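/- **Setting.** The programming language is call-by-value PCF with unit, booleans, naturals, products, sums, equi-recursive types and ML-style references: the types are $\alpha ::= \mathsf{Unit}\mid\mathsf{Bool}\mid\mathsf{Nat}\mid\alpha\Rightarrow\beta\mid\alpha\times\beta\mid\alpha+\beta\mid\mathsf{Ref}(\alpha)\mid X\mid\mu X.\alpha$, and the first-order operations include equality of references. A *model* of type $\Gamma$ is $\mathcal M=(\nu\vec l)(\xi,\sigma)$, where the environment $\xi$ maps the variables of $\Gamma$ to closed values (and its type variables to closed types), the store $\sigma$ maps exactly the free locations (those of $\Gamma$) and the hidden ones $\vec l$ to closed values, and all these are well typed; $\cong$ is contextual congruence of models. The assertions are built from equations $e=e'$ between logical terms (variables, constants, locations, first-order operations, pairs, injections, dereferences $!e$) and reachability predicates $e\hookrightarrow e'$ ($e'$ of a reference type) by $\neg,\wedge,\vee,\supset$, the quantifiers $\forall x^\alpha,\exists x^\alpha$, the hiding quantifiers $\nu x,\overline\nu x$, the type quantifiers $\forall X,\exists X$, the content quantifiers $[!e]C,\langle !e\rangle C$, the (possibly located) evaluation formulae $e\bullet e'=x\{C\}$, and $\square,\Diamond$; $e\,\#\,e'$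 abbreviates $\neg(e'\hookrightarrow e)$. By definition, $\mathcal M\models e_1=e_2$ iff $\mathcal M[u:e_1]\cong\mathcal M[u:e_2]$ (and this is false for terms of different types), and $\mathcal M\models e_1\hookrightarrow e_2$ iff, for every $(\nu\vec l)(\xi,\sigma)\cong\mathcal M$, the location denoted by $e_2$ belongs to the least set that contains the locations occurring in the value of $e_1$ and, with each $l$, the locations occurring in $\sigma(l)$. Quantified variables range over the results of those programs whose execution leaves every model of the given type unchanged up to $\cong$. Write $C\equiv C'$ if $C$ and $C'$ hold in the same models of every type under which they are well typed. A type is *finite* if it contains no function type and no type variable (hence no recursive type); $e\hookrightarrow e'$ is *finite* if $e$ has a finite type. For a finite type $\alpha$, a term $x$ of type $\alpha$ and a term $y$ of type $\mathsf{Ref}(\beta)$, define formulae $x\hookrightarrow^\circ y$ by recursion on $\alpha$, where $B$ is a base type: $$\begin{aligned} x^{B}\hookrightarrow^\circ y&:=\mathsf F,\\ x^{\alpha_1\times\alpha_2}\hookrightarrow^\circ y&:=\exists x_1^{\alpha_1},x_2^{\alpha_2}.\big(x=\langle x_1,x_2\rangle\wedge(x_1\hookrightarrow^\circ y\vee x_2\hookrightarrow^\circ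 y)\big),\\ x^{\alpha_1+\alpha_2}\hookrightarrow^\circ y&:=\textstyle\bigvee_{i=1,2}\exists x'^{\alpha_i}.\big(x=\mathsf{in}_i(x')\wedge x'\hookrightarrow^\circ y\big),\\ x^{\mathsf{Ref}(\alpha)}\hookrightarrow^\circ y&:=x=y\ \vee\ {!x}\hookrightarrow^\circ y,\end{aligned}$$ and formulae $x\hookrightarrow_i y$ ("$y$ is reachable from $x$ in at most $i$ steps") by recursion on $i\in\mathbb N$: $$\begin{aligned} x\hookrightarrow_0 y&:=(x=y),\qquad x^{B}\hookrightarrow_{n+1}y:=\mathsf F,\\ x^{\alpha_1\times\alpha_2}\hookrightarrow_{n+1}y&:=\exists x_1^{\alpha_1},x_2^{\alpha_2}.\big(x=\langle x_1,x_2\rangle\wedge(x_1\hookrightarrow_n y\vee x_2\hookrightarrow_n y)\big)\vee x\hookrightarrow_n y,\\ x^{\alpha_1+\alpha_2}\hookrightarrow_{n+1}y&:=\textstyle\bigvee_{i=1,2}\exists x'^{\alpha_i}.\big(x=\mathsf{in}_i(x')\wedge x'\hookrightarrow_n y\big)\vee x\hookrightarrow_n y,\\ x^{\mathsf{Ref}(\alpha)}\hookrightarrow_{n+1}y&:={!x}\hookrightarrow_n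 y\ \vee\ x\hookrightarrow_n y .\end{aligned}$$ Bound variables are chosen fresh. **Theorem.** 1. Let $C$ be an assertion that is well typed under $\Gamma$ and in which every reachability predicate is finite. Then there is an assertion $C'$, well typed under $\Gamma$, in which no reachability predicate occurs and for which $C\equiv C'$. 2. Let $\alpha$ be finite, $x$ a term of type $\alpha$ and $y$ a term of type $\mathsf{Ref}(\beta)$. Then for every model $\mathcal M$ (of a type under which $x$, $y$ are so typed): (a) $\mathcal M\models x\hookrightarrow y$ iff $\mathcal M\models x\hookrightarrow_i y$ for some $i\in\mathbb N$; (b) $\mathcal M\models x\hookrightarrow^\circ y$ iff $\mathcal M\models x\hookrightarrow_i y$ for some $i\in\mathbb N$; (c) $\mathcal M\models x\hookrightarrow y$ iff $\mathcal M\models x\hookrightarrow^\circ y$. -/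

import Mathlib

namespace LocalState

/-! ### Types -/

/-- Types. `tvar` is a free (or formula-quantified) type variable; the variables bound by `mu`
are the de Bruijn indices `bvar`. -/
inductive Ty : Type
  | unit : Ty
  | bool : Ty
  | nat : Ty
  | arrow : Ty → Ty → Ty
  | prod : Ty → Ty → Ty
  | sum : Ty → Ty → Ty
  | ref : Ty → Ty
  | tvar : ℕ → Ty
  | bvar : ℕ → Ty
  | mu : Ty → Ty

namespace Ty

/-- Every `bvar` of the type is bound by one of its `mu`s or by one of `k` surrounding ones. -/
def LCAt : ℕ → Ty → Prop
  | _, unit => True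
  | _, bool => True
  | _, nat => True
  | k, arrow a b => LCAt k a ∧ LCAt k b
  | k, prod a b => LCAt k a ∧ LCAt k b
  | k, sum a b => LCAt k a ∧ LCAt k b
  | k, ref a => LCAt k a
  | _, tvar _ => True
  | k, bvar n => n < k
  | k, mu a => LCAt (k + 1) a

/-- Proper types: no dangling de Bruijn index. -/
def LC (a : Ty) : Prop := LCAt 0 a

/-- The type variable `X` occurs in the type. -/
def HasTVar (X : ℕ) : Ty → Prop
  | unit => False
  | bool => False
  | nat => False
  | arrow a b => HasTVar X a ∨ HasTVar X b
  | prod a b => HasTVar X a ∨ HasTVar X b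
  | sum a b => HasTVar X a ∨ HasTVar X b
  | ref a => HasTVar X a
  | tvar Y => X = Y
  | bvar _ => False
  | mu a => HasTVar X a

/-- Closed types. -/
def Closed (a : Ty) : Prop := a.LC ∧ ∀ X, ¬ HasTVar X a

/-- Replace `bvar k` by the (locally closed) type `s`. -/
def instB (s : Ty) : ℕ → Ty → Ty
  | _, unit => unit
  | _, bool => bool
  | _, nat => nat
  | k, arrow a b => arrow (instB s k a) (instB s k b)
  | k, prod a b => prod (instB s k a) (instB s k b)
  | k, sum a b => sum (instB s k a) (instB s k b)
  | k, ref a => ref (instB s k a)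
  | _, tvar X => tvar X
  | k, bvar n => if n = k then s else bvar n
  | k, mu a => mu (instB s (k + 1) a)

/-- Replace the type variables by (closed) types. -/
def inst (δ : ℕ → Ty) : Ty → Ty
  | unit => unit
  | bool => bool
  | nat => nat
  | arrow a b => arrow (inst δ a) (inst δ b)
  | prod a b => prod (inst δ a) (inst δ b)
  | sum a b => sum (inst δ a) (inst δ b)
  | ref a => ref (inst δ a)
  | tvar X => δ X
  | bvar n => bvar n
  | mu a => mu (inst δ a)

/-- Zero or more unfoldings `μX.a ↦ a[μX.a/X]` at the root. -/
inductive Unfolds : Ty → Ty → Prop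
  | refl (a : Ty) : Unfolds a a
  | step {a b : Ty} : Unfolds (instB (mu a) 0 a) b → Unfolds (mu a) b

/-- The same root constructor (other than `mu`), with immediate subtypes related by `R`. -/
inductive Match (R : Ty → Ty → Prop) : Ty → Ty → Prop
  | unit : Match R unit unit
  | bool : Match R bool bool
  | nat : Match R nat nat
  | arrow {a b c d : Ty} : R a c → R b d → Match R (arrow a b) (arrow c d)
  | prod {a b c d : Ty} : R a c → R b d → Match R (prod a b) (prod c d)
  | sum {a b c d : Ty} : R a c → R b d → Match R (sum a b) (sum c d)
  | ref {a b : Ty} : R a b → Match R (ref a) (ref b)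
  | tvar (X : ℕ) : Match R (tvar X) (tvar X)

/-- The root of the type is a proper type constructor. -/
def IsHead : Ty → Prop
  | bvar _ => False
  | mu _ => False
  | _ => True

/-- `R` relates only types whose infinite unfoldings agree. -/
def IsBisim (R : Ty → Ty → Prop) : Prop :=
  ∀ a b, R a b →
    (∀ a', Unfolds a a' → a'.IsHead → ∃ b', Unfolds b b' ∧ Match R a' b') ∧
    (∀ b', Unfolds b b' → b'.IsHead → ∃ a', Unfolds a a' ∧ Match R a' b')

/-- Equality of equi-recursive types: the two infinite unfoldings are the same tree. -/
def Eqv (a b : Ty) : Prop := ∃ R, IsBisim R ∧ R a b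

/-- Finite types: no function type and no type variable (hence no recursive type). -/
def IsFinite : Ty → Prop
  | unit => True
  | bool => True
  | nat => True
  | arrow _ _ => False
  | prod a b => IsFinite a ∧ IsFinite b
  | sum a b => IsFinite a ∧ IsFinite b
  | ref a => IsFinite a
  | tvar _ => False
  | bvar _ => False
  | mu _ => False

end Ty

/-! ### Programs -/

inductive UnOp : Type
  | not

/-- Binary first-order operations; `eq` compares data of base type and references. -/
inductive BinOp : Type
  | add | sub | mul | le | and | or | eq

/-- Programs. Variables are de Bruijn indices; indices that exceed the number of enclosing binders
are the free variables. In `recfn a b M` (that is, `μf^{a⇒b}.λy^a.M`) index `0` of `M` is `y` and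
index `1` is `f`. -/
inductive Term : Type
  | var : ℕ → Term
  | unit : Term
  | bool : Bool → Term
  | nat : ℕ → Term
  | loc : ℕ → Term
  | lam : Ty → Term → Term
  | recfn : Ty → Ty → Term → Term
  | app : Term → Term → Term
  | assign : Term → Term → Term
  | ref : Term → Term
  | deref : Term → Term
  | un : UnOp → Term → Term
  | bin : BinOp → Term → Term → Term
  | fst : Term → Term
  | snd : Term → Term
  | pair : Term → Term → Term
  /-- first injection into the sum of the two types -/
  | inl : Ty → Ty → Term → Term
  /-- second injection into the sum of the two types -/
  | inr : Ty → Ty → Term → Term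
  | cond : Term → Term → Term → Term
  /-- `caseOf M a N b N'` branches to `N` (binding a datum of type `a`) or `N'` (of type `b`) -/
  | caseOf : Term → Ty → Term → Ty → Term → Term

namespace Term

def IsValue : Term → Prop
  | var _ => True
  | unit => True
  | bool _ => True
  | nat _ => True
  | loc _ => True
  | lam _ _ => True
  | recfn _ _ _ => True
  | pair M N => IsValue M ∧ IsValue N
  | inl _ _ M => IsValue M
  | inr _ _ M => IsValue M
  | _ => False

/-- Free locations. -/
def fl : Term → Set ℕ
  | var _ => ∅
  | unit => ∅
  | bool _ => ∅
  | nat _ => ∅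
  | loc l => {l}
  | lam _ M => fl M
  | recfn _ _ M => fl M
  | app M N => fl M ∪ fl N
  | assign M N => fl M ∪ fl N
  | ref M => fl M
  | deref M => fl M
  | un _ M => fl M
  | bin _ M N => fl M ∪ fl N
  | fst M => fl M
  | snd M => fl M
  | pair M N => fl M ∪ fl N
  | inl _ _ M => fl M
  | inr _ _ M => fl M
  | cond M N P => fl M ∪ fl N ∪ fl P
  | caseOf M _ N _ P => fl M ∪ fl N ∪ fl P

/-- A renaming of the variables, pushed under one binder. -/
def liftR (r : ℕ → ℕ) : ℕ → ℕ
  | 0 => 0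
  | n + 1 => r n + 1

def rename (r : ℕ → ℕ) : Term → Term
  | var n => var (r n)
  | unit => unit
  | bool b => bool b
  | nat n => nat n
  | loc l => loc l
  | lam a M => lam a (rename (liftR r) M)
  | recfn a b M => recfn a b (rename (liftR (liftR r)) M)
  | app M N => app (rename r M) (rename r N)
  | assign M N => assign (rename r M) (rename r N)
  | ref M => ref (rename r M)
  | deref M => deref (rename r M)
  | un o M => un o (rename r M)
  | bin o M N => bin o (rename r M) (rename r N)
  | fst M => fst (rename r M)
  | snd M => snd (rename r M)
  | pair M N => pair (rename r M) (rename r N)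
  | inl a b M => inl a b (rename r M)
  | inr a b M => inr a b (rename r M)
  | cond M N P => cond (rename r M) (rename r N) (rename r P)
  | caseOf M a N b P =>
      caseOf (rename r M) a (rename (liftR r) N) b (rename (liftR r) P)

/-- A substitution, pushed under one binder. -/
def liftS (s : ℕ → Term) : ℕ → Term
  | 0 => var 0
  | n + 1 => rename Nat.succ (s n)

/-- Capture-avoiding simultaneous substitution. -/
def subst (s : ℕ → Term) : Term → Term
  | var n => s n
  | unit => unit
  | bool b => bool b
  | nat n => nat n
  | loc l => loc l
  | lam a M => lam a (subst (liftS s) M)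
  | recfn a b M => recfn a b (subst (liftS (liftS s)) M)
  | app M N => app (subst s M) (subst s N)
  | assign M N => assign (subst s M) (subst s N)
  | ref M => ref (subst s M)
  | deref M => deref (subst s M)
  | un o M => un o (subst s M)
  | bin o M N => bin o (subst s M) (subst s N)
  | fst M => fst (subst s M)
  | snd M => snd (subst s M)
  | pair M N => pair (subst s M) (subst s N)
  | inl a b M => inl a b (subst s M)
  | inr a b M => inr a b (subst s M)
  | cond M N P => cond (subst s M) (subst s N) (subst s P)
  | caseOf M a N b P =>
      caseOf (subst s M) a (subst (liftS s) N) b (subst (liftS s) P)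

/-- The substitution `V` for index `0`, lowering all other indices by one. -/
def single (V : Term) : ℕ → Term
  | 0 => V
  | n + 1 => var n

/-- `M[V/x]`, where `x` is index `0` of `M`. -/
def subst1 (V M : Term) : Term := subst (single V) M

/-- `M[V/y][W/f]`, where `y` is index `0` and `f` is index `1` of `M`. -/
def subst2 (V W M : Term) : Term :=
  subst (fun n => match n with
    | 0 => V
    | 1 => W
    | m + 2 => var m) M

/-- The substitution given by an environment: variable `n` becomes the `n`-th entry. -/
def envSubst (ξ : List Term) (n : ℕ) : Term := ξ.getD n (var n)

/-- Weakening by `k` variables. -/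
def shift (k : ℕ) (M : Term) : Term := rename (fun n => n + k) M

/-- `let x^a = M in N`. -/
def letE (a : Ty) (M N : Term) : Term := app (lam a N) M

/-- `M ; N`. -/
def seq (M N : Term) : Term := app (lam Ty.unit (shift 1 N)) M

end Term

def UnOp.eval : UnOp → Term → Option Term
  | .not, .bool b => some (.bool (!b))
  | _, _ => none

def BinOp.eval : BinOp → Term → Term → Option Term
  | .add, .nat m, .nat n => some (.nat (m + n))
  | .sub, .nat m, .nat n => some (.nat (m - n))
  | .mul, .nat m, .nat n => some (.nat (m * n))
  | .le, .nat m, .nat n => some (.bool (decide (m ≤ n)))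
  | .and, .bool a, .bool b => some (.bool (a && b))
  | .or, .bool a, .bool b => some (.bool (a || b))
  | .eq, .unit, .unit => some (.bool true)
  | .eq, .bool a, .bool b => some (.bool (decide (a = b)))
  | .eq, .nat m, .nat n => some (.bool (decide (m = n)))
  | .eq, .loc l, .loc l' => some (.bool (decide (l = l')))
  | _, _, _ => none

/-- `UnOp.Sig o a b`: the operation takes a datum of type `a` to one of type `b`. -/
inductive UnOp.Sig : UnOp → Ty → Ty → Prop
  | not : UnOp.Sig .not .bool .bool

/-- `BinOp.Sig o a b c`: the operation takes data of types `a` and `b` to one of type `c`. -/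
inductive BinOp.Sig : BinOp → Ty → Ty → Ty → Prop
  | add : BinOp.Sig .add .nat .nat .nat
  | sub : BinOp.Sig .sub .nat .nat .nat
  | mul : BinOp.Sig .mul .nat .nat .nat
  | le : BinOp.Sig .le .nat .nat .bool
  | and : BinOp.Sig .and .bool .bool .bool
  | or : BinOp.Sig .or .bool .bool .bool
  | eqUnit : BinOp.Sig .eq .unit .unit .bool
  | eqBool : BinOp.Sig .eq .bool .bool .bool
  | eqNat : BinOp.Sig .eq .nat .nat .bool
  | eqRef (a : Ty) : BinOp.Sig .eq (.ref a) (.ref a) .bool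

/-- Typing of programs. `S l = some a` says that the location `l` has type `Ref a`;
`G` lists the types of the variables. -/
inductive HasType (S : ℕ → Option Ty) : List Ty → Term → Ty → Prop
  | var {G : List Ty} {n : ℕ} {a : Ty} : G[n]? = some a → HasType S G (.var n) a
  | unit {G : List Ty} : HasType S G .unit .unit
  | bool {G : List Ty} (b : Bool) : HasType S G (.bool b) .bool
  | nat {G : List Ty} (n : ℕ) : HasType S G (.nat n) .nat
  | loc {G : List Ty} {l : ℕ} {a : Ty} : S l = some a → HasType S G (.loc l) (.ref a)
  | lam {G : List Ty} {a b : Ty} {M : Term} :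
      a.LC → HasType S (a :: G) M b → HasType S G (.lam a M) (.arrow a b)
  | recfn {G : List Ty} {a b : Ty} {M : Term} :
      a.LC → b.LC → HasType S (a :: .arrow a b :: G) M b →
      HasType S G (.recfn a b M) (.arrow a b)
  | app {G : List Ty} {a b : Ty} {M N : Term} :
      HasType S G M (.arrow a b) → HasType S G N a → HasType S G (.app M N) b
  | assign {G : List Ty} {a : Ty} {M N : Term} :
      HasType S G M (.ref a) → HasType S G N a → HasType S G (.assign M N) .unit
  | ref {G : List Ty} {a : Ty} {M : Term} : HasType S G M a → HasType S G (.ref M) (.ref a)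
  | deref {G : List Ty} {a : Ty} {M : Term} : HasType S G M (.ref a) → HasType S G (.deref M) a
  | un {G : List Ty} {o : UnOp} {a b : Ty} {M : Term} :
      o.Sig a b → HasType S G M a → HasType S G (.un o M) b
  | bin {G : List Ty} {o : BinOp} {a b c : Ty} {M N : Term} :
      o.Sig a b c → HasType S G M a → HasType S G N b → HasType S G (.bin o M N) c
  | fst {G : List Ty} {a b : Ty} {M : Term} : HasType S G M (.prod a b) → HasType S G (.fst M) a
  | snd {G : List Ty} {a b : Ty} {M : Term} : HasType S G M (.prod a b) → HasType S G (.snd M) b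
  | pair {G : List Ty} {a b : Ty} {M N : Term} :
      HasType S G M a → HasType S G N b → HasType S G (.pair M N) (.prod a b)
  | inl {G : List Ty} {a b : Ty} {M : Term} :
      a.LC → b.LC → HasType S G M a → HasType S G (.inl a b M) (.sum a b)
  | inr {G : List Ty} {a b : Ty} {M : Term} :
      a.LC → b.LC → HasType S G M b → HasType S G (.inr a b M) (.sum a b)
  | cond {G : List Ty} {a : Ty} {M N P : Term} :
      HasType S G M .bool → HasType S G N a → HasType S G P a → HasType S G (.cond M N P) a
  | caseOf {G : List Ty} {a b c : Ty} {M N P : Term} :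
      a.LC → b.LC → HasType S G M (.sum a b) → HasType S (a :: G) N c → HasType S (b :: G) P c →
      HasType S G (.caseOf M a N b P) c
  /-- types with the same infinite unfolding are interchangeable -/
  | conv {G : List Ty} {a b : Ty} {M : Term} :
      HasType S G M a → Ty.Eqv a b → b.LC → HasType S G M b

/-! ### Reduction -/

/-- Stores: partial maps from locations to values (finite in every model below). -/
abbrev Store := ℕ → Option Term

/-- Configurations `(ν l₁ … lₙ)(M, σ)`. -/
structure Config where
  hid : Finset ℕ
  prog : Term
  store : Store

/-- One-step call-by-value reduction, closed under left-to-right evaluation contexts. A new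
reference is added to the hidden locations. -/
inductive Step : Config → Config → Prop
  | beta {h : Finset ℕ} {σ : Store} {a : Ty} {M V : Term} : V.IsValue →
      Step ⟨h, .app (.lam a M) V, σ⟩ ⟨h, Term.subst1 V M, σ⟩
  | unroll {h : Finset ℕ} {σ : Store} {a b : Ty} {M V : Term} : V.IsValue →
      Step ⟨h, .app (.recfn a b M) V, σ⟩ ⟨h, Term.subst2 V (.recfn a b M) M, σ⟩
  | fst {h : Finset ℕ} {σ : Store} {V W : Term} : V.IsValue → W.IsValue →
      Step ⟨h, .fst (.pair V W), σ⟩ ⟨h, V, σ⟩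
  | snd {h : Finset ℕ} {σ : Store} {V W : Term} : V.IsValue → W.IsValue →
      Step ⟨h, .snd (.pair V W), σ⟩ ⟨h, W, σ⟩
  | condT {h : Finset ℕ} {σ : Store} {M N : Term} :
      Step ⟨h, .cond (.bool true) M N, σ⟩ ⟨h, M, σ⟩
  | condF {h : Finset ℕ} {σ : Store} {M N : Term} :
      Step ⟨h, .cond (.bool false) M N, σ⟩ ⟨h, N, σ⟩
  | caseL {h : Finset ℕ} {σ : Store} {a b c d : Ty} {V N P : Term} : V.IsValue →
      Step ⟨h, .caseOf (.inl c d V) a N b P, σ⟩ ⟨h, Term.subst1 V N, σ⟩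
  | caseR {h : Finset ℕ} {σ : Store} {a b c d : Ty} {V N P : Term} : V.IsValue →
      Step ⟨h, .caseOf (.inr c d V) a N b P, σ⟩ ⟨h, Term.subst1 V P, σ⟩
  | un {h : Finset ℕ} {σ : Store} {o : UnOp} {V W : Term} : o.eval V = some W →
      Step ⟨h, .un o V, σ⟩ ⟨h, W, σ⟩
  | bin {h : Finset ℕ} {σ : Store} {o : BinOp} {V V' W : Term} : o.eval V V' = some W →
      Step ⟨h, .bin o V V', σ⟩ ⟨h, W, σ⟩
  | deref {h : Finset ℕ} {σ : Store} {l : ℕ} {V : Term} : σ l = some V →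
      Step ⟨h, .deref (.loc l), σ⟩ ⟨h, V, σ⟩
  | assign {h : Finset ℕ} {σ : Store} {l : ℕ} {V W : Term} : V.IsValue → σ l = some W →
      Step ⟨h, .assign (.loc l) V, σ⟩ ⟨h, .unit, Function.update σ l (some V)⟩
  | ref {h : Finset ℕ} {σ : Store} {l : ℕ} {V : Term} : V.IsValue → σ l = none → l ∉ h →
      Step ⟨h, .ref V, σ⟩ ⟨insert l h, .loc l, Function.update σ l (some V)⟩
  | appL {h h' : Finset ℕ} {σ σ' : Store} {M M' N : Term} :
      Step ⟨h, M, σ⟩ ⟨h', M', σ'⟩ → Step ⟨h, .app M N, σ⟩ ⟨h', .app M' N, σ'⟩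
  | appR {h h' : Finset ℕ} {σ σ' : Store} {V N N' : Term} : V.IsValue →
      Step ⟨h, N, σ⟩ ⟨h', N', σ'⟩ → Step ⟨h, .app V N, σ⟩ ⟨h', .app V N', σ'⟩
  | pairL {h h' : Finset ℕ} {σ σ' : Store} {M M' N : Term} :
      Step ⟨h, M, σ⟩ ⟨h', M', σ'⟩ → Step ⟨h, .pair M N, σ⟩ ⟨h', .pair M' N, σ'⟩
  | pairR {h h' : Finset ℕ} {σ σ' : Store} {V N N' : Term} : V.IsValue →
      Step ⟨h, N, σ⟩ ⟨h', N', σ'⟩ → Step ⟨h, .pair V N, σ⟩ ⟨h', .pair V N', σ'⟩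
  | fstC {h h' : Finset ℕ} {σ σ' : Store} {M M' : Term} :
      Step ⟨h, M, σ⟩ ⟨h', M', σ'⟩ → Step ⟨h, .fst M, σ⟩ ⟨h', .fst M', σ'⟩
  | sndC {h h' : Finset ℕ} {σ σ' : Store} {M M' : Term} :
      Step ⟨h, M, σ⟩ ⟨h', M', σ'⟩ → Step ⟨h, .snd M, σ⟩ ⟨h', .snd M', σ'⟩
  | inlC {h h' : Finset ℕ} {σ σ' : Store} {a b : Ty} {M M' : Term} :
      Step ⟨h, M, σ⟩ ⟨h', M', σ'⟩ → Step ⟨h, .inl a b M, σ⟩ ⟨h', .inl a b M', σ'⟩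
  | inrC {h h' : Finset ℕ} {σ σ' : Store} {a b : Ty} {M M' : Term} :
      Step ⟨h, M, σ⟩ ⟨h', M', σ'⟩ → Step ⟨h, .inr a b M, σ⟩ ⟨h', .inr a b M', σ'⟩
  | unC {h h' : Finset ℕ} {σ σ' : Store} {o : UnOp} {M M' : Term} :
      Step ⟨h, M, σ⟩ ⟨h', M', σ'⟩ → Step ⟨h, .un o M, σ⟩ ⟨h', .un o M', σ'⟩
  | binL {h h' : Finset ℕ} {σ σ' : Store} {o : BinOp} {M M' N : Term} :
      Step ⟨h, M, σ⟩ ⟨h', M', σ'⟩ → Step ⟨h, .bin o M N, σ⟩ ⟨h', .bin o M' N, σ'⟩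
  | binR {h h' : Finset ℕ} {σ σ' : Store} {o : BinOp} {V N N' : Term} : V.IsValue →
      Step ⟨h, N, σ⟩ ⟨h', N', σ'⟩ → Step ⟨h, .bin o V N, σ⟩ ⟨h', .bin o V N', σ'⟩
  | condC {h h' : Finset ℕ} {σ σ' : Store} {M M' N P : Term} :
      Step ⟨h, M, σ⟩ ⟨h', M', σ'⟩ → Step ⟨h, .cond M N P, σ⟩ ⟨h', .cond M' N P, σ'⟩
  | caseC {h h' : Finset ℕ} {σ σ' : Store} {a b : Ty} {M M' N P : Term} :
      Step ⟨h, M, σ⟩ ⟨h', M', σ'⟩ → Step ⟨h, .caseOf M a N b P, σ⟩ ⟨h', .caseOf M' a N b P, σ'⟩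
  | derefC {h h' : Finset ℕ} {σ σ' : Store} {M M' : Term} :
      Step ⟨h, M, σ⟩ ⟨h', M', σ'⟩ → Step ⟨h, .deref M, σ⟩ ⟨h', .deref M', σ'⟩
  | assignL {h h' : Finset ℕ} {σ σ' : Store} {M M' N : Term} :
      Step ⟨h, M, σ⟩ ⟨h', M', σ'⟩ → Step ⟨h, .assign M N, σ⟩ ⟨h', .assign M' N, σ'⟩
  | assignR {h h' : Finset ℕ} {σ σ' : Store} {V N N' : Term} : V.IsValue →
      Step ⟨h, N, σ⟩ ⟨h', N', σ'⟩ → Step ⟨h, .assign V N, σ⟩ ⟨h', .assign V N', σ'⟩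
  | refC {h h' : Finset ℕ} {σ σ' : Store} {M M' : Term} :
      Step ⟨h, M, σ⟩ ⟨h', M', σ'⟩ → Step ⟨h, .ref M, σ⟩ ⟨h', .ref M', σ'⟩

/-- `c ⇓ c'`: reduction to a value. -/
def EvalsTo (c c' : Config) : Prop := Relation.ReflTransGen Step c c' ∧ c'.prog.IsValue

/-- `c ⇓`. -/
def Converges (c : Config) : Prop := ∃ c', EvalsTo c c'

/-! ### Models -/

/-- A closed typing environment: the types of the variables `0, 1, 2, …` of a model, and the
content types of its free locations. -/
structure Env where
  vars : List Ty
  locs : ℕ → Option Ty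

/-- `Γ · x : a`, where `x` is the next unused variable. -/
def Env.snoc (Γ : Env) (a : Ty) : Env := ⟨Γ.vars ++ [a], Γ.locs⟩

/-- `(ν l₁ … lₙ)(ξ, σ)`: hidden locations, environment and store. The environment lists the
values of the variables `0, 1, 2, …`. -/
structure Model where
  hid : Finset ℕ
  env : List Term
  store : Store

namespace Model

/-- `M[x : V]`, where `x` is the next unused variable. -/
def push (M : Model) (V : Term) : Model := ⟨M.hid, M.env ++ [V], M.store⟩

/-- `M / x`, where `x` is the last variable. -/
def pop (M : Model) : Model := ⟨M.hid, M.env.dropLast, M.store⟩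

/-- `(ν l) M`. -/
def hide (l : ℕ) (M : Model) : Model := ⟨insert l M.hid, M.env, M.store⟩

/-- `M[l ↦ V]`. -/
def update (M : Model) (l : ℕ) (V : Term) : Model :=
  ⟨M.hid, M.env, Function.update M.store l (some V)⟩

end Model

/-- `M` is a model of type `Γ`. Here `S` types all its locations, free and hidden, and the store
is defined exactly on these. -/
def IsModel (Γ : Env) (M : Model) : Prop :=
  (∀ a ∈ Γ.vars, a.Closed) ∧
  {l | M.store l ≠ none}.Finite ∧
  ∃ S : ℕ → Option Ty,
    (∀ l a, Γ.locs l = some a → S l = some a) ∧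
    (∀ l, l ∈ M.hid ↔ S l ≠ none ∧ Γ.locs l = none) ∧
    (∀ l a, S l = some a → a.Closed) ∧
    (∀ l, M.store l = none ↔ S l = none) ∧
    (∀ l a V, S l = some a → M.store l = some V → V.IsValue ∧ HasType S [] V a) ∧
    List.Forall₂ (fun V a => V.IsValue ∧ HasType S [] V a) M.env Γ.vars

/-- The iterated pair `⟨V₁, ⟨V₂, …⟩⟩`. -/
def tuple : List Term → Term
  | [] => .unit
  | V :: Vs => .pair V (tuple Vs)

def tupleTy : List Ty → Ty
  | [] => .unit
  | a :: as => .prod a (tupleTy as)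

/-- Contextual congruence of models of type `Γ`. A context is a program `N` of type `Unit` whose
hole is the variable `0`; the data that fill it are closed, so that filling is substitution. The
locations that occur in `N` are free ones of `Γ`, hence not hidden in either model. -/
def ModelEquiv (Γ : Env) (M M' : Model) : Prop :=
  IsModel Γ M ∧ IsModel Γ M' ∧
  ∀ N, HasType Γ.locs [tupleTy Γ.vars] N .unit →
    (Converges ⟨M.hid, Term.subst1 (tuple M.env) N, M.store⟩ ↔
      Converges ⟨M'.hid, Term.subst1 (tuple M'.env) N, M'.store⟩)

/-- `M[x : N] ⇓ M'`, where `x` is the next unused variable and `N` is a program of type `a`. -/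
def Runs (Γ : Env) (M : Model) (N : Term) (a : Ty) (M' : Model) : Prop :=
  HasType Γ.locs Γ.vars N a ∧ IsModel (Γ.snoc a) M' ∧
  ∃ h V σ, EvalsTo ⟨∅, N.subst (Term.envSubst M.env), M.store⟩ ⟨h, V, σ⟩ ∧
    M' = ⟨M.hid ∪ h, M.env ++ [V], σ⟩

/-- `M ⇝ M'`: evolution by running zero or more programs. -/
inductive Evolves (Γ : Env) (M : Model) : Env → Model → Prop
  | refl : Evolves Γ M Γ M
  | run {Γ₀ : Env} {M₀ : Model} {N : Term} {a : Ty} {M' : Model} :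
      Evolves Γ M Γ₀ M₀ → Runs Γ₀ M₀ N a M' → Evolves Γ M (Γ₀.snoc a) M'

/-- Functional terms of type `a`: running them does not change any model of type `Γ`. -/
def Functional (Γ : Env) (L : Term) (a : Ty) : Prop :=
  HasType Γ.locs Γ.vars L a ∧
  ∀ M M', IsModel Γ M → Runs Γ M L a M' → ModelEquiv Γ M M'.pop

/-- The label closure of `A` in `σ`. -/
inductive Ncl (σ : Store) (A : Set ℕ) : ℕ → Prop
  | base {l : ℕ} : l ∈ A → Ncl σ A l
  | step {l l' : ℕ} {V : Term} : Ncl σ A l → σ l = some V → l' ∈ V.fl → Ncl σ A l'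

/-! ### The assertion language -/

/-- Logical terms; variables are names. -/
inductive LTerm : Type
  | var : ℕ → LTerm
  | unit : LTerm
  | bool : Bool → LTerm
  | nat : ℕ → LTerm
  | loc : ℕ → LTerm
  | un : UnOp → LTerm → LTerm
  | bin : BinOp → LTerm → LTerm → LTerm
  | pair : LTerm → LTerm → LTerm
  | inl : Ty → Ty → LTerm → LTerm
  | inr : Ty → Ty → LTerm → LTerm
  | deref : LTerm → LTerm

/-- Primitive formulae; the remaining connectives are defined from them by duality below. -/
inductive Formula : Type
  /-- `e = e'` -/
  | eq : LTerm → LTerm → Formula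
  | neg : Formula → Formula
  | and : Formula → Formula → Formula
  /-- `∀ x^a. C` -/
  | all : ℕ → Ty → Formula → Formula
  /-- the universal hiding quantifier over hidden references `x` of type `Ref a` -/
  | nuAll : ℕ → Ty → Formula → Formula
  /-- `∀ X. C` -/
  | allT : ℕ → Formula → Formula
  /-- universal content quantification `[!e] C` -/
  | allCon : LTerm → Formula → Formula
  /-- the evaluation formula `e • e' = x^b {C}` -/
  | eval : LTerm → LTerm → ℕ → Ty → Formula → Formula
  /-- the located evaluation formula `e • e' = x^b {C} @ ws`, each `w` in `ws` being listed with
  its content type -/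
  | located : LTerm → LTerm → ℕ → Ty → Formula → List (LTerm × Ty) → Formula
  | box : Formula → Formula
  /-- the reachability predicate `e ↪ e'` -/
  | reach : LTerm → LTerm → Formula

/-- Typing environments of formulae: the types of variable names and the content types of
locations. -/
structure FEnv where
  vars : ℕ → Option Ty
  locs : ℕ → Option Ty

/-- `Γ · x : a`. -/
def FEnv.bind (Γ : FEnv) (x : ℕ) (a : Ty) : FEnv := ⟨Function.update Γ.vars x (some a), Γ.locs⟩

/-- The type variable `X` does not occur in `Γ`. -/
def FEnv.FreshT (Γ : FEnv) (X : ℕ) : Prop :=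
  (∀ x a, Γ.vars x = some a → ¬ Ty.HasTVar X a) ∧ (∀ l a, Γ.locs l = some a → ¬ Ty.HasTVar X a)

namespace LTerm

/-- `Γ ⊢ e : a`. -/
inductive HasType (Γ : FEnv) : LTerm → Ty → Prop
  | var {x : ℕ} {a : Ty} : Γ.vars x = some a → HasType Γ (.var x) a
  | unit : HasType Γ .unit .unit
  | bool (b : Bool) : HasType Γ (.bool b) .bool
  | nat (n : ℕ) : HasType Γ (.nat n) .nat
  | loc {l : ℕ} {a : Ty} : Γ.locs l = some a → HasType Γ (.loc l) (.ref a)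
  | un {o : UnOp} {a b : Ty} {e : LTerm} : o.Sig a b → HasType Γ e a → HasType Γ (.un o e) b
  | bin {o : BinOp} {a b c : Ty} {e e' : LTerm} :
      o.Sig a b c → HasType Γ e a → HasType Γ e' b → HasType Γ (.bin o e e') c
  | pair {a b : Ty} {e e' : LTerm} :
      HasType Γ e a → HasType Γ e' b → HasType Γ (.pair e e') (.prod a b)
  | inl {a b : Ty} {e : LTerm} :
      a.LC → b.LC → HasType Γ e a → HasType Γ (.inl a b e) (.sum a b)
  | inr {a b : Ty} {e : LTerm} :
      a.LC → b.LC → HasType Γ e b → HasType Γ (.inr a b e) (.sum a b)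
  | deref {a : Ty} {e : LTerm} : HasType Γ e (.ref a) → HasType Γ (.deref e) a
  | conv {a b : Ty} {e : LTerm} : HasType Γ e a → Ty.Eqv a b → b.LC → HasType Γ e b

/-- All variable names in the term are smaller than `k`. -/
def VarsBelow (k : ℕ) : LTerm → Prop
  | var x => x < k
  | unit => True
  | bool _ => True
  | nat _ => True
  | loc _ => True
  | un _ e => VarsBelow k e
  | bin _ e e' => VarsBelow k e ∧ VarsBelow k e'
  | pair e e' => VarsBelow k e ∧ VarsBelow k e'
  | inl _ _ e => VarsBelow k e
  | inr _ _ e => VarsBelow k e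
  | deref e => VarsBelow k e

def DerefFree : LTerm → Prop
  | var _ => True
  | unit => True
  | bool _ => True
  | nat _ => True
  | loc _ => True
  | un _ e => DerefFree e
  | bin _ e e' => DerefFree e ∧ DerefFree e'
  | pair e e' => DerefFree e ∧ DerefFree e'
  | inl _ _ e => DerefFree e
  | inr _ _ e => DerefFree e
  | deref _ => False

end LTerm

/-- How the names in a formula are read in a model: `pos x` is the variable of the model that the
name `x` stands for, and `tys X` is the closed type assigned to the type variable `X`. (Keeping
names apart from the variables of a model makes the variables that a model acquires fresh for every
formula, as the bound name convention has it.) -/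
structure Reading where
  pos : ℕ → ℕ
  tys : ℕ → Ty

def Reading.bind (ρ : Reading) (x n : ℕ) : Reading := ⟨Function.update ρ.pos x n, ρ.tys⟩

def Reading.bindT (ρ : Reading) (X : ℕ) (a : Ty) : Reading := ⟨ρ.pos, Function.update ρ.tys X a⟩

namespace LTerm

/-- A logical term as a program. -/
def prog (ρ : Reading) : LTerm → Term
  | var x => .var (ρ.pos x)
  | unit => .unit
  | bool b => .bool b
  | nat n => .nat n
  | loc l => .loc l
  | un o e => .un o (prog ρ e)
  | bin o e e' => .bin o (prog ρ e) (prog ρ e')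
  | pair e e' => .pair (prog ρ e) (prog ρ e')
  | inl a b e => .inl (a.inst ρ.tys) (b.inst ρ.tys) (prog ρ e)
  | inr a b e => .inr (a.inst ρ.tys) (b.inst ρ.tys) (prog ρ e)
  | deref e => .deref (prog ρ e)

/-- The interpretation of a logical term in an environment and a store (always defined for
well-typed terms in models). -/
def den (ρ : Reading) (ξ : List Term) (σ : Store) : LTerm → Option Term
  | var x => ξ[ρ.pos x]?
  | unit => some .unit
  | bool b => some (.bool b)
  | nat n => some (.nat n)
  | loc l => some (.loc l)
  | un o e => (den ρ ξ σ e).bind o.eval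
  | bin o e e' => (den ρ ξ σ e).bind fun V => (den ρ ξ σ e').bind fun W => o.eval V W
  | pair e e' => (den ρ ξ σ e).bind fun V => (den ρ ξ σ e').map fun W => .pair V W
  | inl a b e => (den ρ ξ σ e).map fun V => .inl (a.inst ρ.tys) (b.inst ρ.tys) V
  | inr a b e => (den ρ ξ σ e).map fun V => .inr (a.inst ρ.tys) (b.inst ρ.tys) V
  | deref e => (den ρ ξ σ e).bind fun V => match V with
      | .loc l => σ l
      | _ => none

end LTerm

/-- The program `let xs = !ws in let y^b = N in ws := xs`, of type `Unit`, in the scope of `k`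
further variables. -/
def restoring (N : Term) (b : Ty) : ℕ → List (Term × Ty) → Term
  | k, [] => Term.letE b (N.shift k) .unit
  | k, (w, a) :: ws =>
      Term.letE a (.deref (w.shift k))
        (Term.seq (restoring N b (k + 1) ws) (.assign (w.shift (k + 1)) (.var 0)))

namespace Formula

/-- `Γ ⊢ C`. -/
def WF : FEnv → Formula → Prop
  | Γ, eq e e' => (∃ a, e.HasType Γ a) ∧ (∃ b, e'.HasType Γ b)
  | Γ, neg C => WF Γ C
  | Γ, and C D => WF Γ C ∧ WF Γ D
  | Γ, all x a C => a.LC ∧ WF (Γ.bind x a) C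
  | Γ, nuAll x a C => a.LC ∧ WF (Γ.bind x (.ref a)) C
  | Γ, allT X C => Γ.FreshT X ∧ WF Γ C
  | Γ, allCon e C => (∃ a, e.HasType Γ (.ref a)) ∧ WF Γ C
  | Γ, eval e e' x b C =>
      b.LC ∧ (∃ a, e.HasType Γ (.arrow a b) ∧ e'.HasType Γ a) ∧ WF (Γ.bind x b) C
  | Γ, located e e' x b C ws =>
      b.LC ∧ (∃ a, e.HasType Γ (.arrow a b) ∧ e'.HasType Γ a) ∧ WF (Γ.bind x b) C ∧
      ∀ w ∈ ws, w.2.LC ∧ w.1.HasType Γ (.ref w.2) ∧ w.1.DerefFree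
  | Γ, box C => WF Γ C
  | Γ, reach e e' => (∃ a, e.HasType Γ a) ∧ (∃ b, e'.HasType Γ (.ref b))

/-- The source of every reachability predicate in the formula has a finite type. -/
def FiniteReach : FEnv → Formula → Prop
  | _, eq _ _ => True
  | Γ, neg C => FiniteReach Γ C
  | Γ, and C D => FiniteReach Γ C ∧ FiniteReach Γ D
  | Γ, all x a C => FiniteReach (Γ.bind x a) C
  | Γ, nuAll x a C => FiniteReach (Γ.bind x (.ref a)) C
  | Γ, allT _ C => FiniteReach Γ C
  | Γ, allCon _ C => FiniteReach Γ C
  | Γ, eval _ _ x b C => FiniteReach (Γ.bind x b) C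
  | Γ, located _ _ x b C _ => FiniteReach (Γ.bind x b) C
  | Γ, box C => FiniteReach Γ C
  | Γ, reach e _ => ∃ a, a.IsFinite ∧ e.HasType Γ a

/-- No reachability predicate occurs in the formula. -/
def NoReach : Formula → Prop
  | eq _ _ => True
  | neg C => NoReach C
  | and C D => NoReach C ∧ NoReach D
  | all _ _ C => NoReach C
  | nuAll _ _ C => NoReach C
  | allT _ C => NoReach C
  | allCon _ C => NoReach C
  | eval _ _ _ _ C => NoReach C
  | located _ _ _ _ C _ => NoReach C
  | box C => NoReach C
  | reach _ _ => False

/-- Satisfaction `M ⊨ C` in a model `M` of type `Γ`. -/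
def Sat : Formula → Env → Model → Reading → Prop
  | eq e e', Γ, M, ρ =>
      ∃ a V V', e.den ρ M.env M.store = some V ∧ e'.den ρ M.env M.store = some V' ∧
        ModelEquiv (Γ.snoc a) (M.push V) (M.push V')
  | neg C, Γ, M, ρ => ¬ Sat C Γ M ρ
  | and C D, Γ, M, ρ => Sat C Γ M ρ ∧ Sat D Γ M ρ
  | all x a C, Γ, M, ρ =>
      ∀ L M', Functional Γ L (a.inst ρ.tys) → Runs Γ M L (a.inst ρ.tys) M' →
        Sat C (Γ.snoc (a.inst ρ.tys)) M' (ρ.bind x Γ.vars.length)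
  | nuAll x a C, Γ, M, ρ =>
      ∀ l M', Γ.locs l = none → l ∉ M'.hid →
        IsModel ⟨Γ.vars, Function.update Γ.locs l (some (a.inst ρ.tys))⟩ M' →
        ModelEquiv Γ (M'.hide l) M →
        Sat C (Env.snoc ⟨Γ.vars, Function.update Γ.locs l (some (a.inst ρ.tys))⟩
            (.ref (a.inst ρ.tys)))
          (M'.push (.loc l)) (ρ.bind x Γ.vars.length)
  | allT X C, Γ, M, ρ => ∀ a : Ty, a.Closed → Sat C Γ M (ρ.bindT X a)
  | allCon e C, Γ, M, ρ =>
      ∀ L a l V c, Functional Γ L a → e.den ρ M.env M.store = some (.loc l) →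
        EvalsTo ⟨M.hid, L.subst (Term.envSubst M.env), M.store⟩ c →
        ModelEquiv ⟨[a], Γ.locs⟩ ⟨c.hid, [c.prog], c.store⟩ ⟨M.hid, [V], M.store⟩ →
        IsModel Γ (M.update l V) →
        Sat C Γ (M.update l V) ρ
  | eval e e' x b C, Γ, M, ρ =>
      ∃ M', Runs Γ M (.app (e.prog ρ) (e'.prog ρ)) (b.inst ρ.tys) M' ∧
        Sat C (Γ.snoc (b.inst ρ.tys)) M' (ρ.bind x Γ.vars.length)
  | located e e' x b C ws, Γ, M, ρ =>
      ∃ M', Runs Γ M (.app (e.prog ρ) (e'.prog ρ)) (b.inst ρ.tys) M' ∧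
        Sat C (Γ.snoc (b.inst ρ.tys)) M' (ρ.bind x Γ.vars.length) ∧
        ∀ M'', Runs Γ M
            (restoring (.app (e.prog ρ) (e'.prog ρ)) (b.inst ρ.tys) 0
              (ws.map fun w => (w.1.prog ρ, w.2.inst ρ.tys))) .unit M'' →
          ModelEquiv (Γ.snoc .unit) M'' (M.push .unit)
  | box C, Γ, M, ρ => ∀ Γ' M', Evolves Γ M Γ' M' → Sat C Γ' M' ρ
  | reach e e', Γ, M, ρ =>
      ∀ M', ModelEquiv Γ M' M →
        ∃ V l, e.den ρ M'.env M'.store = some V ∧ e'.den ρ M'.env M'.store = some (.loc l) ∧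
          Ncl M'.store V.fl l

/-! Derived connectives. -/

def or (C D : Formula) : Formula := neg (and (neg C) (neg D))

def imp (C D : Formula) : Formula := neg (and C (neg D))

def ex (x : ℕ) (a : Ty) (C : Formula) : Formula := neg (all x a (neg C))

def nuEx (x : ℕ) (a : Ty) (C : Formula) : Formula := neg (nuAll x a (neg C))

def exT (X : ℕ) (C : Formula) : Formula := neg (allT X (neg C))

def someCon (e : LTerm) (C : Formula) : Formula := neg (allCon e (neg C))

def dia (C : Formula) : Formula := neg (box (neg C))

/-- `e # e'`. -/
def unreach (e e' : LTerm) : Formula := neg (reach e' e)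

/-- Falsity, that is `1 ≠ 1`. -/
def fls : Formula := neg (eq (.nat 1) (.nat 1))

/-- The formula `e^a ↪° e'` given by the inductive clauses for base types, products, sums and
references. Bound names are taken from `k, k + 1, …`. -/
def reachO : Ty → ℕ → LTerm → LTerm → Formula
  | .prod a b, k, e, e' =>
      ex k a (ex (k + 1) b (and (eq e (.pair (.var k) (.var (k + 1))))
        (or (reachO a (k + 2) (.var k) e') (reachO b (k + 2) (.var (k + 1)) e'))))
  | .sum a b, k, e, e' =>
      or (ex k a (and (eq e (.inl a b (.var k))) (reachO a (k + 1) (.var k) e')))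
        (ex k b (and (eq e (.inr a b (.var k))) (reachO b (k + 1) (.var k) e')))
  | .ref a, k, e, e' => or (eq e e') (reachO a k (.deref e) e')
  | _, _, _, _ => fls

/-- The formula `e^a ↪ᵢ e'`: `e'` is reachable from `e` in at most `i` steps. Projections are
expressed by naming the two components. Bound names are taken from `k, k + 1, …`. -/
def reachIn : ℕ → Ty → ℕ → LTerm → LTerm → Formula
  | 0, _, _, e, e' => eq e e'
  | n + 1, .prod a b, k, e, e' =>
      or (ex k a (ex (k + 1) b (and (eq e (.pair (.var k) (.var (k + 1))))
          (or (reachIn n a (k + 2) (.var k) e') (reachIn n b (k + 2) (.var (k + 1)) e')))))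
        (reachIn n (.prod a b) k e e')
  | n + 1, .sum a b, k, e, e' =>
      or (or (ex k a (and (eq e (.inl a b (.var k))) (reachIn n a (k + 1) (.var k) e')))
          (ex k b (and (eq e (.inr a b (.var k))) (reachIn n b (k + 1) (.var k) e'))))
        (reachIn n (.sum a b) k e e')
  | n + 1, .ref a, k, e, e' =>
      or (reachIn n a k (.deref e) e') (reachIn n (.ref a) k e e')
  | _ + 1, _, _, _, _ => fls

end Formula

/-- The reading `ρ` makes the models of type `Δ` models of the formula environment `Γ`: type
variables denote closed types, and each variable name and location of `Γ` has the type that `Γ`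
says. (`Δ` may have further variables and locations.) -/
def Reading.Interprets (ρ : Reading) (Γ : FEnv) (Δ : Env) : Prop :=
  (∀ X, (ρ.tys X).Closed) ∧
  (∀ x a, Γ.vars x = some a → Δ.vars[ρ.pos x]? = some (a.inst ρ.tys)) ∧
  (∀ l a, Γ.locs l = some a → Δ.locs l = some (a.inst ρ.tys))

/-- `C ≡ D` is valid for formulae over `Γ`: they hold in the same models. -/
def Formula.Equivalent (Γ : FEnv) (C D : Formula) : Prop :=
  ∀ (Δ : Env) (ρ : Reading) (M : Model), ρ.Interprets Γ Δ → IsModel Δ M →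
    (C.Sat Δ M ρ ↔ D.Sat Δ M ρ)

end LocalState

/-!
Reachability from a value of finite type is decided by a program: it compares the references found
along the structure of the type with a given one. Congruent models agree on the outcome of this
program, so `e ↪ e'` may be read in the given model alone, without quantifying over the models
congruent to it.

The components of a value of finite type are results of functional programs: projections, and case
analyses that diverge on the other branch. Hence the existential quantifiers of `e ↪° e'` and
`e ↪ᵢ e'` range over these components. Injections carry type annotations, which are determined only
up to equality of equi-recursive types, but annotations have no effect on convergence, so
`e = inᵢ(x)` holds of the component `x` all the same. Induction on the type then shows that both
formulae amount to reachability, the nesting of products, sums and references in the type of `e`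
bounding the number of steps. A finite reachability predicate in an assertion is replaced by
`e ↪° e'` with bound names above all its variables.
-/

namespace LocalState

/-! ### Equi-recursive types -/

namespace Ty

theorem Unfolds.trans {a b c : Ty} (h : Unfolds a b) (h' : Unfolds b c) : Unfolds a c := by
  induction h with
  | refl => exact h'
  | step _ ih => exact .step (ih h')

theorem Unfolds.eq_of_isHead {a b : Ty} (h : Unfolds a b) (ha : a.IsHead) : b = a := by
  cases h with
  | refl => rfl
  | step _ => exact ha.elim

theorem Match.mono {R R' : Ty → Ty → Prop} (h : ∀ a b, R a b → R' a b) {a b : Ty}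
    (m : Match R a b) : Match R' a b := by
  cases m <;> constructor <;> exact h _ _ ‹_›

theorem Match.of_isHead {R : Ty → Ty → Prop} (h : ∀ a, R a a) {a : Ty} (ha : a.IsHead) :
    Match R a a := by
  cases a <;> first | exact ha.elim | (constructor <;> exact h _)

theorem Match.swap {R : Ty → Ty → Prop} {a b : Ty} (m : Match R a b) :
    Match (fun x y => R y x) b a := by
  cases m <;> constructor <;> assumption

theorem Match.comp {R R' : Ty → Ty → Prop} {a b c : Ty} (m : Match R a b) (m' : Match R' b c) :
    Match (fun x z => ∃ y, R x y ∧ R' y z) a c := by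
  cases m <;> cases m' <;> constructor <;> exact ⟨_, ‹_›, ‹_›⟩

theorem Match.isHead_left {R : Ty → Ty → Prop} {a b : Ty} (m : Match R a b) : a.IsHead := by
  cases m <;> trivial

theorem Match.isHead_right {R : Ty → Ty → Prop} {a b : Ty} (m : Match R a b) : b.IsHead := by
  cases m <;> trivial

theorem IsBisim.of_symm {R : Ty → Ty → Prop} (hs : ∀ a b, R a b → R b a)
    (hR : ∀ a b, R a b → ∀ a', Unfolds a a' → a'.IsHead → ∃ b', Unfolds b b' ∧ Match R a' b') :
    IsBisim R := by
  refine fun a b h => ⟨hR a b h, fun b' u hd => ?_⟩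
  obtain ⟨a', ua, m⟩ := hR b a (hs a b h) b' u hd
  exact ⟨a', ua, m.swap.mono fun x y => hs y x⟩

theorem Eqv.refl (a : Ty) : Eqv a a := by
  refine ⟨Eq, .of_symm (fun _ _ => Eq.symm) ?_, rfl⟩
  rintro a _ rfl a' u hd
  exact ⟨a', u, .of_isHead (fun _ => rfl) hd⟩

theorem Eqv.symm {a b : Ty} : Eqv a b → Eqv b a := by
  rintro ⟨R, hR, h⟩
  refine ⟨fun x y => R y x, fun x y hxy => ⟨fun a' h h' => ?_, fun a' h h' => ?_⟩, h⟩
  · obtain ⟨b', hb, m⟩ := (hR _ _ hxy).2 a' h h'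
    exact ⟨b', hb, m.swap⟩
  · obtain ⟨b', hb, m⟩ := (hR _ _ hxy).1 a' h h'
    exact ⟨b', hb, m.swap⟩

theorem Eqv.exists_unfolds_match {a b a' : Ty} (h : Eqv a b) (u : Unfolds a a') (hd : a'.IsHead) :
    ∃ b', Unfolds b b' ∧ Match Eqv a' b' := by
  obtain ⟨R, hR, h⟩ := h
  obtain ⟨b', ub, m⟩ := (hR _ _ h).1 a' u hd
  exact ⟨b', ub, m.mono fun _ _ h => ⟨R, hR, h⟩⟩

theorem Eqv.trans {a b c : Ty} (h : Eqv a b) (h' : Eqv b c) : Eqv a c := by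
  refine ⟨fun x z => ∃ y, Eqv x y ∧ Eqv y z, .of_symm ?_ ?_, b, h, h'⟩
  · exact fun x z ⟨y, hxy, hyz⟩ => ⟨y, hyz.symm, hxy.symm⟩
  · rintro x z ⟨y, hxy, hyz⟩ x' u hd
    obtain ⟨y', uy, m⟩ := hxy.exists_unfolds_match u hd
    obtain ⟨z', uz, m'⟩ := hyz.exists_unfolds_match uy m.isHead_right
    exact ⟨z', uz, m.comp m'⟩

theorem Eqv.match_of_isHead {a b : Ty} (h : Eqv a b) (ha : a.IsHead) (hb : b.IsHead) :
    Match Eqv a b := by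
  obtain ⟨b', ub, m⟩ := h.exists_unfolds_match (.refl a) ha
  rwa [ub.eq_of_isHead hb] at m

theorem Eqv.of_match {a b : Ty} (m : Match Eqv a b) : Eqv a b := by
  refine ⟨fun x y => Eqv x y ∨ Match Eqv x y, .of_symm ?_ ?_, .inr m⟩
  · exact fun x y h => h.imp Eqv.symm fun m => m.swap.mono fun _ _ => Eqv.symm
  · rintro x y (h | m) x' u hd
    · obtain ⟨y', uy, m⟩ := h.exists_unfolds_match u hd
      exact ⟨y', uy, m.mono fun _ _ => .inl⟩
    · rw [u.eq_of_isHead m.isHead_left]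
      exact ⟨y, .refl y, m.mono fun _ _ => .inl⟩

theorem LCAt.mono {a : Ty} : ∀ {j k : ℕ}, LCAt j a → j ≤ k → LCAt k a := by
  induction a with
  | unit | bool | nat | tvar => intros; trivial
  | arrow a b iha ihb | prod a b iha ihb | sum a b iha ihb =>
      exact fun h hjk => ⟨iha h.1 hjk, ihb h.2 hjk⟩
  | ref a ih => exact fun h hjk => ih (j := _) h hjk
  | bvar n => exact fun h hjk => lt_of_lt_of_le h hjk
  | mu a ih => exact fun h hjk => ih (j := _ + 1) h (Nat.succ_le_succ hjk)

theorem instB_of_lcAt {a : Ty} (s : Ty) : ∀ {k : ℕ}, LCAt k a → instB s k a = a := by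
  induction a with
  | unit | bool | nat | tvar => intros; rfl
  | arrow a b iha ihb | prod a b iha ihb | sum a b iha ihb =>
      intro k h; simp only [instB, iha h.1, ihb h.2]
  | ref a ih => intro k h; simp only [instB, ih (k := k) h]
  | bvar n => intro k h; exact if_neg (ne_of_lt h)
  | mu a ih => intro k h; simp only [instB, ih (k := k + 1) h]

theorem inst_instB {δ : ℕ → Ty} (hδ : ∀ X, (δ X).LC) (s a : Ty) :
    ∀ k, (instB s k a).inst δ = instB (s.inst δ) k (a.inst δ) := by
  induction a with
  | unit | bool | nat => intros; rfl
  | arrow a b iha ihb | prod a b iha ihb | sum a b iha ihb =>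
      intro k; simp only [instB, inst, iha, ihb]
  | ref a ih | mu a ih => intro k; simp only [instB, inst, ih]
  | tvar X => exact fun k => (instB_of_lcAt _ ((hδ X).mono (Nat.zero_le k))).symm
  | bvar n => intro k; simp only [instB, inst]; split <;> rfl

theorem LCAt.inst {δ : ℕ → Ty} (hδ : ∀ X, (δ X).LC) {a : Ty} :
    ∀ {k : ℕ}, LCAt k a → LCAt k (a.inst δ) := by
  induction a with
  | unit | bool | nat => intros; trivial
  | arrow a b iha ihb | prod a b iha ihb | sum a b iha ihb => exact fun h => ⟨iha h.1, ihb h.2⟩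
  | ref a ih => exact fun h => ih (k := _) h
  | tvar X => exact fun _ => (hδ X).mono (Nat.zero_le _)
  | bvar n => exact fun h => h
  | mu a ih => exact fun h => ih (k := _ + 1) h

theorem not_hasTVar_inst {δ : ℕ → Ty} (hδ : ∀ X, (δ X).Closed) (a : Ty) (X : ℕ) :
    ¬ HasTVar X (a.inst δ) := by
  induction a with
  | unit | bool | nat | bvar => exact id
  | arrow a b iha ihb | prod a b iha ihb | sum a b iha ihb => exact fun h => h.elim iha ihb
  | ref _ ih | mu _ ih => exact ih
  | tvar Y => exact (hδ Y).2 X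

theorem LC.closed_inst {δ : ℕ → Ty} (hδ : ∀ X, (δ X).Closed) {a : Ty} (h : a.LC) :
    (a.inst δ).Closed :=
  ⟨LCAt.inst (fun X => (hδ X).1) h, not_hasTVar_inst hδ a⟩

theorem inst_congr {δ δ' : ℕ → Ty} (a : Ty) (h : ∀ X, HasTVar X a → δ X = δ' X) :
    a.inst δ = a.inst δ' := by
  induction a with
  | unit | bool | nat | bvar => rfl
  | arrow a b iha ihb | prod a b iha ihb | sum a b iha ihb =>
      simp only [inst, iha fun X hX => h X (.inl hX), ihb fun X hX => h X (.inr hX)]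
  | ref a ih | mu a ih => simp only [inst, ih fun X hX => h X hX]
  | tvar Y => exact h Y rfl

theorem inst_tvar (a : Ty) : a.inst tvar = a := by
  induction a <;> simp_all [inst]

theorem inst_eq_of_not_hasTVar {δ : ℕ → Ty} {a : Ty} (h : ∀ X, ¬ HasTVar X a) : a.inst δ = a :=
  (inst_congr a fun X hX => (h X hX).elim).trans (inst_tvar a)

theorem IsFinite.closed {a : Ty} (h : a.IsFinite) : a.Closed := by
  induction a with
  | unit | bool | nat => exact ⟨trivial, fun _ => id⟩
  | arrow | tvar | bvar | mu => exact h.elim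
  | prod a b iha ihb | sum a b iha ihb =>
      exact ⟨⟨(iha h.1).1, (ihb h.2).1⟩, fun X hX => hX.elim ((iha h.1).2 X) ((ihb h.2).2 X)⟩
  | ref a ih => exact ⟨(ih h).1, (ih h).2⟩

theorem IsFinite.inst_eq {a : Ty} (h : a.IsFinite) (δ : ℕ → Ty) : a.inst δ = a :=
  inst_eq_of_not_hasTVar h.closed.2

theorem Unfolds.inst {δ : ℕ → Ty} (hδ : ∀ X, (δ X).LC) {a b : Ty} (h : Unfolds a b) :
    Unfolds (a.inst δ) (b.inst δ) := by
  induction h with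
  | refl => exact .refl _
  | step _ ih => exact .step (by rwa [inst_instB hδ] at ih)

theorem Unfolds.of_inst {δ : ℕ → Ty} (hδ : ∀ X, (δ X).LC) {c h : Ty} (u : Unfolds c h) :
    ∀ a : Ty, c = a.inst δ → h.IsHead →
      (∃ a', Unfolds a a' ∧ a'.IsHead ∧ (∀ X, a' ≠ tvar X) ∧ h = a'.inst δ) ∨
        ∃ X, Unfolds a (tvar X) ∧ Unfolds (δ X) h := by
  induction u with
  | refl c =>
      rintro a rfl hd
      cases a with
      | tvar X => exact .inr ⟨X, .refl _, .refl _⟩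
      | bvar | mu => exact hd.elim
      | _ => exact .inl ⟨_, .refl _, trivial, fun _ => nofun, rfl⟩
  | @step m h u ih =>
      intro a hc hd
      cases a with
      | tvar X =>
          have hX : δ X = mu m := hc.symm
          exact .inr ⟨X, .refl _, by rw [hX]; exact .step u⟩
      | mu a =>
          obtain rfl : m = a.inst δ := by injection hc
          obtain ⟨a', ua, h1, h2, h3⟩ | ⟨X, ua, uX⟩ :=
            ih (instB (mu a) 0 a) (inst_instB hδ (mu a) a 0).symm hd
          · exact .inl ⟨a', .step ua, h1, h2, h3⟩
          · exact .inr ⟨X, .step ua, uX⟩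
      | _ => cases hc

theorem Match.inst {R R' : Ty → Ty → Prop} {δ : ℕ → Ty}
    (h : ∀ a b, R a b → R' (a.inst δ) (b.inst δ)) {a b : Ty} (m : Match R a b)
    (ha : ∀ X, a ≠ .tvar X) : Match R' (a.inst δ) (b.inst δ) := by
  cases m with
  | tvar X => exact (ha X rfl).elim
  | _ => constructor <;> exact h _ _ ‹_›

theorem Eqv.inst {δ : ℕ → Ty} (hδ : ∀ X, (δ X).LC) {a b : Ty} (h : Eqv a b) :
    Eqv (a.inst δ) (b.inst δ) := by
  let R : Ty → Ty → Prop := fun x y => x = y ∨ ∃ a b, Eqv a b ∧ x = a.inst δ ∧ y = b.inst δ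
  refine ⟨R, .of_symm ?_ ?_, .inr ⟨a, b, h, rfl, rfl⟩⟩
  · rintro x y (rfl | ⟨a, b, hab, rfl, rfl⟩)
    · exact .inl rfl
    · exact .inr ⟨b, a, hab.symm, rfl, rfl⟩
  · rintro x y (rfl | ⟨a, b, hab, rfl, rfl⟩) h u hd
    · exact ⟨h, u, .of_isHead (fun _ => .inl rfl) hd⟩
    · obtain ⟨a', ua, ha', hX, rfl⟩ | ⟨X, ua, uX⟩ := u.of_inst hδ a rfl hd
      · obtain ⟨b', ub, m⟩ := hab.exists_unfolds_match ua ha'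
        exact ⟨b'.inst δ, ub.inst hδ, m.inst (fun x y hxy => .inr ⟨x, y, hxy, rfl, rfl⟩) hX⟩
      · obtain ⟨b', ub, m⟩ := hab.exists_unfolds_match ua trivial
        cases m
        exact ⟨h, (ub.inst hδ).trans uX, .of_isHead (fun _ => .inl rfl) hd⟩

end Ty

/-! ### Reduction -/

/-- Elementary evaluation contexts: a call-by-value evaluation context of depth one. They let the
closure rules of `Step` be treated by a single argument. -/
inductive Frame : Type
  | appL (N : Term) : Frame
  | appR {V : Term} (hV : V.IsValue) : Frame
  | pairL (N : Term) : Frame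
  | pairR {V : Term} (hV : V.IsValue) : Frame
  | fst : Frame
  | snd : Frame
  | inl (a b : Ty) : Frame
  | inr (a b : Ty) : Frame
  | un (o : UnOp) : Frame
  | binL (o : BinOp) (N : Term) : Frame
  | binR (o : BinOp) {V : Term} (hV : V.IsValue) : Frame
  | cond (N P : Term) : Frame
  | caseOf (a : Ty) (N : Term) (b : Ty) (P : Term) : Frame
  | deref : Frame
  | assignL (N : Term) : Frame
  | assignR {V : Term} (hV : V.IsValue) : Frame
  | ref : Frame

/-- The program obtained by placing `M` in the hole of a frame. -/
def Frame.plug (M : Term) : Frame → Term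
  | appL N => .app M N
  | @appR V _ => .app V M
  | pairL N => .pair M N
  | @pairR V _ => .pair V M
  | fst => .fst M
  | snd => .snd M
  | inl a b => .inl a b M
  | inr a b => .inr a b M
  | un o => .un o M
  | binL o N => .bin o M N
  | @binR o V _ => .bin o V M
  | cond N P => .cond M N P
  | caseOf a N b P => .caseOf M a N b P
  | deref => .deref M
  | assignL N => .assign M N
  | @assignR V _ => .assign V M
  | ref => .ref M

/-- Reduction of a redex that is the whole program. -/
inductive HeadStep : Config → Config → Prop
  | beta {h : Finset ℕ} {σ : Store} {a : Ty} {M V : Term} : V.IsValue →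
      HeadStep ⟨h, .app (.lam a M) V, σ⟩ ⟨h, Term.subst1 V M, σ⟩
  | unroll {h : Finset ℕ} {σ : Store} {a b : Ty} {M V : Term} : V.IsValue →
      HeadStep ⟨h, .app (.recfn a b M) V, σ⟩ ⟨h, Term.subst2 V (.recfn a b M) M, σ⟩
  | fst {h : Finset ℕ} {σ : Store} {V W : Term} : V.IsValue → W.IsValue →
      HeadStep ⟨h, .fst (.pair V W), σ⟩ ⟨h, V, σ⟩
  | snd {h : Finset ℕ} {σ : Store} {V W : Term} : V.IsValue → W.IsValue →
      HeadStep ⟨h, .snd (.pair V W), σ⟩ ⟨h, W, σ⟩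
  | condT {h : Finset ℕ} {σ : Store} {M N : Term} :
      HeadStep ⟨h, .cond (.bool true) M N, σ⟩ ⟨h, M, σ⟩
  | condF {h : Finset ℕ} {σ : Store} {M N : Term} :
      HeadStep ⟨h, .cond (.bool false) M N, σ⟩ ⟨h, N, σ⟩
  | caseL {h : Finset ℕ} {σ : Store} {a b c d : Ty} {V N P : Term} : V.IsValue →
      HeadStep ⟨h, .caseOf (.inl c d V) a N b P, σ⟩ ⟨h, Term.subst1 V N, σ⟩
  | caseR {h : Finset ℕ} {σ : Store} {a b c d : Ty} {V N P : Term} : V.IsValue →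
      HeadStep ⟨h, .caseOf (.inr c d V) a N b P, σ⟩ ⟨h, Term.subst1 V P, σ⟩
  | un {h : Finset ℕ} {σ : Store} {o : UnOp} {V W : Term} : o.eval V = some W →
      HeadStep ⟨h, .un o V, σ⟩ ⟨h, W, σ⟩
  | bin {h : Finset ℕ} {σ : Store} {o : BinOp} {V V' W : Term} : o.eval V V' = some W →
      HeadStep ⟨h, .bin o V V', σ⟩ ⟨h, W, σ⟩
  | deref {h : Finset ℕ} {σ : Store} {l : ℕ} {V : Term} : σ l = some V →
      HeadStep ⟨h, .deref (.loc l), σ⟩ ⟨h, V, σ⟩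
  | assign {h : Finset ℕ} {σ : Store} {l : ℕ} {V W : Term} : V.IsValue → σ l = some W →
      HeadStep ⟨h, .assign (.loc l) V, σ⟩ ⟨h, .unit, Function.update σ l (some V)⟩
  | ref {h : Finset ℕ} {σ : Store} {l : ℕ} {V : Term} : V.IsValue → σ l = none → l ∉ h →
      HeadStep ⟨h, .ref V, σ⟩ ⟨insert l h, .loc l, Function.update σ l (some V)⟩

theorem HeadStep.step {c c' : Config} (st : HeadStep c c') : Step c c' := by
  cases st <;> constructor <;> assumption

theorem Step.plug {h h' : Finset ℕ} {σ σ' : Store} {M M' : Term}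
    (st : Step ⟨h, M, σ⟩ ⟨h', M', σ'⟩) (F : Frame) :
    Step ⟨h, F.plug M, σ⟩ ⟨h', F.plug M', σ'⟩ := by
  cases F <;> constructor <;> assumption

@[elab_as_elim]
theorem Step.frame_induction {motive : ∀ c c' : Config, Step c c' → Prop}
    (head : ∀ {c c' : Config} (st : HeadStep c c'), motive c c' st.step)
    (plug : ∀ {h h' : Finset ℕ} {σ σ' : Store} {M M' : Term} (F : Frame)
      (st : Step ⟨h, M, σ⟩ ⟨h', M', σ'⟩), motive _ _ st → motive _ _ (st.plug F))
    {c c' : Config} (st : Step c c') : motive c c' st := by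
  induction st with
  | appL st ih => exact plug (.appL _) st ih
  | appR hV st ih => exact plug (.appR hV) st ih
  | pairL st ih => exact plug (.pairL _) st ih
  | pairR hV st ih => exact plug (.pairR hV) st ih
  | fstC st ih => exact plug .fst st ih
  | sndC st ih => exact plug .snd st ih
  | inlC st ih => exact plug (.inl _ _) st ih
  | inrC st ih => exact plug (.inr _ _) st ih
  | unC st ih => exact plug (.un _) st ih
  | binL st ih => exact plug (.binL _ _) st ih
  | binR hV st ih => exact plug (.binR _ hV) st ih
  | condC st ih => exact plug (.cond _ _) st ih
  | caseC st ih => exact plug (.caseOf _ _ _ _) st ih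
  | derefC st ih => exact plug .deref st ih
  | assignL st ih => exact plug (.assignL _) st ih
  | assignR hV st ih => exact plug (.assignR hV) st ih
  | refC st ih => exact plug .ref st ih
  | _ => exact head (by constructor <;> assumption)

theorem UnOp.isValue_of_eval {o : UnOp} {V W : Term} (h : o.eval V = some W) :
    V.IsValue ∧ W.IsValue := by
  unfold UnOp.eval at h
  split at h <;> cases h
  exact ⟨trivial, trivial⟩

theorem BinOp.isValue_of_eval {o : BinOp} {V V' W : Term} (h : o.eval V V' = some W) :
    V.IsValue ∧ V'.IsValue ∧ W.IsValue := by
  unfold BinOp.eval at h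
  split at h <;> cases h <;> exact ⟨trivial, trivial, trivial⟩

theorem Frame.isValue_of_plug {F : Frame} {M : Term} (h : (F.plug M).IsValue) : M.IsValue := by
  cases F <;> first | exact h.elim | exact h.1 | exact h.2 | exact h

theorem HeadStep.isValue_of_plug {F : Frame} {h : Finset ℕ} {M : Term} {σ : Store} {c : Config}
    (st : HeadStep ⟨h, F.plug M, σ⟩ c) : M.IsValue := by
  cases F <;> cases st <;>
    first
    | trivial
    | assumption
    | exact ⟨‹_›, ‹_›⟩
    | exact (UnOp.isValue_of_eval ‹_›).1
    | exact (BinOp.isValue_of_eval ‹_›).1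
    | exact (BinOp.isValue_of_eval ‹_›).2.1

theorem Step.not_isValue {c c' : Config} (st : Step c c') : ¬ c.prog.IsValue := by
  induction st using Step.frame_induction with
  | head st => cases st <;> exact id
  | plug F _ ih => exact fun h => ih (Frame.isValue_of_plug h)

theorem Frame.plug_inj {F G : Frame} {M N : Term} (hM : ¬ M.IsValue) (hN : ¬ N.IsValue)
    (h : F.plug M = G.plug N) : F = G ∧ M = N := by
  cases F <;> cases G <;> cases h <;> first | exact ⟨rfl, rfl⟩ | contradiction

theorem HeadStep.deterministic {c c₁ c₂ : Config} (st : HeadStep c c₁) (hh : c₁.hid = c.hid)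
    (st' : HeadStep c c₂) : c₂ = c₁ := by
  cases st with
  | ref _ _ hl => exact (hl (Finset.insert_eq_self.1 hh)).elim
  | un ho => cases st' with | un ho' => cases ho.symm.trans ho'; rfl
  | bin ho => cases st' with | bin ho' => cases ho.symm.trans ho'; rfl
  | deref ho => cases st' with | deref ho' => cases ho.symm.trans ho'; rfl
  | _ => cases st'; rfl

theorem Step.headStep_or_plug {c c' : Config} (st : Step c c') :
    HeadStep c c' ∨ ∃ (F : Frame) (M M' : Term), c.prog = F.plug M ∧ c'.prog = F.plug M' ∧
      Step ⟨c.hid, M, c.store⟩ ⟨c'.hid, M', c'.store⟩ := by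
  induction st using Step.frame_induction with
  | head st => exact .inl st
  | plug F st _ => exact .inr ⟨F, _, _, rfl, rfl, st⟩

/-- The hypothesis `hh` excludes allocation, which may choose any unused name. -/
theorem Step.deterministic {c c₁ c₂ : Config} (st : Step c c₁) (hh : c₁.hid = c.hid)
    (st' : Step c c₂) : c₂ = c₁ := by
  induction st using Step.frame_induction generalizing c₂ with
  | @head c c₁ st =>
      obtain st' | ⟨F, M, M', hM, -, st'⟩ := st'.headStep_or_plug
      · exact st.deterministic hh st'
      · obtain ⟨h, N, σ⟩ := c
        subst hM
        exact (st'.not_isValue st.isValue_of_plug).elim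
  | plug F st ih =>
      obtain st' | ⟨G, N, N', hN, hN', st'⟩ := st'.headStep_or_plug
      · exact (st.not_isValue st'.isValue_of_plug).elim
      · obtain ⟨h₂, N₂, σ₂⟩ := c₂
        obtain ⟨rfl, rfl⟩ := Frame.plug_inj st.not_isValue st'.not_isValue hN
        cases ih hh st'
        cases hN'
        rfl

/-- Reduction that changes neither the store nor the hidden locations. -/
def PureSteps (h : Finset ℕ) (σ : Store) : Term → Term → Prop :=
  Relation.ReflTransGen fun M N => Step ⟨h, M, σ⟩ ⟨h, N, σ⟩

namespace PureSteps

variable {h : Finset ℕ} {σ : Store} {M N P : Term}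

theorem refl (M : Term) : PureSteps h σ M M := Relation.ReflTransGen.refl

theorem trans (s : PureSteps h σ M N) (s' : PureSteps h σ N P) : PureSteps h σ M P :=
  Relation.ReflTransGen.trans s s'

theorem tail (s : PureSteps h σ M N) (s' : Step ⟨h, N, σ⟩ ⟨h, P, σ⟩) : PureSteps h σ M P :=
  Relation.ReflTransGen.tail s s'

theorem plug (s : PureSteps h σ M N) (F : Frame) : PureSteps h σ (F.plug M) (F.plug N) :=
  Relation.ReflTransGen.lift (F.plug ·) (fun _ _ st => st.plug F) _ _ s

theorem steps (s : PureSteps h σ M N) : Relation.ReflTransGen Step ⟨h, M, σ⟩ ⟨h, N, σ⟩ :=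
  Relation.ReflTransGen.lift (fun M => (⟨h, M, σ⟩ : Config)) (fun _ _ h => h) _ _ s

theorem evalsTo_iff (s : PureSteps h σ M N) {c : Config} :
    EvalsTo ⟨h, M, σ⟩ c ↔ EvalsTo ⟨h, N, σ⟩ c := by
  refine ⟨fun e => ?_, fun e => ⟨s.steps.trans e.1, e.2⟩⟩
  induction s using Relation.ReflTransGen.head_induction_on with
  | refl => exact e
  | head st _ ih =>
      refine ih ⟨?_, e.2⟩
      obtain h | ⟨d, st', r⟩ := e.1.cases_head
      · subst h
        exact (st.not_isValue e.2).elim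
      · rwa [st.deterministic rfl st'] at r

theorem converges_iff (s : PureSteps h σ M N) :
    Converges ⟨h, M, σ⟩ ↔ Converges ⟨h, N, σ⟩ :=
  exists_congr fun _ => s.evalsTo_iff

theorem pair {M' N' : Term} (s : PureSteps h σ M M') (hV : M'.IsValue) (s' : PureSteps h σ N N') :
    PureSteps h σ (.pair M N) (.pair M' N') :=
  (s.plug (.pairL N)).trans (s'.plug (.pairR hV))

theorem bin {o : BinOp} {M' N' : Term} (s : PureSteps h σ M M') (hV : M'.IsValue)
    (s' : PureSteps h σ N N') : PureSteps h σ (.bin o M N) (.bin o M' N') :=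
  (s.plug (.binL o N)).trans (s'.plug (.binR o hV))

theorem fst {V W : Term} (s : PureSteps h σ M (.pair V W)) (hV : V.IsValue) (hW : W.IsValue) :
    PureSteps h σ (.fst M) V :=
  (s.plug .fst).tail (.fst hV hW)

theorem snd {V W : Term} (s : PureSteps h σ M (.pair V W)) (hV : V.IsValue) (hW : W.IsValue) :
    PureSteps h σ (.snd M) W :=
  (s.plug .snd).tail (.snd hV hW)

theorem deref {l : ℕ} {V : Term} (s : PureSteps h σ M (.loc l)) (hl : σ l = some V) :
    PureSteps h σ (.deref M) V :=
  (s.plug .deref).tail (.deref hl)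

theorem caseL {a b c d : Ty} {V : Term} (s : PureSteps h σ M (.inl c d V)) (hV : V.IsValue) :
    PureSteps h σ (.caseOf M a N b P) (.subst1 V N) :=
  (s.plug (.caseOf a N b P)).tail (.caseL hV)

theorem caseR {a b c d : Ty} {V : Term} (s : PureSteps h σ M (.inr c d V)) (hV : V.IsValue) :
    PureSteps h σ (.caseOf M a N b P) (.subst1 V P) :=
  (s.plug (.caseOf a N b P)).tail (.caseR hV)

theorem cond {b : Bool} (s : PureSteps h σ M (.bool b)) :
    PureSteps h σ (.cond M N P) (if b then N else P) := by
  refine (s.plug (.cond N P)).tail ?_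
  cases b
  · exact .condF
  · exact .condT

theorem beta {a : Ty} {V : Term} (s : PureSteps h σ M V) (hV : V.IsValue) :
    PureSteps h σ (.app (.lam a N) M) (.subst1 V N) :=
  (s.plug (.appR (V := .lam a N) trivial)).tail (.beta hV)

end PureSteps

/-- A diverging program of type `a`. -/
def omega (a : Ty) : Term := .app (.recfn .unit a (.app (.var 1) (.var 0))) .unit

theorem omega_not_evalsTo {a : Ty} {h : Finset ℕ} {σ : Store} {c : Config} :
    ¬ EvalsTo ⟨h, omega a, σ⟩ c := by
  rintro ⟨r, hv⟩
  suffices h : c = ⟨h, omega a, σ⟩ by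
    subst h
    exact hv
  clear hv
  induction r with
  | refl => rfl
  | tail _ st ih =>
      subst ih
      exact Step.deterministic (Step.unroll (a := .unit) (b := a) (V := .unit)
        (M := .app (.var 1) (.var 0)) trivial) rfl st

/-! ### Type annotations have no effect on reduction -/

/-- Equality of programs up to the type annotations of abstractions, injections and case
distinctions. -/
inductive Term.AnnotEq : Term → Term → Prop
  | var (n : ℕ) : AnnotEq (.var n) (.var n)
  | unit : AnnotEq .unit .unit
  | bool (b : Bool) : AnnotEq (.bool b) (.bool b)
  | nat (n : ℕ) : AnnotEq (.nat n) (.nat n)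
  | loc (l : ℕ) : AnnotEq (.loc l) (.loc l)
  | lam {M M' : Term} (a a' : Ty) : AnnotEq M M' → AnnotEq (.lam a M) (.lam a' M')
  | recfn {M M' : Term} (a a' b b' : Ty) : AnnotEq M M' →
      AnnotEq (.recfn a b M) (.recfn a' b' M')
  | app {M M' N N' : Term} : AnnotEq M M' → AnnotEq N N' → AnnotEq (.app M N) (.app M' N')
  | assign {M M' N N' : Term} : AnnotEq M M' → AnnotEq N N' →
      AnnotEq (.assign M N) (.assign M' N')
  | ref {M M' : Term} : AnnotEq M M' → AnnotEq (.ref M) (.ref M')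
  | deref {M M' : Term} : AnnotEq M M' → AnnotEq (.deref M) (.deref M')
  | un {M M' : Term} (o : UnOp) : AnnotEq M M' → AnnotEq (.un o M) (.un o M')
  | bin {M M' N N' : Term} (o : BinOp) : AnnotEq M M' → AnnotEq N N' →
      AnnotEq (.bin o M N) (.bin o M' N')
  | fst {M M' : Term} : AnnotEq M M' → AnnotEq (.fst M) (.fst M')
  | snd {M M' : Term} : AnnotEq M M' → AnnotEq (.snd M) (.snd M')
  | pair {M M' N N' : Term} : AnnotEq M M' → AnnotEq N N' → AnnotEq (.pair M N) (.pair M' N')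
  | inl {M M' : Term} (a a' b b' : Ty) : AnnotEq M M' → AnnotEq (.inl a b M) (.inl a' b' M')
  | inr {M M' : Term} (a a' b b' : Ty) : AnnotEq M M' → AnnotEq (.inr a b M) (.inr a' b' M')
  | cond {M M' N N' P P' : Term} : AnnotEq M M' → AnnotEq N N' → AnnotEq P P' →
      AnnotEq (.cond M N P) (.cond M' N' P')
  | caseOf {M M' N N' P P' : Term} (a a' b b' : Ty) : AnnotEq M M' → AnnotEq N N' →
      AnnotEq P P' → AnnotEq (.caseOf M a N b P) (.caseOf M' a' N' b' P')

namespace Term.AnnotEq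

protected theorem refl (M : Term) : AnnotEq M M := by
  induction M <;> constructor <;> assumption

protected theorem symm {M N : Term} (h : AnnotEq M N) : AnnotEq N M := by
  induction h <;> constructor <;> assumption

theorem isValue {V W : Term} (h : AnnotEq V W) (hV : V.IsValue) : W.IsValue := by
  induction h with
  | pair _ _ ih ih' => exact ⟨ih hV.1, ih' hV.2⟩
  | inl _ _ _ _ _ ih => exact ih hV
  | inr _ _ _ _ _ ih => exact ih hV
  | _ => exact hV

theorem rename {M N : Term} (h : AnnotEq M N) (r : ℕ → ℕ) :
    AnnotEq (M.rename r) (N.rename r) := by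
  induction h generalizing r <;> constructor <;> apply_assumption

theorem liftS {s t : ℕ → Term} (h : ∀ n, AnnotEq (s n) (t n)) :
    ∀ n, AnnotEq (Term.liftS s n) (Term.liftS t n)
  | 0 => .var 0
  | n + 1 => (h n).rename _

theorem subst {M N : Term} (h : AnnotEq M N) {s t : ℕ → Term} (hs : ∀ n, AnnotEq (s n) (t n)) :
    AnnotEq (M.subst s) (N.subst t) := by
  induction h generalizing s t with
  | var n => exact hs n
  | lam _ _ _ ih => exact .lam _ _ (ih (liftS hs))
  | recfn _ _ _ _ _ ih => exact .recfn _ _ _ _ (ih (liftS (liftS hs)))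
  | caseOf _ _ _ _ _ _ _ ih ihN ihP =>
      exact .caseOf _ _ _ _ (ih hs) (ihN (liftS hs)) (ihP (liftS hs))
  | _ => constructor <;> apply_assumption <;> exact hs

theorem subst1 {V W M N : Term} (hV : AnnotEq V W) (h : AnnotEq M N) :
    AnnotEq (Term.subst1 V M) (Term.subst1 W N) :=
  h.subst fun
    | 0 => hV
    | n + 1 => .var n

theorem subst2 {V V' W W' M N : Term} (hV : AnnotEq V V') (hW : AnnotEq W W')
    (h : AnnotEq M N) : AnnotEq (Term.subst2 V W M) (Term.subst2 V' W' N) :=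
  h.subst fun
    | 0 => hV
    | 1 => hW
    | n + 2 => .var n

theorem unOp_eval {o : UnOp} {V V' W : Term} (hV : AnnotEq V V') (h : o.eval V = some W) :
    o.eval V' = some W := by
  cases hV <;> exact h

theorem binOp_eval {o : BinOp} {V V' U U' W : Term} (hV : AnnotEq V V') (hU : AnnotEq U U')
    (h : o.eval V U = some W) : o.eval V' U' = some W := by
  cases hV <;> cases hU <;> first | exact h | cases o <;> cases h

end Term.AnnotEq

/-- Equality of stores up to type annotations in the stored values. -/
def Store.AnnotEq (σ τ : Store) : Prop := ∀ l, Option.Rel Term.AnnotEq (σ l) (τ l)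

namespace Store.AnnotEq

variable {σ τ : Store} {l : ℕ}

protected theorem refl (σ : Store) : AnnotEq σ σ := fun l => by
  cases σ l
  · exact .none
  · exact .some (.refl _)

theorem eq_none (h : AnnotEq σ τ) (hl : σ l = none) : τ l = none := by
  have hrel := h l
  rw [hl] at hrel
  generalize τ l = o at hrel ⊢
  cases hrel
  rfl

theorem exists_eq_some (h : AnnotEq σ τ) {V : Term} (hl : σ l = some V) :
    ∃ W, τ l = some W ∧ V.AnnotEq W := by
  have hrel := h l
  rw [hl] at hrel
  generalize τ l = o at hrel ⊢
  cases hrel with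
  | some hW => exact ⟨_, rfl, hW⟩

theorem update (h : AnnotEq σ τ) (l : ℕ) {V W : Term} (hV : V.AnnotEq W) :
    AnnotEq (Function.update σ l (some V)) (Function.update τ l (some W)) := fun m => by
  obtain rfl | hm := eq_or_ne m l
  · simpa only [Function.update_self] using .some hV
  · simpa only [Function.update_of_ne hm] using h m

end Store.AnnotEq

theorem HeadStep.exists_of_annotEq {h h' : Finset ℕ} {σ σ' τ : Store} {M M' N : Term}
    (st : HeadStep ⟨h, M, σ⟩ ⟨h', M', σ'⟩) (hM : M.AnnotEq N) (hσ : σ.AnnotEq τ) :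
    ∃ N' τ', HeadStep ⟨h, N, τ⟩ ⟨h', N', τ'⟩ ∧ M'.AnnotEq N' ∧ σ'.AnnotEq τ' := by
  cases st with
  | beta hV => cases hM with | app hL hW => cases hL with
    | lam _ _ hL => exact ⟨_, _, .beta (hW.isValue hV), hW.subst1 hL, hσ⟩
  | unroll hV => cases hM with | app hL hW => cases hL with
    | recfn _ _ _ _ hL =>
      exact ⟨_, _, .unroll (hW.isValue hV), hW.subst2 (.recfn _ _ _ _ hL) hL, hσ⟩
  | fst hV hW => cases hM with | fst hP => cases hP with
    | pair hV' hW' => exact ⟨_, _, .fst (hV'.isValue hV) (hW'.isValue hW), hV', hσ⟩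
  | snd hV hW => cases hM with | snd hP => cases hP with
    | pair hV' hW' => exact ⟨_, _, .snd (hV'.isValue hV) (hW'.isValue hW), hW', hσ⟩
  | condT => cases hM with | cond hB hN _ => cases hB; exact ⟨_, _, .condT, hN, hσ⟩
  | condF => cases hM with | cond hB _ hP => cases hB; exact ⟨_, _, .condF, hP, hσ⟩
  | caseL hV => cases hM with | caseOf _ _ _ _ hI hN _ => cases hI with
    | inl _ _ _ _ hW => exact ⟨_, _, .caseL (hW.isValue hV), hW.subst1 hN, hσ⟩
  | caseR hV => cases hM with | caseOf _ _ _ _ hI _ hP => cases hI with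
    | inr _ _ _ _ hW => exact ⟨_, _, .caseR (hW.isValue hV), hW.subst1 hP, hσ⟩
  | un ho => cases hM with | un _ hV => exact ⟨_, _, .un (hV.unOp_eval ho), .refl _, hσ⟩
  | bin ho => cases hM with
    | bin _ hV hW => exact ⟨_, _, .bin (hV.binOp_eval hW ho), .refl _, hσ⟩
  | deref hl => cases hM with | deref hL => cases hL with
    | loc =>
      obtain ⟨W, hW, hV⟩ := hσ.exists_eq_some hl
      exact ⟨_, _, .deref hW, hV, hσ⟩
  | assign hV hl => cases hM with | assign hL hW => cases hL with
    | loc =>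
      obtain ⟨U, hU, -⟩ := hσ.exists_eq_some hl
      exact ⟨_, _, .assign (hW.isValue hV) hU, .unit, hσ.update _ hW⟩
  | ref hV hl hh => cases hM with
    | ref hW => exact ⟨_, _, .ref (hW.isValue hV) (hσ.eq_none hl) hh, .loc _, hσ.update _ hW⟩

theorem Frame.exists_plug_of_annotEq {F : Frame} {M P : Term} (h : (F.plug M).AnnotEq P) :
    ∃ (G : Frame) (N : Term), P = G.plug N ∧ M.AnnotEq N ∧
      ∀ {M' N' : Term}, M'.AnnotEq N' → (F.plug M').AnnotEq (G.plug N') := by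
  cases F with
  | appL => cases h with | app hM hN => exact ⟨.appL _, _, rfl, hM, fun h => .app h hN⟩
  | appR hV => cases h with
    | app hV' hM => exact ⟨.appR (hV'.isValue hV), _, rfl, hM, .app hV'⟩
  | pairL => cases h with | pair hM hN => exact ⟨.pairL _, _, rfl, hM, fun h => .pair h hN⟩
  | pairR hV => cases h with
    | pair hV' hM => exact ⟨.pairR (hV'.isValue hV), _, rfl, hM, .pair hV'⟩
  | fst => cases h with | fst hM => exact ⟨.fst, _, rfl, hM, .fst⟩
  | snd => cases h with | snd hM => exact ⟨.snd, _, rfl, hM, .snd⟩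
  | inl => cases h with | inl _ _ _ _ hM => exact ⟨.inl _ _, _, rfl, hM, .inl _ _ _ _⟩
  | inr => cases h with | inr _ _ _ _ hM => exact ⟨.inr _ _, _, rfl, hM, .inr _ _ _ _⟩
  | un => cases h with | un _ hM => exact ⟨.un _, _, rfl, hM, .un _⟩
  | binL => cases h with | bin _ hM hN => exact ⟨.binL _ _, _, rfl, hM, fun h => .bin _ h hN⟩
  | binR _ hV => cases h with
    | bin _ hV' hM => exact ⟨.binR _ (hV'.isValue hV), _, rfl, hM, .bin _ hV'⟩
  | cond => cases h with
    | cond hM hN hP => exact ⟨.cond _ _, _, rfl, hM, fun h => .cond h hN hP⟩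
  | caseOf => cases h with
    | caseOf _ _ _ _ hM hN hP =>
      exact ⟨.caseOf _ _ _ _, _, rfl, hM, fun h => .caseOf _ _ _ _ h hN hP⟩
  | deref => cases h with | deref hM => exact ⟨.deref, _, rfl, hM, .deref⟩
  | assignL => cases h with
    | assign hM hN => exact ⟨.assignL _, _, rfl, hM, fun h => .assign h hN⟩
  | assignR hV => cases h with
    | assign hV' hM => exact ⟨.assignR (hV'.isValue hV), _, rfl, hM, .assign hV'⟩
  | ref => cases h with | ref hM => exact ⟨.ref, _, rfl, hM, .ref⟩

theorem Step.exists_of_annotEq {c c' : Config} (st : Step c c') {N : Term} {τ : Store}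
    (hM : c.prog.AnnotEq N) (hσ : c.store.AnnotEq τ) :
    ∃ N' τ', Step ⟨c.hid, N, τ⟩ ⟨c'.hid, N', τ'⟩ ∧ c'.prog.AnnotEq N' ∧ c'.store.AnnotEq τ' := by
  induction st using Step.frame_induction generalizing N with
  | head st =>
      obtain ⟨N', τ', st', h⟩ := st.exists_of_annotEq hM hσ
      exact ⟨N', τ', st'.step, h⟩
  | plug F _ ih =>
      obtain ⟨G, N, rfl, hN, hG⟩ := Frame.exists_plug_of_annotEq hM
      obtain ⟨N', τ', st', hN', hσ'⟩ := ih hN hσ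
      exact ⟨G.plug N', τ', st'.plug G, hG hN', hσ'⟩

theorem Converges.of_annotEq {c : Config} (hc : Converges c) {N : Term} {τ : Store}
    (hM : c.prog.AnnotEq N) (hσ : c.store.AnnotEq τ) : Converges ⟨c.hid, N, τ⟩ := by
  obtain ⟨c', r, hv⟩ := hc
  induction r using Relation.ReflTransGen.head_induction_on generalizing N τ with
  | refl => exact ⟨_, .refl, hM.isValue hv⟩
  | head st _ ih =>
      obtain ⟨N', τ', st', hM', hσ'⟩ := st.exists_of_annotEq hM hσ
      obtain ⟨c'', r, hv⟩ := ih hM' hσ'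
      exact ⟨c'', .head st' r, hv⟩

theorem converges_congr_of_annotEq {h : Finset ℕ} {σ : Store} {M N : Term} (hMN : M.AnnotEq N) :
    Converges ⟨h, M, σ⟩ ↔ Converges ⟨h, N, σ⟩ :=
  ⟨fun hc => hc.of_annotEq hMN (.refl σ), fun hc => hc.of_annotEq hMN.symm (.refl σ)⟩

/-! ### Typed values -/

/-- Closed values together with the type that their form determines. -/
inductive ValueShape (S : ℕ → Option Ty) : Term → Ty → Prop
  | unit : ValueShape S .unit .unit
  | bool (b : Bool) : ValueShape S (.bool b) .bool
  | nat (n : ℕ) : ValueShape S (.nat n) .nat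
  | loc {l : ℕ} {a : Ty} : S l = some a → ValueShape S (.loc l) (.ref a)
  | lam (a b : Ty) (M : Term) : ValueShape S (.lam a M) (.arrow a b)
  | recfn (a b : Ty) (M : Term) : ValueShape S (.recfn a b M) (.arrow a b)
  | pair {a b : Ty} {V W : Term} :
      HasType S [] V a → HasType S [] W b → ValueShape S (.pair V W) (.prod a b)
  | inl {a b : Ty} {V : Term} : HasType S [] V a → ValueShape S (.inl a b V) (.sum a b)
  | inr {a b : Ty} {V : Term} : HasType S [] V b → ValueShape S (.inr a b V) (.sum a b)

namespace HasType

variable {S : ℕ → Option Ty} {V : Term} {a b t : Ty}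

theorem valueShape (h : HasType S [] V t) (hV : V.IsValue) :
    ∃ t', ValueShape S V t' ∧ Ty.Eqv t' t := by
  generalize hG : ([] : List Ty) = G at h
  induction h with
  | var hn => subst hG; cases hn
  | unit => exact ⟨_, .unit, .refl _⟩
  | bool b => exact ⟨_, .bool b, .refl _⟩
  | nat n => exact ⟨_, .nat n, .refl _⟩
  | loc hl => exact ⟨_, .loc hl, .refl _⟩
  | lam => exact ⟨_, .lam _ _ _, .refl _⟩
  | recfn => exact ⟨_, .recfn _ _ _, .refl _⟩
  | pair h h' => subst hG; exact ⟨_, .pair h h', .refl _⟩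
  | inl _ _ h => subst hG; exact ⟨_, .inl h, .refl _⟩
  | inr _ _ h => subst hG; exact ⟨_, .inr h, .refl _⟩
  | conv _ he _ ih =>
      obtain ⟨t', ht, e⟩ := ih hV hG
      exact ⟨t', ht, e.trans he⟩
  | _ => exact hV.elim

theorem valueShape_match (h : HasType S [] V t) (hV : V.IsValue) (ht : t.IsHead) :
    ∃ t', ValueShape S V t' ∧ Ty.Match Ty.Eqv t' t := by
  obtain ⟨t', hs, e⟩ := h.valueShape hV
  exact ⟨t', hs, e.match_of_isHead (by cases hs <;> trivial) ht⟩

theorem eq_unit (h : HasType S [] V .unit) (hV : V.IsValue) : V = .unit := by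
  obtain ⟨t', hs, m⟩ := h.valueShape_match hV trivial
  cases m
  cases hs
  rfl

theorem exists_bool (h : HasType S [] V .bool) (hV : V.IsValue) : ∃ b, V = .bool b := by
  obtain ⟨t', hs, m⟩ := h.valueShape_match hV trivial
  cases m
  cases hs
  exact ⟨_, rfl⟩

theorem exists_nat (h : HasType S [] V .nat) (hV : V.IsValue) : ∃ n, V = .nat n := by
  obtain ⟨t', hs, m⟩ := h.valueShape_match hV trivial
  cases m
  cases hs
  exact ⟨_, rfl⟩

theorem exists_loc (h : HasType S [] V (.ref a)) (hV : V.IsValue) :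
    ∃ l a', V = .loc l ∧ S l = some a' ∧ Ty.Eqv a' a := by
  obtain ⟨t', hs, m⟩ := h.valueShape_match hV trivial
  cases m with
  | ref e =>
      cases hs with
      | loc hl => exact ⟨_, _, rfl, hl, e⟩

theorem exists_pair (h : HasType S [] V (.prod a b)) (hV : V.IsValue) (ha : a.LC) (hb : b.LC) :
    ∃ V₁ V₂, V = .pair V₁ V₂ ∧ HasType S [] V₁ a ∧ HasType S [] V₂ b := by
  obtain ⟨t', hs, m⟩ := h.valueShape_match hV trivial
  cases m with
  | prod e e' =>
      cases hs with
      | pair h h' => exact ⟨_, _, rfl, h.conv e ha, h'.conv e' hb⟩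

theorem exists_inl_or_inr (h : HasType S [] V (.sum a b)) (hV : V.IsValue) (ha : a.LC)
    (hb : b.LC) :
    (∃ c d W, V = .inl c d W ∧ HasType S [] W a) ∨ ∃ c d W, V = .inr c d W ∧ HasType S [] W b := by
  obtain ⟨t', hs, m⟩ := h.valueShape_match hV trivial
  cases m with
  | sum e e' =>
      cases hs with
      | inl hW => exact .inl ⟨_, _, _, rfl, hW.conv e ha⟩
      | inr hW => exact .inr ⟨_, _, _, rfl, hW.conv e' hb⟩

theorem loc_inv {l : ℕ} (h : HasType S [] (.loc l) t) : ∃ a, S l = some a ∧ Ty.Eqv (.ref a) t := by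
  obtain ⟨t', hs, e⟩ := h.valueShape trivial
  cases hs with
  | loc hl => exact ⟨_, hl, e⟩

theorem eqv_of_isFinite {V : Term} {a c : Ty} (ha : a.IsFinite) (hV : V.IsValue)
    (h : HasType S [] V a) (h' : HasType S [] V c) : Ty.Eqv c a := by
  induction a generalizing V c with
  | unit | bool | nat =>
      obtain ⟨t, hs, m⟩ := h.valueShape_match hV trivial
      obtain ⟨t', hs', e⟩ := h'.valueShape hV
      cases m
      cases hs
      cases hs'
      exact e.symm
  | ref a =>
      obtain ⟨l, a', rfl, hl, e⟩ := h.exists_loc hV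
      obtain ⟨a'', hl', e'⟩ := h'.loc_inv
      cases hl.symm.trans hl'
      exact e'.symm.trans (.of_match (.ref e))
  | prod a b iha ihb =>
      obtain ⟨V₁, V₂, rfl, h₁, h₂⟩ := h.exists_pair hV ha.1.closed.1 ha.2.closed.1
      obtain ⟨t', hs', e⟩ := h'.valueShape hV
      cases hs' with
      | pair g₁ g₂ =>
          exact e.symm.trans (.of_match (.prod (iha ha.1 hV.1 h₁ g₁) (ihb ha.2 hV.2 h₂ g₂)))
  | sum a b =>
      obtain ⟨t, hs, e⟩ := h.valueShape hV
      obtain ⟨t', hs', e'⟩ := h'.valueShape hV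
      cases hs with
      | inl => cases hs' with | inl => exact e'.symm.trans e
      | inr => cases hs' with | inr => exact e'.symm.trans e
      | _ => cases e.match_of_isHead trivial trivial
  | _ => exact ha.elim

end HasType

section Operations

variable {S : ℕ → Option Ty} {a b c : Ty}

theorem UnOp.Sig.inst {o : UnOp} (h : UnOp.Sig o a b) (δ : ℕ → Ty) :
    UnOp.Sig o (a.inst δ) (b.inst δ) := by
  cases h; constructor

theorem UnOp.Sig.closed {o : UnOp} (h : UnOp.Sig o a b) : b.Closed := by
  cases h; exact ⟨trivial, fun _ => id⟩

theorem UnOp.Sig.exists_eval {o : UnOp} (h : UnOp.Sig o a b) {V : Term} (hV : V.IsValue)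
    (hVa : HasType S [] V a) : ∃ W, o.eval V = some W ∧ HasType S [] W b := by
  cases h
  obtain ⟨_, rfl⟩ := hVa.exists_bool hV
  exact ⟨_, rfl, .bool _⟩

theorem BinOp.Sig.inst {o : BinOp} (h : BinOp.Sig o a b c) (δ : ℕ → Ty) :
    BinOp.Sig o (a.inst δ) (b.inst δ) (c.inst δ) := by
  cases h <;> constructor

theorem BinOp.Sig.closed {o : BinOp} (h : BinOp.Sig o a b c) : c.Closed := by
  cases h <;> exact ⟨trivial, fun _ => id⟩

theorem BinOp.Sig.exists_eval {o : BinOp} (h : BinOp.Sig o a b c) {V V' : Term} (hV : V.IsValue)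
    (hVa : HasType S [] V a) (hV' : V'.IsValue) (hVb : HasType S [] V' b) :
    ∃ W, o.eval V V' = some W ∧ HasType S [] W c := by
  cases h with
  | add | sub | mul =>
      obtain ⟨_, rfl⟩ := hVa.exists_nat hV
      obtain ⟨_, rfl⟩ := hVb.exists_nat hV'
      exact ⟨_, rfl, .nat _⟩
  | le | eqNat =>
      obtain ⟨_, rfl⟩ := hVa.exists_nat hV
      obtain ⟨_, rfl⟩ := hVb.exists_nat hV'
      exact ⟨_, rfl, .bool _⟩
  | and | or | eqBool =>
      obtain ⟨_, rfl⟩ := hVa.exists_bool hV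
      obtain ⟨_, rfl⟩ := hVb.exists_bool hV'
      exact ⟨_, rfl, .bool _⟩
  | eqUnit =>
      obtain rfl := hVa.eq_unit hV
      obtain rfl := hVb.eq_unit hV'
      exact ⟨_, rfl, .bool _⟩
  | eqRef =>
      obtain ⟨_, _, rfl, -⟩ := hVa.exists_loc hV
      obtain ⟨_, _, rfl, -⟩ := hVb.exists_loc hV'
      exact ⟨_, rfl, .bool _⟩

end Operations

/-! ### Typed models -/

/-- `S` types the free and hidden locations of the model `M` of type `Γ`. -/
structure ModelTyping (S : ℕ → Option Ty) (Γ : Env) (M : Model) : Prop where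
  vars_closed : ∀ a ∈ Γ.vars, a.Closed
  locs : ∀ l a, Γ.locs l = some a → S l = some a
  hid : ∀ l, l ∈ M.hid ↔ S l ≠ none ∧ Γ.locs l = none
  locs_closed : ∀ l a, S l = some a → a.Closed
  dom : ∀ l, M.store l = none ↔ S l = none
  store : ∀ l a V, S l = some a → M.store l = some V → V.IsValue ∧ HasType S [] V a
  env : List.Forall₂ (fun V a => V.IsValue ∧ HasType S [] V a) M.env Γ.vars

theorem isModel_iff {Γ : Env} {M : Model} :
    IsModel Γ M ↔ {l | M.store l ≠ none}.Finite ∧ ∃ S, ModelTyping S Γ M :=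
  ⟨fun ⟨h₁, h₂, S, h₃, h₄, h₅, h₆, h₇, h₈⟩ => ⟨h₂, S, h₁, h₃, h₄, h₅, h₆, h₇, h₈⟩,
    fun ⟨h₂, S, h₁, h₃, h₄, h₅, h₆, h₇, h₈⟩ => ⟨h₁, h₂, S, h₃, h₄, h₅, h₆, h₇, h₈⟩⟩

namespace ModelTyping

variable {S : ℕ → Option Ty} {Γ : Env} {M : Model}

theorem isValue_store (h : ModelTyping S Γ M) {l : ℕ} {V : Term} (hl : M.store l = some V) :
    V.IsValue := by
  cases hS : S l with
  | none => rw [(h.dom l).2 hS] at hl; cases hl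
  | some a => exact (h.store l a V hS hl).1

theorem exists_store (h : ModelTyping S Γ M) {l : ℕ} {a : Ty} (hl : S l = some a) :
    ∃ V, M.store l = some V ∧ V.IsValue ∧ HasType S [] V a := by
  cases hs : M.store l with
  | none => rw [(h.dom l).1 hs] at hl; cases hl
  | some V => exact ⟨V, rfl, h.store l a V hl hs⟩

theorem isValue_env (h : ModelTyping S Γ M) {V : Term} (hV : V ∈ M.env) : V.IsValue := by
  obtain ⟨n, hn, rfl⟩ := List.mem_iff_getElem.1 hV
  exact ((List.forall₂_iff_get.1 h.env).2 n hn (h.env.length_eq ▸ hn)).1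

theorem length_env (h : ModelTyping S Γ M) : M.env.length = Γ.vars.length :=
  h.env.length_eq

theorem exists_env (h : ModelTyping S Γ M) {n : ℕ} {a : Ty} (hn : Γ.vars[n]? = some a) :
    ∃ V, M.env[n]? = some V ∧ V.IsValue ∧ HasType S [] V a := by
  obtain ⟨hn', rfl⟩ := List.getElem?_eq_some_iff.1 hn
  have hl : n < M.env.length := h.length_env ▸ hn'
  exact ⟨M.env[n], List.getElem?_eq_getElem hl, (List.forall₂_iff_get.1 h.env).2 n hl hn'⟩

theorem push (h : ModelTyping S Γ M) {a : Ty} {V : Term} (ha : a.Closed) (hV : V.IsValue)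
    (hVa : HasType S [] V a) : ModelTyping S (Γ.snoc a) (M.push V) where
  vars_closed b hb := by
    rcases List.mem_append.1 hb with hb | hb
    · exact h.vars_closed b hb
    · rwa [List.mem_singleton.1 hb]
  locs := h.locs
  hid := h.hid
  locs_closed := h.locs_closed
  dom := h.dom
  store := h.store
  env := List.rel_append h.env (.cons ⟨hV, hVa⟩ .nil)

theorem of_push {a : Ty} {V : Term} (h : ModelTyping S (Γ.snoc a) (M.push V)) :
    ModelTyping S Γ M ∧ a.Closed ∧ V.IsValue ∧ HasType S [] V a := by
  have henv := List.forall₂_reverse_iff.2 h.env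
  simp only [Model.push, Env.snoc, List.reverse_append, List.reverse_singleton,
    List.singleton_append, List.forall₂_cons] at henv
  exact ⟨⟨fun b hb => h.vars_closed b (List.mem_append_left _ hb), h.locs, h.hid, h.locs_closed,
    h.dom, h.store, List.forall₂_reverse_iff.1 henv.2⟩,
    h.vars_closed a (List.mem_append_right _ (.head _)), henv.1⟩

end ModelTyping

theorem IsModel.length_env {Γ : Env} {M : Model} (h : IsModel Γ M) :
    M.env.length = Γ.vars.length := by
  obtain ⟨-, _, hS⟩ := isModel_iff.1 h
  exact hS.length_env

theorem ModelEquiv.refl {Γ : Env} {M : Model} (h : IsModel Γ M) : ModelEquiv Γ M M :=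
  ⟨h, h, fun _ _ => .rfl⟩

theorem ModelEquiv.symm {Γ : Env} {M M' : Model} (h : ModelEquiv Γ M M') : ModelEquiv Γ M' M :=
  ⟨h.2.1, h.1, fun N hN => (h.2.2 N hN).symm⟩

/-! ### Readings -/

theorem Reading.inst_bindT_of_not_hasTVar {ρ : Reading} {X : ℕ} {a b : Ty}
    (hb : ¬ Ty.HasTVar X b) : b.inst (ρ.bindT X a).tys = b.inst ρ.tys := by
  refine Ty.inst_congr b fun Y hY => ?_
  have hne : Y ≠ X := by rintro rfl; exact hb hY
  simp only [Reading.bindT, Function.update_of_ne hne]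

namespace Reading.Interprets

variable {ρ : Reading} {Γ : FEnv} {Δ : Env}

theorem lc (h : ρ.Interprets Γ Δ) (X : ℕ) : (ρ.tys X).LC := (h.1 X).1

theorem snoc (h : ρ.Interprets Γ Δ) (a : Ty) : ρ.Interprets Γ (Δ.snoc a) := by
  refine ⟨h.1, fun x b hx => ?_, h.2.2⟩
  have hx := h.2.1 x b hx
  obtain ⟨hlt, -⟩ := List.getElem?_eq_some_iff.1 hx
  rw [← hx]
  exact List.getElem?_append_left hlt

theorem bind_of_eq (h : ρ.Interprets Γ Δ) (x : ℕ) {a b : Ty} (hb : a.inst ρ.tys = b) :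
    (ρ.bind x Δ.vars.length).Interprets (Γ.bind x a) (Δ.snoc b) := by
  subst hb
  refine ⟨h.1, fun y b hy => ?_, h.2.2⟩
  by_cases hxy : y = x
  · subst hxy
    obtain rfl : a = b := by simpa [FEnv.bind] using hy
    simp [Reading.bind, Env.snoc]
  · have hy' : Γ.vars y = some b := by simpa [FEnv.bind, hxy] using hy
    simpa [Reading.bind, hxy] using (h.snoc (a.inst ρ.tys)).2.1 y b hy'

theorem bind (h : ρ.Interprets Γ Δ) (x : ℕ) (a : Ty) :
    (ρ.bind x Δ.vars.length).Interprets (Γ.bind x a) (Δ.snoc (a.inst ρ.tys)) :=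
  h.bind_of_eq x rfl

theorem bindT (h : ρ.Interprets Γ Δ) {X : ℕ} (hX : Γ.FreshT X) {a : Ty} (ha : a.Closed) :
    (ρ.bindT X a).Interprets Γ Δ := by
  refine ⟨fun Y => ?_, fun x b hx => ?_, fun l b hl => ?_⟩
  · obtain rfl | hY := eq_or_ne Y X
    · simpa only [Reading.bindT, Function.update_self] using ha
    · simpa only [Reading.bindT, Function.update_of_ne hY] using h.1 Y
  · rw [inst_bindT_of_not_hasTVar (hX.1 x b hx)]
    exact h.2.1 x b hx
  · rw [inst_bindT_of_not_hasTVar (hX.2 l b hl)]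
    exact h.2.2 l b hl

theorem updateLocs (h : ρ.Interprets Γ Δ) {l : ℕ} (hl : Δ.locs l = none) (a : Ty) :
    ρ.Interprets Γ ⟨Δ.vars, Function.update Δ.locs l (some a)⟩ := by
  refine ⟨h.1, h.2.1, fun m b hm => ?_⟩
  have hm := h.2.2 m b hm
  have : m ≠ l := by rintro rfl; rw [hl] at hm; cases hm
  simpa [this] using hm

theorem evolves (h : ρ.Interprets Γ Δ) {Δ' : Env} {M M' : Model} (e : Evolves Δ M Δ' M') :
    ρ.Interprets Γ Δ' := by
  induction e with
  | refl => exact h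
  | run _ _ ih => exact ih.snoc _

end Reading.Interprets

/-! ### Logical terms -/

namespace LTerm

theorem VarsBelow.mono {e : LTerm} {j k : ℕ} (h : e.VarsBelow j) (hjk : j ≤ k) :
    e.VarsBelow k := by
  induction e with
  | var x => exact lt_of_lt_of_le h hjk
  | bin _ _ _ ih ih' | pair _ _ ih ih' => exact ⟨ih h.1, ih' h.2⟩
  | un _ _ ih | inl _ _ _ ih | inr _ _ _ ih | deref _ ih => exact ih h
  | _ => trivial

theorem exists_varsBelow (e : LTerm) : ∃ k, e.VarsBelow k := by
  induction e with
  | var x => exact ⟨x + 1, Nat.lt_succ_self x⟩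
  | bin _ _ _ ih ih' | pair _ _ ih ih' =>
      obtain ⟨k, hk⟩ := ih
      obtain ⟨k', hk'⟩ := ih'
      exact ⟨max k k', hk.mono (le_max_left _ _), hk'.mono (le_max_right _ _)⟩
  | un _ _ ih | inl _ _ _ ih | inr _ _ _ ih | deref _ ih => exact ih
  | _ => exact ⟨0, trivial⟩

theorem HasType.of_agree {Γ Γ' : FEnv} {e : LTerm} {a : Ty} {k : ℕ} (h : e.HasType Γ a)
    (hk : e.VarsBelow k) (hv : ∀ x < k, Γ'.vars x = Γ.vars x) (hl : Γ'.locs = Γ.locs) :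
    e.HasType Γ' a := by
  induction h with
  | var hx => exact .var ((hv _ hk).trans hx)
  | unit => exact .unit
  | bool b => exact .bool b
  | nat n => exact .nat n
  | loc h => exact .loc (by rw [hl, h])
  | un ho _ ih => exact .un ho (ih hk)
  | bin ho _ _ ih ih' => exact .bin ho (ih hk.1) (ih' hk.2)
  | pair _ _ ih ih' => exact .pair (ih hk.1) (ih' hk.2)
  | inl ha hb _ ih => exact .inl ha hb (ih hk)
  | inr ha hb _ ih => exact .inr ha hb (ih hk)
  | deref _ ih => exact .deref (ih hk)
  | conv _ e hb ih => exact .conv (ih hk) e hb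

theorem HasType.bind {Γ : FEnv} {e : LTerm} {a : Ty} {k : ℕ} (h : e.HasType Γ a)
    (hk : e.VarsBelow k) (b : Ty) : e.HasType (Γ.bind k b) a :=
  h.of_agree hk (fun x hx => by simp [FEnv.bind, hx.ne]) rfl

theorem HasType.bind_var (Γ : FEnv) (k : ℕ) (a : Ty) : (LTerm.var k).HasType (Γ.bind k a) a :=
  .var (by simp [FEnv.bind])

theorem HasType.den_eq {Γ : FEnv} {e : LTerm} {a : Ty} {k : ℕ} {ρ ρ' : Reading} {ξ ξ' : List Term}
    (σ : Store) (h : e.HasType Γ a) (hk : e.VarsBelow k)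
    (hv : ∀ x b, Γ.vars x = some b → x < k → ξ'[ρ'.pos x]? = ξ[ρ.pos x]?)
    (ht : ρ'.tys = ρ.tys) : e.den ρ' ξ' σ = e.den ρ ξ σ := by
  induction h with
  | var hx => exact hv _ _ hx hk
  | unit | bool | nat | loc => rfl
  | un _ _ ih => simp only [den, ih hk]
  | bin _ _ _ ih ih' | pair _ _ ih ih' => simp only [den, ih hk.1, ih' hk.2]
  | inl _ _ _ ih | inr _ _ _ ih => simp only [den, ih hk, ht]
  | deref _ ih => simp only [den, ih hk]
  | conv _ _ _ ih => exact ih hk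

theorem HasType.den_bind {Γ : FEnv} {Δ : Env} {e : LTerm} {a : Ty} {k : ℕ} {ρ : Reading}
    {ξ : List Term} (σ : Store) (h : e.HasType Γ a) (hk : e.VarsBelow k) (hρ : ρ.Interprets Γ Δ)
    (hξ : ξ.length = Δ.vars.length) (V : Term) :
    e.den (ρ.bind k Δ.vars.length) (ξ ++ [V]) σ = e.den ρ ξ σ := by
  refine h.den_eq σ hk (fun x b hx hlt => ?_) rfl
  obtain ⟨hp, -⟩ := List.getElem?_eq_some_iff.1 (hρ.2.1 x b hx)
  rw [← hξ] at hp
  simp only [Reading.bind, Function.update_of_ne hlt.ne]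
  exact List.getElem?_append_left hp

theorem HasType.closed_inst {Γ : FEnv} {Δ : Env} {S : ℕ → Option Ty} {M : Model} {ρ : Reading}
    {e : LTerm} {a : Ty} (h : e.HasType Γ a) (hρ : ρ.Interprets Γ Δ) (hM : ModelTyping S Δ M) :
    (a.inst ρ.tys).Closed := by
  induction h with
  | var hx => exact hM.vars_closed _ (List.mem_of_getElem? (hρ.2.1 _ _ hx))
  | unit | bool | nat => exact ⟨trivial, fun _ => id⟩
  | loc hl =>
      have hc := hM.locs_closed _ _ (hM.locs _ _ (hρ.2.2 _ _ hl))
      exact ⟨hc.1, hc.2⟩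
  | un ho => exact (ho.inst ρ.tys).closed
  | bin ho => exact (ho.inst ρ.tys).closed
  | pair _ _ ih ih' => exact ⟨⟨ih.1, ih'.1⟩, fun X hX => hX.elim (ih.2 X) (ih'.2 X)⟩
  | inl ha hb | inr ha hb => exact Ty.LC.closed_inst (a := .sum _ _) hρ.1 ⟨ha, hb⟩
  | deref _ ih => exact ih
  | conv _ _ hb => exact hb.closed_inst hρ.1

theorem HasType.exists_den {Γ : FEnv} {Δ : Env} {S : ℕ → Option Ty} {M : Model} {ρ : Reading}
    {e : LTerm} {a : Ty} (h : e.HasType Γ a) (hρ : ρ.Interprets Γ Δ) (hM : ModelTyping S Δ M) :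
    ∃ V, e.den ρ M.env M.store = some V ∧ V.IsValue ∧
      LocalState.HasType S [] V (a.inst ρ.tys) := by
  induction h with
  | var hx => exact hM.exists_env (hρ.2.1 _ _ hx)
  | unit => exact ⟨_, rfl, trivial, .unit⟩
  | bool b => exact ⟨_, rfl, trivial, .bool b⟩
  | nat n => exact ⟨_, rfl, trivial, .nat n⟩
  | loc hl => exact ⟨_, rfl, trivial, .loc (hM.locs _ _ (hρ.2.2 _ _ hl))⟩
  | un ho _ ih =>
      obtain ⟨V, hd, hV, ht⟩ := ih
      obtain ⟨W, hW, hWt⟩ := (ho.inst ρ.tys).exists_eval hV ht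
      exact ⟨W, by simp only [LTerm.den, hd, Option.bind_some, hW],
        (UnOp.isValue_of_eval hW).2, hWt⟩
  | bin ho _ _ ih ih' =>
      obtain ⟨V, hd, hV, ht⟩ := ih
      obtain ⟨V', hd', hV', ht'⟩ := ih'
      obtain ⟨W, hW, hWt⟩ := (ho.inst ρ.tys).exists_eval hV ht hV' ht'
      exact ⟨W, by simp only [LTerm.den, hd, hd', Option.bind_some, hW],
        (BinOp.isValue_of_eval hW).2.2, hWt⟩
  | pair _ _ ih ih' =>
      obtain ⟨V, hd, hV, ht⟩ := ih
      obtain ⟨V', hd', hV', ht'⟩ := ih'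
      exact ⟨.pair V V', by simp only [LTerm.den, hd, hd', Option.bind_some, Option.map_some],
        ⟨hV, hV'⟩, .pair ht ht'⟩
  | inl ha hb _ ih =>
      obtain ⟨V, hd, hV, ht⟩ := ih
      exact ⟨.inl _ _ V, by simp only [LTerm.den, hd, Option.map_some], hV,
        .inl (ha.closed_inst hρ.1).1 (hb.closed_inst hρ.1).1 ht⟩
  | inr ha hb _ ih =>
      obtain ⟨V, hd, hV, ht⟩ := ih
      exact ⟨.inr _ _ V, by simp only [LTerm.den, hd, Option.map_some], hV,
        .inr (ha.closed_inst hρ.1).1 (hb.closed_inst hρ.1).1 ht⟩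
  | deref h ih =>
      obtain ⟨V, hd, hV, ht⟩ := ih
      obtain ⟨l, a', rfl, hl, e⟩ := LocalState.HasType.exists_loc ht hV
      obtain ⟨W, hW, hWv, hWt⟩ := hM.exists_store hl
      exact ⟨W, by simp only [LTerm.den, hd, Option.bind_some, hW], hWv,
        hWt.conv e (h.closed_inst hρ hM).1⟩
  | conv _ e hb ih =>
      obtain ⟨V, hd, hV, ht⟩ := ih
      exact ⟨V, hd, hV, ht.conv (e.inst hρ.lc) (hb.closed_inst hρ.1).1⟩

/-- A logical term as a program, with programs for its variables. -/
def progWith (v : ℕ → Term) (δ : ℕ → Ty) : LTerm → Term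
  | var x => v x
  | unit => .unit
  | bool b => .bool b
  | nat n => .nat n
  | loc l => .loc l
  | un o e => .un o (progWith v δ e)
  | bin o e e' => .bin o (progWith v δ e) (progWith v δ e')
  | pair e e' => .pair (progWith v δ e) (progWith v δ e')
  | inl a b e => .inl (a.inst δ) (b.inst δ) (progWith v δ e)
  | inr a b e => .inr (a.inst δ) (b.inst δ) (progWith v δ e)
  | deref e => .deref (progWith v δ e)

theorem prog_eq_progWith (ρ : Reading) (e : LTerm) :
    e.prog ρ = e.progWith (fun x => .var (ρ.pos x)) ρ.tys := by
  induction e <;> simp only [prog, progWith, *]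

theorem HasType.progWith {Γ : FEnv} {e : LTerm} {a : Ty} {v : ℕ → Term} {δ : ℕ → Ty}
    {S : ℕ → Option Ty} {G : List Ty} (h : e.HasType Γ a) (hδ : ∀ X, (δ X).Closed)
    (hv : ∀ x b, Γ.vars x = some b → LocalState.HasType S G (v x) (b.inst δ))
    (hl : ∀ l b, Γ.locs l = some b → S l = some (b.inst δ)) :
    LocalState.HasType S G (e.progWith v δ) (a.inst δ) := by
  induction h with
  | var hx => exact hv _ _ hx
  | unit => exact .unit
  | bool b => exact .bool b
  | nat n => exact .nat n
  | loc h => exact .loc (hl _ _ h)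
  | un ho _ ih => exact .un (ho.inst δ) ih
  | bin ho _ _ ih ih' => exact .bin (ho.inst δ) ih ih'
  | pair _ _ ih ih' => exact .pair ih ih'
  | inl ha hb _ ih => exact .inl (ha.closed_inst hδ).1 (hb.closed_inst hδ).1 ih
  | inr ha hb _ ih => exact .inr (ha.closed_inst hδ).1 (hb.closed_inst hδ).1 ih
  | deref _ ih => exact .deref ih
  | conv _ e hb ih => exact ih.conv (e.inst fun X => (hδ X).1) (hb.closed_inst hδ).1

theorem pureSteps_progWith {ρ : Reading} {ξ : List Term} {h : Finset ℕ} {σ : Store}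
    {v s : ℕ → Term}
    (hv : ∀ x V, ξ[ρ.pos x]? = some V → V.IsValue ∧ PureSteps h σ ((v x).subst s) V)
    (hσ : ∀ l V, σ l = some V → V.IsValue) {e : LTerm} {V : Term} (hV : e.den ρ ξ σ = some V) :
    V.IsValue ∧ PureSteps h σ ((e.progWith v ρ.tys).subst s) V := by
  induction e generalizing V with
  | var x => exact hv x _ hV
  | unit | bool | nat | loc =>
      cases hV
      exact ⟨trivial, .refl _⟩
  | un o e ih =>
      obtain ⟨W, hW, ho⟩ := Option.bind_eq_some_iff.1 hV
      exact ⟨(UnOp.isValue_of_eval ho).2, ((ih hW).2.plug (.un o)).tail (.un ho)⟩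
  | bin o e e' ih ih' =>
      obtain ⟨W, hW, hV⟩ := Option.bind_eq_some_iff.1 hV
      obtain ⟨W', hW', ho⟩ := Option.bind_eq_some_iff.1 hV
      exact ⟨(BinOp.isValue_of_eval ho).2.2,
        ((ih hW).2.bin (ih hW).1 (ih' hW').2).tail (.bin ho)⟩
  | pair e e' ih ih' =>
      obtain ⟨W, hW, hV⟩ := Option.bind_eq_some_iff.1 hV
      obtain ⟨W', hW', rfl⟩ := Option.map_eq_some_iff.1 hV
      exact ⟨⟨(ih hW).1, (ih' hW').1⟩, (ih hW).2.pair (ih hW).1 (ih' hW').2⟩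
  | inl a b e ih =>
      obtain ⟨W, hW, rfl⟩ := Option.map_eq_some_iff.1 hV
      exact ⟨(ih hW).1, (ih hW).2.plug (.inl _ _)⟩
  | inr a b e ih =>
      obtain ⟨W, hW, rfl⟩ := Option.map_eq_some_iff.1 hV
      exact ⟨(ih hW).1, (ih hW).2.plug (.inr _ _)⟩
  | deref e ih =>
      obtain ⟨W, hW, hV⟩ := Option.bind_eq_some_iff.1 hV
      split at hV
      · exact ⟨hσ _ _ hV, (ih hW).2.deref hV⟩
      · cases hV

theorem HasType.prog {Γ : FEnv} {Δ : Env} {ρ : Reading} {e : LTerm} {a : Ty} (h : e.HasType Γ a)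
    (hρ : ρ.Interprets Γ Δ) :
    LocalState.HasType Δ.locs Δ.vars (e.prog ρ) (a.inst ρ.tys) := by
  rw [prog_eq_progWith]
  exact h.progWith hρ.1 (fun x b hx => .var (hρ.2.1 x b hx)) hρ.2.2

theorem pureSteps_prog {S : ℕ → Option Ty} {Δ : Env} {M : Model} {ρ : Reading} {e : LTerm}
    {V : Term} (h : Finset ℕ) (hM : ModelTyping S Δ M) (hV : e.den ρ M.env M.store = some V) :
    PureSteps h M.store ((e.prog ρ).subst (Term.envSubst M.env)) V := by
  rw [prog_eq_progWith]
  refine (pureSteps_progWith (fun x V hx => ?_) (fun l V => hM.isValue_store) hV).2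
  refine ⟨hM.isValue_env (List.mem_of_getElem? hx), ?_⟩
  simp only [Term.subst, Term.envSubst, List.getD_eq_getElem?_getD, hx]
  exact .refl _

end LTerm

/-! ### A program that decides reachability from data of finite types -/

theorem Ncl.mono {σ : Store} {A B : Set ℕ} (h : A ⊆ B) {l : ℕ} (hl : Ncl σ A l) : Ncl σ B l := by
  induction hl with
  | base hl => exact .base (h hl)
  | step _ hs hf ih => exact .step ih hs hf

theorem not_ncl_empty {σ : Store} {l : ℕ} : ¬ Ncl σ ∅ l := by
  intro h
  induction h with
  | base h => exact h
  | step _ _ _ ih => exact ih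

theorem ncl_union {σ : Store} {A B : Set ℕ} {l : ℕ} :
    Ncl σ (A ∪ B) l ↔ Ncl σ A l ∨ Ncl σ B l := by
  constructor
  · intro h
    induction h with
    | base h => exact h.imp .base .base
    | step _ hs hf ih => exact ih.imp (.step · hs hf) (.step · hs hf)
  · rintro (h | h)
    · exact h.mono Set.subset_union_left
    · exact h.mono Set.subset_union_right

theorem ncl_singleton {σ : Store} {m l : ℕ} {W : Term} (hm : σ m = some W) :
    Ncl σ {m} l ↔ m = l ∨ Ncl σ W.fl l := by
  constructor
  · intro h
    induction h with
    | base h => exact .inl h.symm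
    | step _ hs hf ih =>
        obtain rfl | ih := ih
        · cases hm.symm.trans hs
          exact .inr (.base hf)
        · exact .inr (.step ih hs hf)
  · rintro (rfl | h)
    · exact .base rfl
    · induction h with
      | base h => exact .step (.base rfl) hm h
      | step _ hs hf ih => exact .step ih hs hf

/-- The program `P` decides the proposition `p`: it evaluates to a boolean that reflects `p`,
without changing the store `σ` and the hidden locations `h`. -/
def Decides (h : Finset ℕ) (σ : Store) (P : Term) (p : Prop) : Prop :=
  ∃ b : Bool, PureSteps h σ P (.bool b) ∧ (b = true ↔ p)

/-- A program of type `Unit` that converges if `P` evaluates to `true` and diverges if `P` evaluates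
to `false`. -/
def assertTrue (P : Term) : Term := .cond P .unit (omega .unit)

theorem subst_assertTrue (s : ℕ → Term) (P : Term) :
    (assertTrue P).subst s = assertTrue (P.subst s) := rfl

theorem omega_hasType {S : ℕ → Option Ty} {G : List Ty} {a : Ty} (ha : a.LC) :
    HasType S G (omega a) a :=
  .app (.recfn trivial ha (.app (.var rfl) (.var rfl))) .unit

theorem HasType.assertTrue {S : ℕ → Option Ty} {G : List Ty} {P : Term} (hP : HasType S G P .bool) :
    HasType S G (assertTrue P) .unit :=
  .cond hP .unit (omega_hasType trivial)

namespace Decides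

variable {h : Finset ℕ} {σ : Store} {P Q : Term} {p q : Prop}

theorem of_pureSteps (s : PureSteps h σ P Q) (d : Decides h σ Q p) : Decides h σ P p := by
  obtain ⟨b, hb, hp⟩ := d
  exact ⟨b, s.trans hb, hp⟩

theorem congr (d : Decides h σ P p) (hpq : p ↔ q) : Decides h σ P q := by
  obtain ⟨b, hb, hp⟩ := d
  exact ⟨b, hb, hp.trans hpq⟩

theorem false (hp : ¬ p) : Decides h σ (.bool false) p :=
  ⟨_, .refl _, by simpa only [Bool.false_eq_true, false_iff] using hp⟩

theorem or (d : Decides h σ P p) (d' : Decides h σ Q q) :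
    Decides h σ (.bin .or P Q) (p ∨ q) := by
  obtain ⟨b, hb, hp⟩ := d
  obtain ⟨b', hb', hq⟩ := d'
  exact ⟨b || b', (hb.bin trivial hb').tail (.bin rfl), by rw [Bool.or_eq_true, hp, hq]⟩

theorem eq_loc {l m : ℕ} (s : PureSteps h σ P (.loc l)) (s' : PureSteps h σ Q (.loc m)) :
    Decides h σ (.bin .eq P Q) (l = m) :=
  ⟨decide (l = m), (s.bin trivial s').tail (.bin rfl), decide_eq_true_iff⟩

theorem converges_assertTrue_iff (d : Decides h σ P p) :
    Converges ⟨h, assertTrue P, σ⟩ ↔ p := by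
  obtain ⟨b, hb, hp⟩ := d
  rw [assertTrue, hb.cond.converges_iff, ← hp]
  cases b with
  | true => exact iff_of_true ⟨_, .refl, trivial⟩ rfl
  | false => exact iff_of_false (fun ⟨_, hc⟩ => omega_not_evalsTo hc) Bool.false_ne_true

end Decides

open Classical in
/-- `reachProg b a t t'` is a program of type `Bool` that decides whether the reference `t'` with
contents of type `b` is reachable from the datum `t` of the finite type `a`, by searching `t` along
the structure of `a`. It returns `false` without comparing references when their types differ,
because the equality test would then be ill typed. -/
noncomputable def reachProg (b : Ty) : Ty → Term → Term → Term
  | .prod a₁ a₂, t, t' =>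
      .bin .or (reachProg b a₁ (.fst t) t') (reachProg b a₂ (.snd t) t')
  | .sum a₁ a₂, t, t' =>
      .caseOf t a₁ (reachProg b a₁ (.var 0) (t'.rename Nat.succ))
        a₂ (reachProg b a₂ (.var 0) (t'.rename Nat.succ))
  | .ref a, t, t' =>
      .bin .or (if Ty.Eqv a b then .bin .eq t t' else .bool false) (reachProg b a (.deref t) t')
  | _, _, _ => .bool false

theorem reachProg_hasType {S : ℕ → Option Ty} {a b : Ty} (ha : a.IsFinite) (hb : b.LC)
    {G : List Ty} {t : Term} {i : ℕ} (ht : HasType S G t a) (hi : G[i]? = some (.ref b)) :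
    HasType S G (reachProg b a t (.var i)) .bool := by
  induction a generalizing G t i with
  | unit | bool | nat => exact .bool _
  | prod a₁ a₂ ih₁ ih₂ => exact .bin .or (ih₁ ha.1 (.fst ht) hi) (ih₂ ha.2 (.snd ht) hi)
  | sum a₁ a₂ ih₁ ih₂ =>
      exact .caseOf ha.1.closed.1 ha.2.closed.1 ht (ih₁ (i := i + 1) ha.1 (.var rfl) hi)
        (ih₂ (i := i + 1) ha.2 (.var rfl) hi)
  | ref a ih =>
      refine .bin .or ?_ (ih ha (.deref ht) hi)
      split_ifs with h
      · exact .bin (.eqRef b) (ht.conv (.of_match (.ref h)) hb) (.var hi)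
      · exact .bool _
  | _ => exact ha.elim

theorem subst_reachProg (b a : Ty) (s : ℕ → Term) (t : Term) {t' : Term}
    (ht' : (∃ i, t' = .var i) ∨ ∃ l, t' = .loc l) :
    (reachProg b a t t').subst s = reachProg b a (t.subst s) (t'.subst s) := by
  induction a generalizing s t t' with
  | prod a₁ a₂ ih₁ ih₂ => simp only [reachProg, Term.subst, ih₁ s _ ht', ih₂ s _ ht']
  | sum a₁ a₂ ih₁ ih₂ =>
      have lift : (t'.rename Nat.succ).subst (Term.liftS s) = (t'.subst s).rename Nat.succ := by
        rcases ht' with ⟨i, rfl⟩ | ⟨l, rfl⟩ <;> rfl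
      have atom : (∃ i, t'.rename Nat.succ = .var i) ∨ ∃ l, t'.rename Nat.succ = .loc l := by
        rcases ht' with ⟨i, rfl⟩ | ⟨l, rfl⟩
        · exact .inl ⟨i + 1, rfl⟩
        · exact .inr ⟨l, rfl⟩
      simp only [reachProg, Term.subst, ih₁ _ _ atom, ih₂ _ _ atom, lift, Term.liftS]
  | ref a ih =>
      simp only [reachProg, Term.subst, ih s _ ht']
      split_ifs <;> rfl
  | _ => rfl

theorem decides_reachProg {S : ℕ → Option Ty} {Δ : Env} {M : Model} (hM : ModelTyping S Δ M)
    {h : Finset ℕ} {a b b' : Ty} (ha : a.IsFinite) {t V : Term} {l : ℕ} (hl : S l = some b')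
    (hb : Ty.Eqv b' b) (hV : V.IsValue) (hVa : HasType S [] V a) (ht : PureSteps h M.store t V) :
    Decides h M.store (reachProg b a t (.loc l)) (Ncl M.store V.fl l) := by
  induction a generalizing t V with
  | unit =>
      obtain rfl := hVa.eq_unit hV
      exact .false not_ncl_empty
  | bool =>
      obtain ⟨_, rfl⟩ := hVa.exists_bool hV
      exact .false not_ncl_empty
  | nat =>
      obtain ⟨_, rfl⟩ := hVa.exists_nat hV
      exact .false not_ncl_empty
  | prod a₁ a₂ ih₁ ih₂ =>
      obtain ⟨V₁, V₂, rfl, h₁, h₂⟩ := hVa.exists_pair hV ha.1.closed.1 ha.2.closed.1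
      exact ((ih₁ ha.1 hV.1 h₁ (ht.fst hV.1 hV.2)).or
        (ih₂ ha.2 hV.2 h₂ (ht.snd hV.1 hV.2))).congr ncl_union.symm
  | sum a₁ a₂ ih₁ ih₂ =>
      obtain ⟨c, d, W, rfl, hW⟩ | ⟨c, d, W, rfl, hW⟩ :=
        hVa.exists_inl_or_inr hV ha.1.closed.1 ha.2.closed.1
      · refine .of_pureSteps (ht.caseL hV) ?_
        rw [Term.subst1, Term.rename, subst_reachProg _ _ _ _ (.inr ⟨l, rfl⟩)]
        exact ih₁ (V := W) ha.1 hV hW (.refl W)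
      · refine .of_pureSteps (ht.caseR hV) ?_
        rw [Term.subst1, Term.rename, subst_reachProg _ _ _ _ (.inr ⟨l, rfl⟩)]
        exact ih₂ (V := W) ha.2 hV hW (.refl W)
  | ref a ih =>
      obtain ⟨m, a', rfl, hm, e⟩ := hVa.exists_loc hV
      obtain ⟨W, hW, hWv, hWt⟩ := hM.exists_store hm
      refine (Decides.or ?_ (ih ha hWv (hWt.conv e ha.closed.1) (ht.deref hW))).congr
        (ncl_singleton hW).symm
      split_ifs with hab
      · exact .eq_loc ht (.refl _)
      · refine .false ?_
        rintro rfl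
        cases hm.symm.trans hl
        exact hab (e.symm.trans hb)
  | _ => exact ha.elim

/-- A program of type `Unit` that converges if the reference `t'` is reachable from `t`, and
diverges otherwise. The abstractions evaluate `t'` once, so that `reachProg` is only applied to
a variable as its reference. -/
noncomputable def reachContext (a b : Ty) (t t' : Term) : Term :=
  .app (.app (.lam (.ref b) (.lam a (assertTrue (reachProg b a (.var 0) (.var 1))))) t') t

theorem reachContext_hasType {S : ℕ → Option Ty} {G : List Ty} {a b : Ty} {t t' : Term}
    (ha : a.IsFinite) (hb : b.LC) (ht : HasType S G t a) (ht' : HasType S G t' (.ref b)) :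
    HasType S G (reachContext a b t t') .unit :=
  .app (.app (.lam hb (.lam ha.closed.1
    (reachProg_hasType ha hb (.var rfl) rfl).assertTrue)) ht') ht

theorem subst_reachContext (a b : Ty) (s : ℕ → Term) (t t' : Term) :
    (reachContext a b t t').subst s = reachContext a b (t.subst s) (t'.subst s) := by
  simp only [reachContext, Term.subst, subst_assertTrue, subst_reachProg _ _ _ _ (.inl ⟨_, rfl⟩)]
  rfl

theorem pureSteps_reachContext {h : Finset ℕ} {σ : Store} {a b : Ty} {t t' V : Term} {l : ℕ}
    (hV : V.IsValue) (ht : PureSteps h σ t V) (ht' : PureSteps h σ t' (.loc l)) :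
    PureSteps h σ (reachContext a b t t') (assertTrue (reachProg b a V (.loc l))) := by
  have subst_loc : Term.subst1 (.loc l) (.lam a (assertTrue (reachProg b a (.var 0) (.var 1)))) =
      .lam a (assertTrue (reachProg b a (.var 0) (.loc l))) := by
    simp only [Term.subst1, Term.subst, subst_assertTrue, subst_reachProg _ _ _ _ (.inl ⟨_, rfl⟩)]
    rfl
  have subst_val : Term.subst1 V (assertTrue (reachProg b a (.var 0) (.loc l))) =
      assertTrue (reachProg b a V (.loc l)) := by
    simp only [Term.subst1, subst_assertTrue, subst_reachProg _ _ _ _ (.inr ⟨_, rfl⟩)]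
    rfl
  refine ((ht'.beta trivial).plug (.appL t)).trans ?_
  rw [subst_loc, ← subst_val]
  exact ht.beta hV

theorem converges_reachContext_iff {S : ℕ → Option Ty} {Δ : Env} {M : Model}
    (hM : ModelTyping S Δ M) {h : Finset ℕ} {a b : Ty} (ha : a.IsFinite) {t t' V : Term} {l : ℕ}
    (hl : HasType S [] (.loc l) (.ref b)) (hV : V.IsValue) (hVa : HasType S [] V a)
    (ht : PureSteps h M.store t V) (ht' : PureSteps h M.store t' (.loc l)) :
    Converges ⟨h, reachContext a b t t', M.store⟩ ↔ Ncl M.store V.fl l := by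
  obtain ⟨_, b', h₀, hb', e⟩ := hl.exists_loc trivial
  cases h₀
  rw [(pureSteps_reachContext hV ht ht').converges_iff]
  exact (decides_reachProg hM ha hb' e hV hVa (.refl V)).converges_assertTrue_iff

/-! ### Reachability and contextual congruence -/

/-- The program that extracts the `n`th component of the value of `t`, a nested tuple. -/
def proj : ℕ → Term → Term
  | 0, t => .fst t
  | n + 1, t => proj n (.snd t)

theorem subst_proj (s : ℕ → Term) (n : ℕ) : ∀ t, (proj n t).subst s = proj n (t.subst s) := by
  induction n with
  | zero => exact fun _ => rfl
  | succ _ ih => exact fun t => ih (.snd t)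

theorem proj_hasType {S : ℕ → Option Ty} {G : List Ty} {a : Ty} (as : List Ty) {n : ℕ} {t : Term}
    (ht : HasType S G t (tupleTy as)) (hn : as[n]? = some a) : HasType S G (proj n t) a := by
  induction as generalizing n t with
  | nil => simp at hn
  | cons b bs ih =>
      cases n with
      | zero => cases hn; exact .fst ht
      | succ n => exact ih (t := .snd t) (.snd ht) hn

theorem isValue_tuple {ξ : List Term} (h : ∀ V ∈ ξ, V.IsValue) : (tuple ξ).IsValue := by
  induction ξ with
  | nil => trivial
  | cons V ξ ih => exact ⟨h V (.head _), ih fun W hW => h W (.tail _ hW)⟩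

theorem pureSteps_proj {h : Finset ℕ} {σ : Store} {ξ : List Term} (hξ : ∀ V ∈ ξ, V.IsValue)
    {n : ℕ} {t V : Term} (ht : PureSteps h σ t (tuple ξ)) (hn : ξ[n]? = some V) :
    PureSteps h σ (proj n t) V := by
  induction ξ generalizing n t with
  | nil => simp at hn
  | cons W ξ ih =>
      have hW := hξ W (.head _)
      have hξ' : ∀ V ∈ ξ, V.IsValue := fun W hW => hξ W (.tail _ hW)
      cases n with
      | zero => cases hn; exact ht.fst hW (isValue_tuple hξ')
      | succ n => exact ih (t := .snd t) hξ' (ht.snd hW (isValue_tuple hξ')) hn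

namespace LTerm

/-- A logical term as a program over the tuple of the data of a model. -/
def ctxProg (ρ : Reading) (e : LTerm) : Term := e.progWith (fun x => proj (ρ.pos x) (.var 0)) ρ.tys

theorem HasType.ctxProg {Γ : FEnv} {Δ : Env} {ρ : Reading} {e : LTerm} {a : Ty}
    (h : e.HasType Γ a) (hρ : ρ.Interprets Γ Δ) :
    LocalState.HasType Δ.locs [tupleTy Δ.vars] (e.ctxProg ρ) (a.inst ρ.tys) :=
  h.progWith hρ.1 (fun x b hx => proj_hasType _ (.var rfl) (hρ.2.1 x b hx)) hρ.2.2

theorem pureSteps_ctxProg {S : ℕ → Option Ty} {Δ : Env} {M : Model} {ρ : Reading} {e : LTerm}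
    {V : Term} (h : Finset ℕ) (hM : ModelTyping S Δ M) (hV : e.den ρ M.env M.store = some V) :
    PureSteps h M.store ((e.ctxProg ρ).subst (Term.single (tuple M.env))) V := by
  refine (pureSteps_progWith (fun x V hx => ?_) (fun l V => hM.isValue_store) hV).2
  refine ⟨hM.isValue_env (List.mem_of_getElem? hx), ?_⟩
  rw [subst_proj]
  exact pureSteps_proj (fun V => hM.isValue_env) (.refl _) hx

end LTerm

/-- The location denoted by `e'` is reachable in the store of `M` from the value of `e`. -/
def Reaches (ρ : Reading) (M : Model) (e e' : LTerm) : Prop :=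
  ∃ V l, e.den ρ M.env M.store = some V ∧ e'.den ρ M.env M.store = some (.loc l) ∧
    Ncl M.store V.fl l

theorem reaches_iff_converges {Γ : FEnv} {Δ : Env} {ρ : Reading} {M : Model} {e e' : LTerm}
    {a b : Ty} (ha : a.IsFinite) (he : e.HasType Γ a) (he' : e'.HasType Γ (.ref b))
    (hρ : ρ.Interprets Γ Δ) (hM : IsModel Δ M) :
    Reaches ρ M e e' ↔ Converges ⟨M.hid, Term.subst1 (tuple M.env)
      (reachContext a (b.inst ρ.tys) (e.ctxProg ρ) (e'.ctxProg ρ)), M.store⟩ := by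
  obtain ⟨-, S, hS⟩ := isModel_iff.1 hM
  obtain ⟨V, hd, hV, ht⟩ := he.exists_den hρ hS
  obtain ⟨W, hd', hW, ht'⟩ := he'.exists_den hρ hS
  rw [ha.inst_eq] at ht
  obtain ⟨l, _, rfl, -⟩ := ht'.exists_loc hW
  rw [Term.subst1, subst_reachContext, converges_reachContext_iff hS ha ht' hV ht
    (LTerm.pureSteps_ctxProg _ hS hd) (LTerm.pureSteps_ctxProg _ hS hd')]
  refine ⟨?_, fun h => ⟨V, l, hd, hd', h⟩⟩
  rintro ⟨V', l', h, h', hn⟩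
  cases hd.symm.trans h
  cases hd'.symm.trans h'
  exact hn

theorem Reaches.of_modelEquiv {Γ : FEnv} {Δ : Env} {ρ : Reading} {M M' : Model} {e e' : LTerm}
    {a b : Ty} (ha : a.IsFinite) (he : e.HasType Γ a) (he' : e'.HasType Γ (.ref b))
    (hρ : ρ.Interprets Γ Δ) (hM : ModelEquiv Δ M M') (h : Reaches ρ M e e') :
    Reaches ρ M' e e' := by
  obtain ⟨-, S, hS⟩ := isModel_iff.1 hM.1
  have hb : (b.inst ρ.tys).LC := (he'.closed_inst hρ hS).1
  have ht := he.ctxProg hρ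
  rw [ha.inst_eq] at ht
  rw [reaches_iff_converges ha he he' hρ hM.2.1]
  rw [reaches_iff_converges ha he he' hρ hM.1] at h
  exact (hM.2.2 _ (reachContext_hasType ha hb ht (he'.ctxProg hρ))).1 h

theorem sat_reach_iff {Γ : FEnv} {Δ : Env} {ρ : Reading} {M : Model} {e e' : LTerm}
    {a b : Ty} (ha : a.IsFinite) (he : e.HasType Γ a) (he' : e'.HasType Γ (.ref b))
    (hρ : ρ.Interprets Γ Δ) (hM : IsModel Δ M) :
    (Formula.reach e e').Sat Δ M ρ ↔ Reaches ρ M e e' :=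
  ⟨fun h => h M (.refl hM), fun h _ hM' => h.of_modelEquiv ha he he' hρ hM'.symm⟩

/-! ### Equations -/

theorem tuple_append_annotEq (ξ : List Term) {V V' : Term} (h : V.AnnotEq V') :
    (tuple (ξ ++ [V])).AnnotEq (tuple (ξ ++ [V'])) := by
  induction ξ with
  | nil => exact .pair h (.refl _)
  | cons W ξ ih => exact .pair (.refl W) ih

theorem ModelEquiv.push_of_annotEq {S : ℕ → Option Ty} {Δ : Env} {M : Model} (hM : IsModel Δ M)
    (hS : ModelTyping S Δ M) {a : Ty} {V V' : Term} (ha : a.Closed) (hV : V.IsValue)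
    (hVa : HasType S [] V a) (hV' : V'.IsValue) (hVa' : HasType S [] V' a) (h : V.AnnotEq V') :
    ModelEquiv (Δ.snoc a) (M.push V) (M.push V') :=
  have hfin := (isModel_iff.1 hM).1
  ⟨isModel_iff.2 ⟨hfin, S, hS.push ha hV hVa⟩, isModel_iff.2 ⟨hfin, S, hS.push ha hV' hVa'⟩,
    fun N _ => converges_congr_of_annotEq
      (Term.AnnotEq.subst1 (tuple_append_annotEq M.env h) (.refl N))⟩

section

variable {Γ : FEnv} {Δ : Env} {ρ : Reading} {M : Model} {e e' f : LTerm} {a b : Ty} {k : ℕ}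

/-- The type annotations of injections are not observable, so `e = inᵢ(x)` holds also if the value
of `e` is an injection annotated with other, equivalent types. -/
theorem sat_eq_of_annotEq {V V' : Term} (he : e.HasType Γ a) (he' : e'.HasType Γ a)
    (hρ : ρ.Interprets Γ Δ) (hM : IsModel Δ M) (hV : e.den ρ M.env M.store = some V)
    (hV' : e'.den ρ M.env M.store = some V') (h : V.AnnotEq V') :
    (Formula.eq e e').Sat Δ M ρ := by
  obtain ⟨-, S, hS⟩ := isModel_iff.1 hM
  obtain ⟨W, hW, hWv, hWt⟩ := he.exists_den hρ hS
  obtain ⟨W', hW', hWv', hWt'⟩ := he'.exists_den hρ hS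
  cases hV.symm.trans hW
  cases hV'.symm.trans hW'
  exact ⟨_, V, V', hV, hV', .push_of_annotEq hM hS (he.closed_inst hρ hS) hWv hWt hWv' hWt' h⟩

theorem sat_eq_symm (h : (Formula.eq e f).Sat Δ M ρ) : (Formula.eq f e).Sat Δ M ρ := by
  obtain ⟨c, V, V', hV, hV', hm⟩ := h
  exact ⟨c, V', V, hV', hV, hm.symm⟩

theorem LTerm.den_bind_var {n : ℕ} {ξ : List Term} (hξ : ξ.length = n) (σ : Store) (V : Term) :
    (LTerm.var k).den (ρ.bind k n) (ξ ++ [V]) σ = some V := by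
  simp [LTerm.den, Reading.bind, ← hξ]

theorem reaches_bind_var_iff {V : Term} (he' : e'.HasType Γ b) (hk' : e'.VarsBelow k)
    (hρ : ρ.Interprets Γ Δ) (hM : M.env.length = Δ.vars.length)
    (hV : e.den ρ M.env M.store = some V) :
    Reaches (ρ.bind k Δ.vars.length) (M.push V) (.var k) e' ↔ Reaches ρ M e e' := by
  simp only [Reaches, Model.push, LTerm.den_bind_var hM, he'.den_bind M.store hk' hρ hM, hV]

/-- Naming the two sides by a fresh variable turns the equation into a congruence of models, which
preserves reachability from that variable. -/
theorem Reaches.of_sat_eq (he : e.HasType Γ a) (ha : a.IsFinite) (he' : e'.HasType Γ (.ref b))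
    (hρ : ρ.Interprets Γ Δ) (h : (Formula.eq e f).Sat Δ M ρ) (hr : Reaches ρ M f e') :
    Reaches ρ M e e' := by
  obtain ⟨c, V, V', hV, hV', hm⟩ := h
  obtain ⟨-, S, hS⟩ := isModel_iff.1 hm.1
  obtain ⟨hS, hc, hVv, hVc⟩ := hS.of_push
  obtain ⟨W, hW, -, hWa⟩ := he.exists_den hρ hS
  cases hV.symm.trans hW
  rw [ha.inst_eq] at hWa
  have hca : Ty.Eqv c a := hWa.eqv_of_isFinite ha hVv hVc
  obtain ⟨k, hk⟩ := e'.exists_varsBelow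
  rw [← reaches_bind_var_iff he' hk hρ hS.length_env hV'] at hr
  rw [← reaches_bind_var_iff he' hk hρ hS.length_env hV]
  exact hr.of_modelEquiv ha ((LTerm.HasType.bind_var Γ k c).conv hca ha.closed.1) (he'.bind hk c)
    (hρ.bind_of_eq k (Ty.inst_eq_of_not_hasTVar hc.2)) hm.symm

end

/-! ### Existential quantifiers -/

/-- The closed value `V` is the result, in the model `M` of type `Δ`, of a program of type `a` that
leaves every model of type `Δ` unchanged up to congruence: `V` is in the range of the quantifiers
`∀ x^a` and `∃ x^a`. -/
def Definable (Δ : Env) (M : Model) (a : Ty) (V : Term) : Prop :=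
  ∃ L, Functional Δ L a ∧ Runs Δ M L a (M.push V)

theorem Definable.isModel_push {Δ : Env} {M : Model} {a : Ty} {V : Term}
    (h : Definable Δ M a V) : IsModel (Δ.snoc a) (M.push V) := by
  obtain ⟨_, -, hR⟩ := h
  exact hR.2.1

theorem Model.pop_push (M : Model) (V : Term) : (M.push V).pop = M := by
  simp [Model.push, Model.pop]

theorem functional_of_pureSteps {Δ : Env} {L : Term} {a : Ty} (hL : HasType Δ.locs Δ.vars L a)
    (h : ∀ S M, ModelTyping S Δ M → ∃ V, (V.IsValue ∨ ∃ b, V = omega b) ∧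
      PureSteps ∅ M.store (L.subst (Term.envSubst M.env)) V) : Functional Δ L a := by
  refine ⟨hL, ?_⟩
  rintro M _ hM ⟨-, -, h', W, σ, hev, rfl⟩
  obtain ⟨-, S, hS⟩ := isModel_iff.1 hM
  obtain ⟨V, hV, st⟩ := h S M hS
  have hev := st.evalsTo_iff.1 hev
  rcases hV with hV | ⟨b, rfl⟩
  · obtain h | ⟨d, st', -⟩ := hev.1.cases_head
    · cases h
      rw [Finset.union_empty]
      exact (M.pop_push _).symm ▸ .refl hM
    · exact (st'.not_isValue hV).elim
  · exact (omega_not_evalsTo hev).elim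

theorem runs_push {S : ℕ → Option Ty} {Δ : Env} {M : Model} {L V : Term} {a : Ty}
    (hM : IsModel Δ M) (hS : ModelTyping S Δ M) (hL : HasType Δ.locs Δ.vars L a) (ha : a.Closed)
    (hV : V.IsValue) (hVa : HasType S [] V a)
    (st : PureSteps ∅ M.store (L.subst (Term.envSubst M.env)) V) : Runs Δ M L a (M.push V) :=
  ⟨hL, isModel_iff.2 ⟨(isModel_iff.1 hM).1, S, hS.push ha hV hVa⟩, ∅, V, M.store,
    ⟨st.steps, hV⟩, by rw [Finset.union_empty, Model.push]⟩

section

variable {S : ℕ → Option Ty} {Γ : FEnv} {Δ : Env} {ρ : Reading} {M : Model} {e : LTerm} {a b : Ty}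

theorem LTerm.HasType.exists_den_pair (he : e.HasType Γ (.prod a b)) (hρ : ρ.Interprets Γ Δ)
    (hS : ModelTyping S Δ M) : ∃ V W, e.den ρ M.env M.store = some (.pair V W) ∧
      V.IsValue ∧ W.IsValue ∧ LocalState.HasType S [] V (a.inst ρ.tys) ∧
      LocalState.HasType S [] W (b.inst ρ.tys) := by
  have hc := he.closed_inst hρ hS
  obtain ⟨_, hd, hVv, ht⟩ := he.exists_den hρ hS
  obtain ⟨V, W, rfl, hV, hW⟩ := LocalState.HasType.exists_pair ht hVv hc.1.1 hc.1.2
  exact ⟨V, W, hd, hVv.1, hVv.2, hV, hW⟩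

theorem LTerm.HasType.exists_den_inl_or_inr (he : e.HasType Γ (.sum a b))
    (hρ : ρ.Interprets Γ Δ) (hS : ModelTyping S Δ M) :
    (∃ c d V, e.den ρ M.env M.store = some (.inl c d V) ∧ V.IsValue ∧
      LocalState.HasType S [] V (a.inst ρ.tys)) ∨
    ∃ c d V, e.den ρ M.env M.store = some (.inr c d V) ∧ V.IsValue ∧
      LocalState.HasType S [] V (b.inst ρ.tys) := by
  have hc := he.closed_inst hρ hS
  obtain ⟨_, hd, hV, ht⟩ := he.exists_den hρ hS
  obtain ⟨c, d, W, rfl, hW⟩ | ⟨c, d, W, rfl, hW⟩ :=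
    LocalState.HasType.exists_inl_or_inr ht hV hc.1.1 hc.1.2
  · exact .inl ⟨c, d, W, hd, hV, hW⟩
  · exact .inr ⟨c, d, W, hd, hV, hW⟩

theorem definable_fst {V W : Term} (he : e.HasType Γ (.prod a b)) (hρ : ρ.Interprets Γ Δ)
    (hM : IsModel Δ M) (hd : e.den ρ M.env M.store = some (.pair V W)) :
    Definable Δ M (a.inst ρ.tys) V := by
  obtain ⟨-, S, hS⟩ := isModel_iff.1 hM
  have hc := he.closed_inst hρ hS
  have hL : HasType Δ.locs Δ.vars (.fst (e.prog ρ)) (a.inst ρ.tys) := .fst (he.prog hρ)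
  refine ⟨_, functional_of_pureSteps hL fun T N hT => ?_, ?_⟩
  · obtain ⟨V, W, hd, hV, hW, -⟩ := he.exists_den_pair hρ hT
    exact ⟨V, .inl hV, (LTerm.pureSteps_prog _ hT hd).fst hV hW⟩
  · obtain ⟨_, _, hd', hV, hW, hVa, -⟩ := he.exists_den_pair hρ hS
    cases hd.symm.trans hd'
    exact runs_push hM hS hL ⟨hc.1.1, fun X hX => hc.2 X (.inl hX)⟩ hV hVa
      ((LTerm.pureSteps_prog _ hS hd).fst hV hW)

theorem definable_snd {V W : Term} (he : e.HasType Γ (.prod a b)) (hρ : ρ.Interprets Γ Δ)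
    (hM : IsModel Δ M) (hd : e.den ρ M.env M.store = some (.pair V W)) :
    Definable Δ M (b.inst ρ.tys) W := by
  obtain ⟨-, S, hS⟩ := isModel_iff.1 hM
  have hc := he.closed_inst hρ hS
  have hL : HasType Δ.locs Δ.vars (.snd (e.prog ρ)) (b.inst ρ.tys) := .snd (he.prog hρ)
  refine ⟨_, functional_of_pureSteps hL fun T N hT => ?_, ?_⟩
  · obtain ⟨V, W, hd, hV, hW, -⟩ := he.exists_den_pair hρ hT
    exact ⟨W, .inl hW, (LTerm.pureSteps_prog _ hT hd).snd hV hW⟩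
  · obtain ⟨_, _, hd', hV, hW, -, hWb⟩ := he.exists_den_pair hρ hS
    cases hd.symm.trans hd'
    exact runs_push hM hS hL ⟨hc.1.2, fun X hX => hc.2 X (.inr hX)⟩ hW hWb
      ((LTerm.pureSteps_prog _ hS hd).snd hV hW)

/-- The witness diverges on right injections, and is therefore functional on all models. -/
theorem definable_of_inl {c d : Ty} {V : Term} (he : e.HasType Γ (.sum a b))
    (hρ : ρ.Interprets Γ Δ) (hM : IsModel Δ M) (hd : e.den ρ M.env M.store = some (.inl c d V)) :
    Definable Δ M (a.inst ρ.tys) V := by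
  obtain ⟨-, S, hS⟩ := isModel_iff.1 hM
  have hc := he.closed_inst hρ hS
  have hL : HasType Δ.locs Δ.vars (.caseOf (e.prog ρ) (a.inst ρ.tys) (.var 0) (b.inst ρ.tys)
      (omega (a.inst ρ.tys))) (a.inst ρ.tys) :=
    .caseOf hc.1.1 hc.1.2 (he.prog hρ) (.var rfl) (omega_hasType hc.1.1)
  refine ⟨_, functional_of_pureSteps hL fun T N hT => ?_, ?_⟩
  · obtain ⟨_, _, V, hd, hV, -⟩ | ⟨_, _, V, hd, hV, -⟩ := he.exists_den_inl_or_inr hρ hT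
    · exact ⟨V, .inl hV, (LTerm.pureSteps_prog _ hT hd).caseL hV⟩
    · exact ⟨omega _, .inr ⟨_, rfl⟩, (LTerm.pureSteps_prog _ hT hd).caseR hV⟩
  · obtain ⟨_, _, _, hd', hV, hVa⟩ | ⟨_, _, _, hd', -⟩ := he.exists_den_inl_or_inr hρ hS
    · cases hd.symm.trans hd'
      exact runs_push hM hS hL ⟨hc.1.1, fun X hX => hc.2 X (.inl hX)⟩ hV hVa
        ((LTerm.pureSteps_prog _ hS hd).caseL hV)
    · cases hd.symm.trans hd'

theorem definable_of_inr {c d : Ty} {V : Term} (he : e.HasType Γ (.sum a b))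
    (hρ : ρ.Interprets Γ Δ) (hM : IsModel Δ M) (hd : e.den ρ M.env M.store = some (.inr c d V)) :
    Definable Δ M (b.inst ρ.tys) V := by
  obtain ⟨-, S, hS⟩ := isModel_iff.1 hM
  have hc := he.closed_inst hρ hS
  have hL : HasType Δ.locs Δ.vars (.caseOf (e.prog ρ) (a.inst ρ.tys) (omega (b.inst ρ.tys))
      (b.inst ρ.tys) (.var 0)) (b.inst ρ.tys) :=
    .caseOf hc.1.1 hc.1.2 (he.prog hρ) (omega_hasType hc.1.2) (.var rfl)
  refine ⟨_, functional_of_pureSteps hL fun T N hT => ?_, ?_⟩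
  · obtain ⟨_, _, V, hd, hV, -⟩ | ⟨_, _, V, hd, hV, -⟩ := he.exists_den_inl_or_inr hρ hT
    · exact ⟨omega _, .inr ⟨_, rfl⟩, (LTerm.pureSteps_prog _ hT hd).caseL hV⟩
    · exact ⟨V, .inl hV, (LTerm.pureSteps_prog _ hT hd).caseR hV⟩
  · obtain ⟨_, _, _, hd', -⟩ | ⟨_, _, _, hd', hV, hVb⟩ := he.exists_den_inl_or_inr hρ hS
    · cases hd.symm.trans hd'
    · cases hd.symm.trans hd'
      exact runs_push hM hS hL ⟨hc.1.2, fun X hX => hc.2 X (.inr hX)⟩ hV hVb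
        ((LTerm.pureSteps_prog _ hS hd).caseR hV)

end

section

variable {Δ : Env} {ρ : Reading} {M : Model} {C D : Formula}

theorem sat_or : (Formula.or C D).Sat Δ M ρ ↔ C.Sat Δ M ρ ∨ D.Sat Δ M ρ := by
  rw [or_iff_not_and_not]
  rfl

theorem not_sat_fls (hM : IsModel Δ M) : ¬ Formula.fls.Sat Δ M ρ := by
  obtain ⟨hf, S, hS⟩ := isModel_iff.1 hM
  refine fun h => h ⟨.nat, .nat 1, .nat 1, rfl, rfl, .refl (isModel_iff.2 ⟨hf, S, ?_⟩)⟩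
  exact hS.push ⟨trivial, fun _ => id⟩ trivial (.nat 1)

theorem sat_ex {x : ℕ} {a : Ty} : (Formula.ex x a C).Sat Δ M ρ ↔
    ∃ L M', Functional Δ L (a.inst ρ.tys) ∧ Runs Δ M L (a.inst ρ.tys) M' ∧
      C.Sat (Δ.snoc (a.inst ρ.tys)) M' (ρ.bind x Δ.vars.length) := by
  simp only [Formula.ex, Formula.Sat, not_forall, not_not, exists_prop]

theorem sat_ex_of_definable {x : ℕ} {a : Ty} {V : Term} (hV : Definable Δ M (a.inst ρ.tys) V)
    (hC : C.Sat (Δ.snoc (a.inst ρ.tys)) (M.push V) (ρ.bind x Δ.vars.length)) :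
    (Formula.ex x a C).Sat Δ M ρ := by
  obtain ⟨L, hL, hR⟩ := hV
  exact sat_ex.2 ⟨L, _, hL, hR, hC⟩

end

/-! ### Reachability from components -/

section

variable {Γ : FEnv} {Δ : Env} {ρ : Reading} {M : Model} {e f e' : LTerm} {a b : Ty}

theorem reaches_pair_iff (he : e.HasType Γ a) (hf : f.HasType Γ b) (hρ : ρ.Interprets Γ Δ)
    (hM : IsModel Δ M) :
    Reaches ρ M (.pair e f) e' ↔ Reaches ρ M e e' ∨ Reaches ρ M f e' := by
  obtain ⟨-, S, hS⟩ := isModel_iff.1 hM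
  obtain ⟨V, hV, -⟩ := he.exists_den hρ hS
  obtain ⟨W, hW, -⟩ := hf.exists_den hρ hS
  simp only [Reaches, LTerm.den, hV, hW, Option.bind_some, Option.map_some, Option.some.injEq,
    exists_and_left, exists_eq_left', ← exists_or, ← and_or_left]
  exact exists_congr fun l => and_congr_right fun _ => ncl_union

theorem reaches_inl_iff : Reaches ρ M (.inl a b e) e' ↔ Reaches ρ M e e' := by
  simp [Reaches, LTerm.den, Term.fl]

theorem reaches_inr_iff : Reaches ρ M (.inr a b e) e' ↔ Reaches ρ M e e' := by
  simp [Reaches, LTerm.den, Term.fl]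

theorem Reaches.of_deref (h : Reaches ρ M (.deref e) e') : Reaches ρ M e e' := by
  obtain ⟨W, l, hW, hl, hn⟩ := h
  obtain ⟨V, hV, hW⟩ := Option.bind_eq_some_iff.1 hW
  split at hW
  · exact ⟨_, l, hV, hl, (ncl_singleton hW).2 (.inr hn)⟩
  · cases hW

theorem sat_eq_or_reaches_deref (he : e.HasType Γ (.ref a)) (hρ : ρ.Interprets Γ Δ)
    (hM : IsModel Δ M) (h : Reaches ρ M e e') :
    (Formula.eq e e').Sat Δ M ρ ∨ Reaches ρ M (.deref e) e' := by
  obtain ⟨V, l, hV, hl, hn⟩ := h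
  obtain ⟨-, S, hS⟩ := isModel_iff.1 hM
  obtain ⟨V', hd, hVv, hVt⟩ := he.exists_den hρ hS
  cases hV.symm.trans hd
  obtain ⟨m, a', rfl, hm, -⟩ := hVt.exists_loc hVv
  obtain ⟨W, hW, -⟩ := hS.exists_store hm
  rcases (ncl_singleton hW).1 hn with rfl | hn
  · exact .inl ⟨_, _, _, hV, hl,
      .push_of_annotEq hM hS (he.closed_inst hρ hS) hVv hVt hVv hVt (.refl _)⟩
  · exact .inr ⟨W, l, Option.bind_eq_some_iff.2 ⟨_, hV, hW⟩, hl, hn⟩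

theorem not_reaches_of_base (ha : a = .unit ∨ a = .bool ∨ a = .nat) (he : e.HasType Γ a)
    (hρ : ρ.Interprets Γ Δ) (hM : IsModel Δ M) : ¬ Reaches ρ M e e' := by
  rintro ⟨V, l, hV, -, hn⟩
  obtain ⟨-, S, hS⟩ := isModel_iff.1 hM
  obtain ⟨W, hW, hv, ht⟩ := he.exists_den hρ hS
  cases hV.symm.trans hW
  suffices V.fl = ∅ from not_ncl_empty (this ▸ hn)
  rcases ha with rfl | rfl | rfl
  · rw [HasType.eq_unit ht hv, Term.fl]
  · obtain ⟨_, rfl⟩ := HasType.exists_bool ht hv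
    rfl
  · obtain ⟨_, rfl⟩ := HasType.exists_nat ht hv
    rfl

end

/-! ### Formulae about components -/

/-- `e` of finite type `a` and `e'` of type `Ref c` are well typed over `Γ`, and the names
`k, k + 1, …` are fresh for them: the side conditions under which `e ↪° e'` and `e ↪ᵢ e'` are
formed with bound names from `k` on. -/
structure ReachTyping (Γ : FEnv) (k : ℕ) (a c : Ty) (e e' : LTerm) : Prop where
  finite : a.IsFinite
  source : e.HasType Γ a
  target : e'.HasType Γ (.ref c)
  source_below : e.VarsBelow k
  target_below : e'.VarsBelow k

namespace ReachTyping

variable {Γ : FEnv} {k : ℕ} {a b c : Ty} {e e' : LTerm}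

theorem bind (h : ReachTyping Γ k a c e e') (b : Ty) :
    ReachTyping (Γ.bind k b) (k + 1) a c e e' :=
  ⟨h.finite, h.source.bind h.source_below b, h.target.bind h.target_below b,
    h.source_below.mono k.le_succ, h.target_below.mono k.le_succ⟩

theorem bind_var (h : ReachTyping Γ k a c e e') (hb : b.IsFinite) :
    ReachTyping (Γ.bind k b) (k + 1) b c (.var k) e' :=
  ⟨hb, .bind_var Γ k b, (h.bind b).target, k.lt_succ_self, (h.bind b).target_below⟩

theorem fst (h : ReachTyping Γ k (.prod a b) c e e') :
    ReachTyping ((Γ.bind k a).bind (k + 1) b) (k + 2) a c (.var k) e' :=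
  (h.bind_var h.finite.1).bind b

theorem snd (h : ReachTyping Γ k (.prod a b) c e e') :
    ReachTyping ((Γ.bind k a).bind (k + 1) b) (k + 2) b c (.var (k + 1)) e' :=
  (h.bind a).bind_var h.finite.2

theorem inl (h : ReachTyping Γ k (.sum a b) c e e') :
    ReachTyping (Γ.bind k a) (k + 1) a c (.var k) e' :=
  h.bind_var h.finite.1

theorem inr (h : ReachTyping Γ k (.sum a b) c e e') :
    ReachTyping (Γ.bind k b) (k + 1) b c (.var k) e' :=
  h.bind_var h.finite.2

theorem deref (h : ReachTyping Γ k (.ref a) c e e') : ReachTyping Γ k a c (.deref e) e' :=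
  ⟨h.finite, .deref h.source, h.target, h.source_below, h.target_below⟩

theorem reaches_push_iff {Δ : Env} {ρ : Reading} {M : Model} (h : ReachTyping Γ k a c e e')
    (hρ : ρ.Interprets Γ Δ) (hM : M.env.length = Δ.vars.length) (V : Term) :
    Reaches (ρ.bind k Δ.vars.length) (M.push V) e e' ↔ Reaches ρ M e e' := by
  simp only [Reaches, Model.push, h.source.den_bind M.store h.source_below hρ hM,
    h.target.den_bind M.store h.target_below hρ hM]

end ReachTyping

namespace Formula

/-- `∃ x₁^a, x₂^b. (e = ⟨x₁, x₂⟩ ∧ (C ∨ D))`, with `x₁` and `x₂` named `k` and `k + 1`: the common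
shape of the clauses for products in `e ↪° e'` and `e ↪ᵢ e'`. -/
def exProd (k : ℕ) (a b : Ty) (e : LTerm) (C D : Formula) : Formula :=
  ex k a (ex (k + 1) b (and (eq e (.pair (.var k) (.var (k + 1)))) (or C D)))

/-- `∃ x^a. (e = in₁(x) ∧ C)`, with `x` named `k`: the left half of the clauses for sums. -/
def exInl (k : ℕ) (a b : Ty) (e : LTerm) (C : Formula) : Formula :=
  ex k a (and (eq e (.inl a b (.var k))) C)

/-- `∃ x^b. (e = in₂(x) ∧ C)`, with `x` named `k`: the right half of the clauses for sums. -/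
def exInr (k : ℕ) (a b : Ty) (e : LTerm) (C : Formula) : Formula :=
  ex k b (and (eq e (.inr a b (.var k))) C)

/-- `C ⊃ e ↪ e'` is valid for models of `Γ`, with `e ↪ e'` read in the given model only. -/
def EntailsReach (Γ : FEnv) (C : Formula) (e e' : LTerm) : Prop :=
  ∀ ⦃Δ : Env⦄ ⦃ρ : Reading⦄ ⦃M : Model⦄, ρ.Interprets Γ Δ → IsModel Δ M → C.Sat Δ M ρ →
    Reaches ρ M e e'

/-- `e ↪ e' ⊃ C` is valid for models of `Γ`, with `e ↪ e'` read in the given model only. -/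
def EntailedByReach (Γ : FEnv) (C : Formula) (e e' : LTerm) : Prop :=
  ∀ ⦃Δ : Env⦄ ⦃ρ : Reading⦄ ⦃M : Model⦄, ρ.Interprets Γ Δ → IsModel Δ M → Reaches ρ M e e' →
    C.Sat Δ M ρ

end Formula

section

open Formula (EntailsReach EntailedByReach exProd exInl exInr)

variable {Γ : FEnv} {k : ℕ} {a b c : Ty} {e f e' : LTerm} {C D : Formula}

theorem entailsReach_fls : EntailsReach Γ .fls e e' :=
  fun _ _ _ _ hM h => (not_sat_fls hM h).elim

theorem entailsReach_or (hC : EntailsReach Γ C e e') (hD : EntailsReach Γ D e e') :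
    EntailsReach Γ (.or C D) e e' :=
  fun _ _ _ hρ hM h => (sat_or.1 h).elim (hC hρ hM) (hD hρ hM)

theorem entailsReach_ex (h : ReachTyping Γ k a c e e')
    (hC : EntailsReach (Γ.bind k b) C e e') : EntailsReach Γ (.ex k b C) e e' := by
  intro Δ ρ M hρ hM hs
  obtain ⟨L, M', hL, hR, hs⟩ := sat_ex.1 hs
  have hr : Reaches _ M' e e' := hC (hρ.bind k b) hR.2.1 hs
  have hequiv : ModelEquiv Δ M M'.pop := hL.2 M M' hM hR
  obtain ⟨-, -, h', V, σ, -, rfl⟩ := hR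
  let N : Model := ⟨M.hid ∪ h', M.env, σ⟩
  replace hequiv : ModelEquiv Δ M N := N.pop_push V ▸ hequiv
  refine .of_modelEquiv h.finite h.source h.target hρ hequiv.symm ?_
  exact (h.reaches_push_iff (M := N) hρ hM.length_env V).1 hr

theorem entailsReach_eq_and (h : ReachTyping Γ k a c e e') (hC : EntailsReach Γ C f e') :
    EntailsReach Γ (.and (.eq e f) C) e e' :=
  fun _ _ _ hρ hM hs => .of_sat_eq h.source h.finite h.target hρ hs.1 (hC hρ hM hs.2)

theorem entailsReach_eq (h : ReachTyping Γ k a c e e') : EntailsReach Γ (.eq e e') e e' := by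
  intro Δ ρ M hρ hM hs
  obtain ⟨-, S, hS⟩ := isModel_iff.1 hM
  obtain ⟨_, hd, hv, ht⟩ := h.target.exists_den hρ hS
  obtain ⟨l, -, rfl, -⟩ := ht.exists_loc hv
  exact .of_sat_eq h.source h.finite h.target hρ hs ⟨_, l, hd, hd, .base rfl⟩

theorem entailsReach_exProd (h : ReachTyping Γ k (.prod a b) c e e')
    (hC : EntailsReach ((Γ.bind k a).bind (k + 1) b) C (.var k) e')
    (hD : EntailsReach ((Γ.bind k a).bind (k + 1) b) D (.var (k + 1)) e') :
    EntailsReach Γ (exProd k a b e C D) e e' := by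
  refine entailsReach_ex h (entailsReach_ex (h.bind a)
    (entailsReach_eq_and ((h.bind a).bind b) fun Δ ρ M hρ hM hs => ?_))
  exact (reaches_pair_iff h.fst.source h.snd.source hρ hM).2
    ((sat_or.1 hs).imp (hC hρ hM) (hD hρ hM))

theorem entailsReach_exInl (h : ReachTyping Γ k (.sum a b) c e e')
    (hC : EntailsReach (Γ.bind k a) C (.var k) e') : EntailsReach Γ (exInl k a b e C) e e' :=
  entailsReach_ex h (entailsReach_eq_and (h.bind a)
    fun _ _ _ hρ hM hs => reaches_inl_iff.2 (hC hρ hM hs))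

theorem entailsReach_exInr (h : ReachTyping Γ k (.sum a b) c e e')
    (hC : EntailsReach (Γ.bind k b) C (.var k) e') : EntailsReach Γ (exInr k a b e C) e e' :=
  entailsReach_ex h (entailsReach_eq_and (h.bind b)
    fun _ _ _ hρ hM hs => reaches_inr_iff.2 (hC hρ hM hs))

theorem entailedByReach_of_base (ha : a = .unit ∨ a = .bool ∨ a = .nat)
    (h : ReachTyping Γ k a c e e') : EntailedByReach Γ C e e' :=
  fun _ _ _ hρ hM hr => (not_reaches_of_base ha h.source hρ hM hr).elim

theorem LTerm.den_pair {ρ : Reading} {ξ : List Term} {σ : Store} {V W : Term}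
    (hV : e.den ρ ξ σ = some V) (hW : f.den ρ ξ σ = some W) :
    (LTerm.pair e f).den ρ ξ σ = some (.pair V W) := by
  rw [LTerm.den, hV, hW]
  rfl

theorem entailedByReach_exProd (h : ReachTyping Γ k (.prod a b) c e e')
    (hC : EntailedByReach ((Γ.bind k a).bind (k + 1) b) C (.var k) e')
    (hD : EntailedByReach ((Γ.bind k a).bind (k + 1) b) D (.var (k + 1)) e') :
    EntailedByReach Γ (exProd k a b e C D) e e' := by
  intro Δ ρ M hρ hM hr
  obtain ⟨-, S, hS⟩ := isModel_iff.1 hM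
  obtain ⟨V, W, hd, -⟩ := h.source.exists_den_pair hρ hS
  have hV : Definable Δ M _ V := definable_fst h.source hρ hM hd
  have hρ₁ := hρ.bind k a
  have hM₁ := hV.isModel_push
  have hd₁ := (h.source.den_bind M.store h.source_below hρ hM.length_env V).trans hd
  have hW : Definable _ (M.push V) _ W := definable_snd (h.bind a).source hρ₁ hM₁ hd₁
  have hρ₂ := hρ₁.bind (k + 1) b
  have hM₂ := hW.isModel_push
  have hx := ((LTerm.HasType.bind_var Γ k a).den_bind M.store k.lt_succ_self hρ₁ hM₁.length_env
    W).trans (LTerm.den_bind_var hM.length_env M.store V)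
  have hp := LTerm.den_pair hx (LTerm.den_bind_var hM₁.length_env M.store W)
  have hd₂ := ((h.bind a).source.den_bind M.store (h.bind a).source_below hρ₁ hM₁.length_env
    W).trans hd₁
  have hpair := h.fst.source.pair h.snd.source
  have heq := sat_eq_of_annotEq ((h.bind a).bind b).source hpair hρ₂ hM₂ hd₂ hp (.refl _)
  have hr₂ := ((h.bind a).reaches_push_iff hρ₁ hM₁.length_env W).2
    ((h.reaches_push_iff hρ hM.length_env V).2 hr)
  have hr' := (reaches_pair_iff h.fst.source h.snd.source hρ₂ hM₂).1
    (.of_sat_eq hpair h.finite h.fst.target hρ₂ (sat_eq_symm heq) hr₂)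
  exact sat_ex_of_definable hV (sat_ex_of_definable hW
    ⟨heq, sat_or.2 (hr'.imp (hC hρ₂ hM₂) (hD hρ₂ hM₂))⟩)

section

variable {Δ : Env} {ρ : Reading} {M : Model} {c₁ c₂ : Ty} {V : Term}

theorem sat_exInl_of_reaches (h : ReachTyping Γ k (.sum a b) c e e')
    (hC : EntailedByReach (Γ.bind k a) C (.var k) e') (hρ : ρ.Interprets Γ Δ) (hM : IsModel Δ M)
    (hd : e.den ρ M.env M.store = some (.inl c₁ c₂ V)) (hr : Reaches ρ M e e') :
    (exInl k a b e C).Sat Δ M ρ := by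
  have hV : Definable Δ M _ V := definable_of_inl h.source hρ hM hd
  have hρ' := hρ.bind k a
  have hd' := (h.source.den_bind M.store h.source_below hρ hM.length_env V).trans hd
  have hi : (LTerm.inl a b (.var k)).den (ρ.bind k Δ.vars.length) (M.push V).env M.store = _ :=
    Option.map_eq_some_iff.2 ⟨V, LTerm.den_bind_var hM.length_env M.store V, rfl⟩
  have hinl := h.inl.source.inl h.inl.finite.closed.1 h.inr.finite.closed.1
  have heq := sat_eq_of_annotEq (h.bind a).source hinl hρ' hV.isModel_push hd' hi
    (.inl _ _ _ _ (.refl V))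
  have hr' := (h.reaches_push_iff hρ hM.length_env V).2 hr
  exact sat_ex_of_definable hV ⟨heq, hC hρ' hV.isModel_push
    (reaches_inl_iff.1 (hr'.of_sat_eq hinl h.finite h.inl.target hρ' (sat_eq_symm heq)))⟩

theorem sat_exInr_of_reaches (h : ReachTyping Γ k (.sum a b) c e e')
    (hC : EntailedByReach (Γ.bind k b) C (.var k) e') (hρ : ρ.Interprets Γ Δ) (hM : IsModel Δ M)
    (hd : e.den ρ M.env M.store = some (.inr c₁ c₂ V)) (hr : Reaches ρ M e e') :
    (exInr k a b e C).Sat Δ M ρ := by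
  have hV : Definable Δ M _ V := definable_of_inr h.source hρ hM hd
  have hρ' := hρ.bind k b
  have hd' := (h.source.den_bind M.store h.source_below hρ hM.length_env V).trans hd
  have hi : (LTerm.inr a b (.var k)).den (ρ.bind k Δ.vars.length) (M.push V).env M.store = _ :=
    Option.map_eq_some_iff.2 ⟨V, LTerm.den_bind_var hM.length_env M.store V, rfl⟩
  have hinr := h.inr.source.inr h.inl.finite.closed.1 h.inr.finite.closed.1
  have heq := sat_eq_of_annotEq (h.bind b).source hinr hρ' hV.isModel_push hd' hi
    (.inr _ _ _ _ (.refl V))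
  have hr' := (h.reaches_push_iff hρ hM.length_env V).2 hr
  exact sat_ex_of_definable hV ⟨heq, hC hρ' hV.isModel_push
    (reaches_inr_iff.1 (hr'.of_sat_eq hinr h.finite h.inr.target hρ' (sat_eq_symm heq)))⟩

end

theorem entailedByReach_exInl_or_exInr (h : ReachTyping Γ k (.sum a b) c e e')
    (hC : EntailedByReach (Γ.bind k a) C (.var k) e')
    (hD : EntailedByReach (Γ.bind k b) D (.var k) e') :
    EntailedByReach Γ (.or (exInl k a b e C) (exInr k a b e D)) e e' := by
  intro Δ ρ M hρ hM hr
  obtain ⟨-, S, hS⟩ := isModel_iff.1 hM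
  obtain ⟨_, _, V, hd, -⟩ | ⟨_, _, V, hd, -⟩ := h.source.exists_den_inl_or_inr hρ hS
  · exact sat_or.2 (.inl (sat_exInl_of_reaches h hC hρ hM hd hr))
  · exact sat_or.2 (.inr (sat_exInr_of_reaches h hD hρ hM hd hr))

theorem entailedByReach_or_left (hC : EntailedByReach Γ C e e') :
    EntailedByReach Γ (.or C D) e e' :=
  fun _ _ _ hρ hM hr => sat_or.2 (.inl (hC hρ hM hr))

end

/-! ### The formulae `e ↪° e'` and `e ↪ᵢ e'` -/

section

open Formula (EntailsReach EntailedByReach reachO reachIn)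

variable {Γ : FEnv} {k : ℕ} {a c : Ty} {e e' : LTerm}

theorem reachO_entailsReach (h : ReachTyping Γ k a c e e') :
    EntailsReach Γ (reachO a k e e') e e' := by
  induction a generalizing Γ k e with
  | unit | bool | nat => exact entailsReach_fls
  | prod a b iha ihb => exact entailsReach_exProd h (iha h.fst) (ihb h.snd)
  | sum a b iha ihb =>
      exact entailsReach_or (entailsReach_exInl h (iha h.inl)) (entailsReach_exInr h (ihb h.inr))
  | ref a ih =>
      exact entailsReach_or (entailsReach_eq h) fun _ _ _ hρ hM hs => (ih h.deref hρ hM hs).of_deref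
  | _ => exact h.finite.elim

theorem reachO_entailedByReach (h : ReachTyping Γ k a c e e') :
    EntailedByReach Γ (reachO a k e e') e e' := by
  induction a generalizing Γ k e with
  | unit => exact entailedByReach_of_base (.inl rfl) h
  | bool => exact entailedByReach_of_base (.inr (.inl rfl)) h
  | nat => exact entailedByReach_of_base (.inr (.inr rfl)) h
  | prod a b iha ihb => exact entailedByReach_exProd h (iha h.fst) (ihb h.snd)
  | sum a b iha ihb => exact entailedByReach_exInl_or_exInr h (iha h.inl) (ihb h.inr)
  | ref a ih =>
      exact fun _ _ _ hρ hM hr => sat_or.2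
        ((sat_eq_or_reaches_deref h.source hρ hM hr).imp_right (ih h.deref hρ hM))
  | _ => exact h.finite.elim

theorem reachIn_entailsReach (n : ℕ) (h : ReachTyping Γ k a c e e') :
    EntailsReach Γ (reachIn n a k e e') e e' := by
  induction n generalizing Γ k a e with
  | zero => exact entailsReach_eq h
  | succ n ih =>
      cases a with
      | unit | bool | nat => exact entailsReach_fls
      | prod a b => exact entailsReach_or (entailsReach_exProd h (ih h.fst) (ih h.snd)) (ih h)
      | sum a b =>
          exact entailsReach_or (entailsReach_or (entailsReach_exInl h (ih h.inl))
            (entailsReach_exInr h (ih h.inr))) (ih h)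
      | ref a =>
          exact entailsReach_or (fun _ _ _ hρ hM hs => (ih h.deref hρ hM hs).of_deref) (ih h)
      | _ => exact h.finite.elim

/-- The number of nested products, sums and references in a finite type: reachability from a value
of type `a` takes at most `a.depth` steps. -/
def Ty.depth : Ty → ℕ
  | .prod a b | .sum a b => max a.depth b.depth + 1
  | .ref a => a.depth + 1
  | _ => 0

theorem sat_reachIn_of_sat_eq {Δ : Env} {ρ : Reading} {M : Model} (n : ℕ)
    (h : (Formula.eq e e').Sat Δ M ρ) : (reachIn n (.ref a) k e e').Sat Δ M ρ := by
  induction n with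
  | zero => exact h
  | succ n ih => exact sat_or.2 (.inr ih)

theorem reachIn_entailedByReach {n : ℕ} (hn : a.depth ≤ n) (h : ReachTyping Γ k a c e e') :
    EntailedByReach Γ (reachIn n a k e e') e e' := by
  induction a generalizing Γ k e n with
  | unit => exact entailedByReach_of_base (.inl rfl) h
  | bool => exact entailedByReach_of_base (.inr (.inl rfl)) h
  | nat => exact entailedByReach_of_base (.inr (.inr rfl)) h
  | prod a b iha ihb =>
      obtain ⟨n, rfl⟩ := Nat.exists_eq_add_of_le' (Nat.le_of_add_left_le hn)
      obtain ⟨ha, hb⟩ := max_le_iff.1 (Nat.le_of_succ_le_succ hn)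
      exact entailedByReach_or_left (entailedByReach_exProd h (iha ha h.fst) (ihb hb h.snd))
  | sum a b iha ihb =>
      obtain ⟨n, rfl⟩ := Nat.exists_eq_add_of_le' (Nat.le_of_add_left_le hn)
      obtain ⟨ha, hb⟩ := max_le_iff.1 (Nat.le_of_succ_le_succ hn)
      exact entailedByReach_or_left (entailedByReach_exInl_or_exInr h (iha ha h.inl) (ihb hb h.inr))
  | ref a ih =>
      obtain ⟨n, rfl⟩ := Nat.exists_eq_add_of_le' (Nat.le_of_add_left_le hn)
      intro Δ ρ M hρ hM hr
      rcases sat_eq_or_reaches_deref h.source hρ hM hr with heq | hr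
      · exact sat_reachIn_of_sat_eq (n + 1) heq
      · exact sat_or.2 (.inl (ih (Nat.le_of_succ_le_succ hn) h.deref hρ hM hr))
  | _ => exact h.finite.elim

theorem sat_reachO_iff {Δ : Env} {ρ : Reading} {M : Model} (h : ReachTyping Γ k a c e e')
    (hρ : ρ.Interprets Γ Δ) (hM : IsModel Δ M) :
    (reachO a k e e').Sat Δ M ρ ↔ Reaches ρ M e e' :=
  ⟨reachO_entailsReach h hρ hM, reachO_entailedByReach h hρ hM⟩

theorem exists_sat_reachIn_iff {Δ : Env} {ρ : Reading} {M : Model} (h : ReachTyping Γ k a c e e')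
    (hρ : ρ.Interprets Γ Δ) (hM : IsModel Δ M) :
    (∃ n, (reachIn n a k e e').Sat Δ M ρ) ↔ Reaches ρ M e e' :=
  ⟨fun ⟨n, hn⟩ => reachIn_entailsReach n h hρ hM hn,
    fun hr => ⟨a.depth, reachIn_entailedByReach le_rfl h hρ hM hr⟩⟩

end

/-! ### Elimination of reachability predicates -/

theorem IsModel.push_loc {Δ : Env} {M : Model} {l : ℕ} {a : Ty}
    (hM : IsModel ⟨Δ.vars, Function.update Δ.locs l (some a)⟩ M) :
    IsModel (Env.snoc ⟨Δ.vars, Function.update Δ.locs l (some a)⟩ (.ref a)) (M.push (.loc l)) := by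
  obtain ⟨hf, S, hS⟩ := isModel_iff.1 hM
  have hl : S l = some a := hS.locs l a (Function.update_self ..)
  have hc := hS.locs_closed l a hl
  exact isModel_iff.2 ⟨hf, S, hS.push ⟨hc.1, hc.2⟩ trivial (.loc hl)⟩

theorem IsModel.evolves {Δ Δ' : Env} {M M' : Model} (hM : IsModel Δ M) (h : Evolves Δ M Δ' M') :
    IsModel Δ' M' := by
  cases h with
  | refl => exact hM
  | run _ hr => exact hr.2.1

namespace Formula

theorem noReach_reachO (a : Ty) (k : ℕ) (e e' : LTerm) : (reachO a k e e').NoReach := by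
  induction a generalizing k e <;> simp_all [reachO, NoReach, or, ex, fls]

theorem wf_reachO {Γ : FEnv} {k : ℕ} {a c : Ty} {e e' : LTerm} (h : ReachTyping Γ k a c e e') :
    (reachO a k e e').WF Γ := by
  induction a generalizing Γ k e with
  | unit | bool | nat => exact ⟨⟨.nat, .nat 1⟩, .nat, .nat 1⟩
  | prod a b iha ihb =>
      have hpair := h.fst.source.pair h.snd.source
      exact ⟨h.fst.finite.closed.1, h.snd.finite.closed.1,
        ⟨⟨_, ((h.bind a).bind b).source⟩, _, hpair⟩, iha h.fst, ihb h.snd⟩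
  | sum a b iha ihb =>
      have ha := h.inl.finite.closed.1
      have hb := h.inr.finite.closed.1
      exact ⟨⟨ha, ⟨⟨_, (h.bind a).source⟩, _, h.inl.source.inl ha hb⟩, iha h.inl⟩,
        hb, ⟨⟨_, (h.bind b).source⟩, _, h.inr.source.inr ha hb⟩, ihb h.inr⟩
  | ref a ih => exact ⟨⟨⟨_, h.source⟩, _, h.target⟩, ih h.deref⟩
  | _ => exact h.finite.elim

namespace Equivalent

variable {Γ : FEnv} {x : ℕ} {a b : Ty} {e e' : LTerm} {C C' D D' : Formula}

theorem neg (h : Equivalent Γ C C') : Equivalent Γ (.neg C) (.neg C') :=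
  fun Δ ρ M hρ hM => not_congr (h Δ ρ M hρ hM)

theorem and (hC : Equivalent Γ C C') (hD : Equivalent Γ D D') :
    Equivalent Γ (.and C D) (.and C' D') :=
  fun Δ ρ M hρ hM => and_congr (hC Δ ρ M hρ hM) (hD Δ ρ M hρ hM)

theorem all (h : Equivalent (Γ.bind x a) C C') : Equivalent Γ (.all x a C) (.all x a C') :=
  fun _ _ _ hρ _ => forall₄_congr fun _ _ _ hR => h _ _ _ (hρ.bind x a) hR.2.1

theorem nuAll (h : Equivalent (Γ.bind x (.ref a)) C C') :
    Equivalent Γ (.nuAll x a C) (.nuAll x a C') :=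
  fun _ ρ _ hρ _ => forall₅_congr fun _ _ hl _ hM' => forall_congr' fun _ =>
    h _ _ _ ((hρ.updateLocs hl (a.inst ρ.tys)).bind_of_eq x rfl) hM'.push_loc

theorem allT {X : ℕ} (hX : Γ.FreshT X) (h : Equivalent Γ C C') :
    Equivalent Γ (.allT X C) (.allT X C') :=
  fun _ _ _ hρ hM => forall₂_congr fun _ ha => h _ _ _ (hρ.bindT hX ha) hM

theorem allCon (h : Equivalent Γ C C') : Equivalent Γ (.allCon e C) (.allCon e C') :=
  fun _ _ _ hρ _ => forall₅_congr fun _ _ _ _ _ => forall₅_congr fun _ _ _ _ hM' =>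
    h _ _ _ hρ hM'

theorem eval (h : Equivalent (Γ.bind x b) C C') :
    Equivalent Γ (.eval e e' x b C) (.eval e e' x b C') :=
  fun _ _ _ hρ _ => exists_congr fun _ => and_congr_right fun hR =>
    h _ _ _ (hρ.bind x b) hR.2.1

theorem located {ws : List (LTerm × Ty)} (h : Equivalent (Γ.bind x b) C C') :
    Equivalent Γ (.located e e' x b C ws) (.located e e' x b C' ws) :=
  fun _ _ _ hρ _ => exists_congr fun _ => and_congr_right fun hR => and_congr_left fun _ =>
    h _ _ _ (hρ.bind x b) hR.2.1

theorem box (h : Equivalent Γ C C') : Equivalent Γ (.box C) (.box C') :=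
  fun _ _ _ hρ hM => forall₃_congr fun _ _ hE => h _ _ _ (hρ.evolves hE) (hM.evolves hE)

theorem reach_reachO {k : ℕ} (h : ReachTyping Γ k a b e e') :
    Equivalent Γ (reach e e') (reachO a k e e') :=
  fun _ _ _ hρ hM =>
    (sat_reach_iff h.finite h.source h.target hρ hM).trans (sat_reachO_iff h hρ hM).symm

end Equivalent

theorem exists_noReach_of_reach {Γ : FEnv} {e e' : LTerm} (h : (reach e e').WF Γ)
    (hf : (reach e e').FiniteReach Γ) :
    ∃ C : Formula, C.WF Γ ∧ C.NoReach ∧ Equivalent Γ (reach e e') C := by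
  obtain ⟨a, ha, he⟩ := hf
  obtain ⟨-, b, he'⟩ := h
  obtain ⟨i, hi⟩ := e.exists_varsBelow
  obtain ⟨j, hj⟩ := e'.exists_varsBelow
  have h : ReachTyping Γ (max i j) a b e e' :=
    ⟨ha, he, he', hi.mono (le_max_left i j), hj.mono (le_max_right i j)⟩
  exact ⟨reachO a (max i j) e e', wf_reachO h, noReach_reachO .., .reach_reachO h⟩

theorem exists_noReach (C : Formula) {Γ : FEnv} (h : C.WF Γ) (hf : C.FiniteReach Γ) :
    ∃ C' : Formula, C'.WF Γ ∧ C'.NoReach ∧ Equivalent Γ C C' := by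
  induction C generalizing Γ with
  | eq e e' => exact ⟨eq e e', h, trivial, fun _ _ _ _ _ => .rfl⟩
  | neg C ih =>
      obtain ⟨C', hwf, hno, heq⟩ := ih h hf
      exact ⟨neg C', hwf, hno, heq.neg⟩
  | and C D ihC ihD =>
      obtain ⟨C', hwfC, hnoC, heqC⟩ := ihC h.1 hf.1
      obtain ⟨D', hwfD, hnoD, heqD⟩ := ihD h.2 hf.2
      exact ⟨and C' D', ⟨hwfC, hwfD⟩, ⟨hnoC, hnoD⟩, heqC.and heqD⟩
  | all x a C ih =>
      obtain ⟨C', hwf, hno, heq⟩ := ih h.2 hf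
      exact ⟨all x a C', ⟨h.1, hwf⟩, hno, heq.all⟩
  | nuAll x a C ih =>
      obtain ⟨C', hwf, hno, heq⟩ := ih h.2 hf
      exact ⟨nuAll x a C', ⟨h.1, hwf⟩, hno, heq.nuAll⟩
  | allT X C ih =>
      obtain ⟨C', hwf, hno, heq⟩ := ih h.2 hf
      exact ⟨allT X C', ⟨h.1, hwf⟩, hno, heq.allT h.1⟩
  | allCon e C ih =>
      obtain ⟨C', hwf, hno, heq⟩ := ih h.2 hf
      exact ⟨allCon e C', ⟨h.1, hwf⟩, hno, heq.allCon⟩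
  | eval e e' x b C ih =>
      obtain ⟨C', hwf, hno, heq⟩ := ih h.2.2 hf
      exact ⟨eval e e' x b C', ⟨h.1, h.2.1, hwf⟩, hno, heq.eval⟩
  | located e e' x b C ws ih =>
      obtain ⟨C', hwf, hno, heq⟩ := ih h.2.2.1 hf
      exact ⟨located e e' x b C' ws, ⟨h.1, h.2.1, hwf, h.2.2.2⟩, hno, heq.located⟩
  | box C ih =>
      obtain ⟨C', hwf, hno, heq⟩ := ih h hf
      exact ⟨box C', hwf, hno, heq.box⟩
  | reach e e' => exact exists_noReach_of_reach h hf

end Formula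

end LocalState

theorem mainTheorem5 :
    (∀ (Γ : LocalState.FEnv) (C : LocalState.Formula), C.WF Γ → C.FiniteReach Γ →
      ∃ C' : LocalState.Formula, C'.WF Γ ∧ C'.NoReach ∧ LocalState.Formula.Equivalent Γ C C') ∧
    (∀ (Γ : LocalState.FEnv) (a b : LocalState.Ty) (e e' : LocalState.LTerm) (k : ℕ),
      a.IsFinite → e.HasType Γ a → e'.HasType Γ (.ref b) → e.VarsBelow k → e'.VarsBelow k →
      ∀ (Δ : LocalState.Env) (ρ : LocalState.Reading) (M : LocalState.Model),
        ρ.Interprets Γ Δ → LocalState.IsModel Δ M →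
        ((LocalState.Formula.reach e e').Sat Δ M ρ ↔
          ∃ i : ℕ, (LocalState.Formula.reachIn i a k e e').Sat Δ M ρ) ∧
        ((LocalState.Formula.reachO a k e e').Sat Δ M ρ ↔
          ∃ i : ℕ, (LocalState.Formula.reachIn i a k e e').Sat Δ M ρ) ∧
        ((LocalState.Formula.reach e e').Sat Δ M ρ ↔
          (LocalState.Formula.reachO a k e e').Sat Δ M ρ)) := by
  refine ⟨fun _ C => C.exists_noReach, ?_⟩
  intro Γ a b e e' k ha he he' hk hk' Δ ρ M hρ hM
  have h : LocalState.ReachTyping Γ k a b e e' := ⟨ha, he, he', hk, hk'⟩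
  rw [LocalState.exists_sat_reachIn_iff h hρ hM, LocalState.sat_reach_iff ha he he' hρ hM,
    LocalState.sat_reachO_iff h hρ hM]
  exact ⟨.rfl, .rfl, .rfl⟩
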